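/- Let $m\ge 0$, $\lambda>0$, $0<\alpha<\tfrac12$, and let $(a_n)_{n\ge1}$ be a positive sequence with $\lim_{n\to\infty} n^{\alpha}a_n=1$. Write $\mathbb{N}^*=\{1,2,\dots\}$ and let $\{\delta_n^{\pm}: n\in\mathbb{N}^*\}$ be the canonical basis of $\ell^2(\mathbb{N}^*,\mathbb{C}^2)$. Let $V_{\omega,i}(n)$, $n\in\mathbb{N}^*$, $i=1,2$, be integrable real random variables on a probability space, and consider the Dirac operator $D_\omega=D+V_\omega$, $$D(\phi^+,\phi^-)=(m\phi^++d\phi^-,\ d^*\phi^+-m\phi^-),\qquad (du)_n=u_n-u_{n+1},\quad (d^*u)_n=u_n-u_{n-1},\quad u_0=0,$$ $$V_\omega\delta_n^+=V_{\omega,1}(n)\delta_n^+,\qquad V_\omega\delta_n^-=V_{\omega,2}(n)\delta_n^-.$$ Assume: - (A1) the random variables $V_{\omega,i}(n)$, $n\in\mathbb{N}^*$, $i=1,2$, are independent; - (A2) $\mathbb{E}[V_{\omega,i}(n)]=0$; - (A3a) $\mathbb{E}[V_{\omega,i}(n)^2]^{1/2}=\lambda a_n$; - (A5) there exist $C>0$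 and $\varepsilon>0$ such that $\mathbb{E}[|V_{\omega,i}(n)|^3]\le C n^{-(2\alpha+\varepsilon)}$ for all $n$ and $i$; - (A6a) there exist $p>1$, $\gamma\ge0$ and $C>0$ such that each $V_{\omega,i}(n)$ has a density $\rho_{n,i}$ with $\int_{\mathbb{R}}\rho_{n,i}(y)^p\,dy\le C\lambda^{-\gamma}a_n^{-\gamma}$. For $L\ge1$ let $\Lambda_L=\{(u,+):1\le u\le L-1\}\cup\{(u,-):1\le u\le L\}$ and $\Lambda'_L=\{(u,\pm):1\le u\le L\}$. Let $D_{\omega,L}$ and $D'_{\omega,L}$ be the restrictions of $D_\omega$ to $\ell^2(\Lambda_L)$ and $\ell^2(\Lambda'_L)$ (compressions by the coordinate projections), and let $$G_{\omega,L}(u,\sigma;n,\sigma';E)=\langle\delta_u^\sigma,(D_{\omega,L}-E)^{-1}\delta_n^{\sigma'}\rangle,\qquad G'_{\omega,L}(u,\sigma;n,\sigma';E)=\langle\delta_u^\sigma,(D'_{\omega,L}-E)^{-1}\delta_n^{\sigma'}\rangle$$ be their Green's functions, the resolvents being extended by $0$ outside the box. Let $I\subset(-\sqrt{m^2+4},-m)\cup(m,\sqrt{m^2+4})$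 be a compact interval. Then, for every $L\ge1$ and $E\in I$, the operators $D_{\omega,L}-E$ and $D'_{\omega,L}-E$ are almost surely invertible. Moreover, there exists $s_0>0$ such that for every $s\in(0,s_0]$ and every $u\in\mathbb{N}^*$ there are constants $c>0$ and $C>0$ with $$\mathbb{E}\big[|G_{\omega,L}(u,\sigma;n,-;E)|^s\big]\le C\lambda^{-2s}a_n^{-2s}e^{-cn^{1-2\alpha}},\qquad \mathbb{E}\big[|G'_{\omega,L}(u,\sigma;n,+;E)|^s\big]\le C\lambda^{-2s}a_n^{-2s}e^{-cn^{1-2\alpha}}$$ for all $L\ge u$, all $1\le n\le L$, all $E\in I$ and all $\sigma\in\{+,-\}$. Here $s_0$ does not depend on $u$, and $c$, $C$ do not depend on $L$, $n$, $E$, $\sigma$; all constants may depend on the fixed model (including $\lambda$, $\alpha$, $m$ and the laws of the $V_{\omega,i}(n)$) and on $I$. -/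

import Mathlib

open MeasureTheory ProbabilityTheory Filter Topology

namespace DecayingDirac

/-- The spin labels `+` and `-`. -/
inductive Spin
  | plus
  | minus
  deriving DecidableEq

instance : Fintype Spin :=
  ⟨{Spin.plus, Spin.minus}, fun σ => by cases σ <;> simp⟩

/-- A point `(n, σ)` with `n ∈ ℕ* = {1, 2, …}` and `σ ∈ {+, -}`; it labels the canonical
basis vector `δ_n^σ`. -/
abbrev Site : Type := ℕ+ × Spin

/-- The difference operator `(d u)_n = u_n - u_{n+1}`. -/
def d (u : ℕ+ → ℂ) (n : ℕ+) : ℂ := u n - u (n + 1)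

/-- The difference operator `(d^* u)_n = u_n - u_{n-1}`, with the convention `u_0 = 0`. -/
def dStar (u : ℕ+ → ℂ) (n : ℕ+) : ℂ := u n - if n = 1 then 0 else u (n - 1)

/-- The Dirac operator with mass `m` and (real, diagonal) potential `v`,
`(φ⁺, φ⁻) ↦ (m φ⁺ + d φ⁻, d^* φ⁺ - m φ⁻) + v (φ⁺, φ⁻)`.
It is a local operator, so it makes sense on all spinor sequences, whether or not `v` is
bounded; only its matrix elements in the canonical basis are used below. -/
def dirac (m : ℝ) (v : Site → ℝ) (Φ : Site → ℂ) : Site → ℂ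
  | (n, Spin.plus) =>
      (m : ℂ) * Φ (n, Spin.plus) + d (fun k => Φ (k, Spin.minus)) n
        + (v (n, Spin.plus) : ℂ) * Φ (n, Spin.plus)
  | (n, Spin.minus) =>
      dStar (fun k => Φ (k, Spin.plus)) n - (m : ℂ) * Φ (n, Spin.minus)
        + (v (n, Spin.minus) : ℂ) * Φ (n, Spin.minus)

/-- The box `Λ_L = {(u,+) : 1 ≤ u ≤ L - 1} ∪ {(u,-) : 1 ≤ u ≤ L}`. -/
def box (L : ℕ+) : Finset Site :=
  (Finset.Icc 1 L ×ˢ Finset.univ).filter fun x => x.2 = Spin.plus → x.1 < L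

/-- The box `Λ'_L = {(u,±) : 1 ≤ u ≤ L}`. -/
def box' (L : ℕ+) : Finset Site := Finset.Icc 1 L ×ˢ Finset.univ

/-- The restriction `P_Λ D P_Λ` of the Dirac operator to `ℓ²(Λ)` for a finite set `Λ` of sites,
as the matrix of its elements `⟨δ_x, D δ_y⟩`. -/
def boxDirac (m : ℝ) (v : Site → ℝ) (Λ : Finset Site) : Matrix Λ Λ ℂ :=
  Matrix.of fun x y => dirac m v (Pi.single (y : Site) (1 : ℂ)) x

/-- `E` is not an eigenvalue of the restriction of the Dirac operator to `Λ`, that is, the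
resolvent `(P_Λ D P_Λ - E)⁻¹` exists on `ℓ²(Λ)`. -/
def HasResolvent (m : ℝ) (v : Site → ℝ) (Λ : Finset Site) (E : ℝ) : Prop :=
  IsUnit (boxDirac m v Λ - (E : ℂ) • (1 : Matrix Λ Λ ℂ))

/-- The Green's function `⟨δ_x, (P_Λ D P_Λ - E)⁻¹ δ_y⟩` of the box `Λ`, where the resolvent on
`ℓ²(Λ)` is extended by zero to the other sites. -/
noncomputable def green (m : ℝ) (v : Site → ℝ) (Λ : Finset Site) (E : ℝ) (x y : Site) : ℂ :=
  if h : x ∈ Λ ∧ y ∈ Λ then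
    (boxDirac m v Λ - (E : ℂ) • (1 : Matrix Λ Λ ℂ))⁻¹ ⟨x, h.1⟩ ⟨y, h.2⟩
  else 0

/-- The set `(-√(m²+4), -m) ∪ (m, √(m²+4))`. -/
def openBands (m : ℝ) : Set ℝ :=
  Set.Ioo (-√(m ^ 2 + 4)) (-m) ∪ Set.Ioo m (√(m ^ 2 + 4))

/-- The random variable `X` has a density `ρ` with `∫ ρ^p ≤ B`. -/
def HasLpDensity {Ω : Type*} [MeasurableSpace Ω] (P : Measure Ω) (X : Ω → ℝ) (p B : ℝ) : Prop :=
  ∃ ρ : ℝ → ℝ, (∀ y, 0 ≤ ρ y) ∧ Integrable ρ ∧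
    (∀ A : Set ℝ, MeasurableSet A → P (X ⁻¹' A) = ∫⁻ y in A, ENNReal.ofReal (ρ y)) ∧
    ∫⁻ y, ENNReal.ofReal (ρ y ^ p) ≤ ENNReal.ofReal B

end DecayingDirac

/-! Enumerated as (1,-), (1,+), (2,-), (2,+), …, the sites form a chain on which `D - E` is
tridiagonal. Put μ² = (E-m)/(E+m) and c = (E+m)μ, so that c² = E²-m² lies in (0,4). Up to explicit
factors, solutions of the eigenvalue equation follow the recursion u_{k+1} = (c + z_k) u_k -
u_{k-1}, where z_k is -μ or -1/μ times the potential at site k (`eq_kap_mul_state`). Both boxes are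
initial segments of the chain.

On an initial segment, for j ≤ k, |G(j,k)| is comparable to |u_j / u_k| |G(k,k)| (`green_mul_eq`).
Here u_j and u_k involve only the potentials before k, while G(k,k), as a function of the potential
y at k, is bounded by 1/|y + a|. The L^p density therefore integrates out G(k,k) at a fractional
power 2t (`lintegral_green_le`). In the same way the potential at k-1 serves to replace |u_k|^{-2t}
by Q_{k-1}^{-t}, where Q = p² - cpu + u² is the form preserved by the free recursion
(`lintegral_shear_snd_le`). It remains to show that E[|u_j|^{2t} Q_k^{-t}] decays like exp(-κ ∑
β_i), with β_i = λ²a² the variance at site i (`state_moment_decay`).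

This decay is a second-order effect. A noise of variance θβ multiplies the conditional mean of
Q^{-t} by 1 - tθβ (x + (4-c²)x²/2) + O(t²β) up to o(β), where x = u²/Q - 2/(4-c²); the third-moment
assumption controls the remainder. The linear term has no sign, but it is a coboundary of the free
map, so a correction of relative size β to Q^{-t} removes it. The quadratic term has the right sign
and cannot vanish at two consecutive steps because c ≠ 0 (`sq_add_sq_dev_ge`). For small t the
corrected function contracts by 1 - κβ at each step (`Params.drift_le`, `Params.exists_lyap_decay`)
as soon as β is small and varies slowly; the finitely many earlier steps cost a constant.

Since ∑ β_i up to site n is at least of order n^{1-2α}, the polynomial losses a_n^{-γ} coming from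
the densities are absorbed (`chain_factor_le`). Jensen's inequality passes to smaller exponents, and
the symmetry of the Green's function covers the case j > k. -/

namespace DecayingDirac

/-! ### The invariant quadratic form of the free recursion. -/

/-- The quadratic form preserved by the free recursion `u_{k+1} = c u_k - u_{k-1}`. -/
def qf (c p u : ℝ) : ℝ := p ^ 2 - c * p * u + u ^ 2

lemma qf_shear (c p u z : ℝ) :
    qf c u ((c + z) * u - p) = qf c p u + z * (u * (c * u - 2 * p)) + z ^ 2 * u ^ 2 := by
  unfold qf; ring

lemma sq_snd_le_qf {c δ : ℝ} (p u : ℝ) (hδ : 0 < δ) (hd : δ ≤ 4 - c ^ 2) :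
    u ^ 2 ≤ 4 / δ * qf c p u := by
  have h : 4 * qf c p u = (2 * p - c * u) ^ 2 + (4 - c ^ 2) * u ^ 2 := by unfold qf; ring
  rw [div_mul_eq_mul_div, le_div_iff₀ hδ, h]
  nlinarith [sq_nonneg (2 * p - c * u), sq_nonneg u]

lemma qf_comm (c p u : ℝ) : qf c p u = qf c u p := by unfold qf; ring

lemma sq_fst_le_qf {c δ : ℝ} (p u : ℝ) (hδ : 0 < δ) (hd : δ ≤ 4 - c ^ 2) :
    p ^ 2 ≤ 4 / δ * qf c p u := by
  rw [qf_comm]; exact sq_snd_le_qf u p hδ hd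

lemma abs_mul_le_qf {c δ : ℝ} (p u : ℝ) (hδ : 0 < δ) (hd : δ ≤ 4 - c ^ 2) :
    |p * u| ≤ 4 / δ * qf c p u := by
  have h1 := sq_fst_le_qf p u hδ hd
  have h2 := sq_snd_le_qf p u hδ hd
  rw [abs_le]; constructor <;> nlinarith [sq_nonneg (p - u), sq_nonneg (p + u)]

lemma qf_pos {c p u : ℝ} (hd : 0 < 4 - c ^ 2) (h : (p, u) ≠ 0) : 0 < qf c p u := by
  have h1 := sq_fst_le_qf p u hd le_rfl
  have h2 := sq_snd_le_qf p u hd le_rfl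
  have h4 : 0 < 4 / (4 - c ^ 2) := by positivity
  by_contra hn
  push Not at hn
  have hp : p ^ 2 = 0 := le_antisymm (h1.trans (mul_nonpos_of_nonneg_of_nonpos h4.le hn)) (sq_nonneg _)
  have hu : u ^ 2 = 0 := le_antisymm (h2.trans (mul_nonpos_of_nonneg_of_nonpos h4.le hn)) (sq_nonneg _)
  apply h
  ext
  · simpa using hp
  · simpa using hu

lemma qf_le {c : ℝ} (p u : ℝ) (hd : 0 < 4 - c ^ 2) : qf c p u ≤ 2 * (p ^ 2 + u ^ 2) := by
  unfold qf
  nlinarith [sq_nonneg (p + c / 2 * u), sq_nonneg (u + c / 2 * p), sq_nonneg u, sq_nonneg p]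

lemma shear_ne_zero {c p u z : ℝ} (h : (p, u) ≠ 0) : (u, (c + z) * u - p) ≠ 0 := by
  intro h0
  have h1 : u = 0 := congrArg Prod.fst h0
  have h2 : (c + z) * u - p = 0 := congrArg Prod.snd h0
  apply h
  subst h1
  ext
  · simpa using h2
  · rfl

/-! ### Expansion of small negative powers. -/

lemma abs_log_one_add_sub_le {X : ℝ} (hX : |X| ≤ 1 / 2) :
    |-X + X ^ 2 / 2 + Real.log (1 + X)| ≤ 2 * |X| ^ 3 := by
  have hlog := Real.abs_log_sub_add_sum_range_le (x := -X) (by rw [abs_neg]; linarith) 2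
  simp only [Finset.sum_range_succ, Finset.sum_range_zero, sub_neg_eq_add, abs_neg] at hlog
  calc _ = |0 + (-X) ^ (0 + 1) / ((0 : ℕ) + 1 : ℝ) + (-X) ^ (1 + 1) / ((1 : ℕ) + 1 : ℝ)
          + Real.log (1 + X)| := by
        congr 1; push_cast; ring
    _ ≤ _ := hlog
    _ ≤ _ := by
        have h3 : 0 ≤ |X| ^ 3 := by positivity
        rw [div_le_iff₀ (by linarith), show 2 + 1 = 3 from rfl]
        nlinarith [mul_nonneg h3 (sub_nonneg.2 hX)]

lemma abs_log_one_add_le {X : ℝ} (hX : |X| ≤ 1 / 2) : |Real.log (1 + X)| ≤ 2 * |X| := by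
  obtain ⟨hl1, hl2⟩ := abs_le.1 (abs_log_one_add_sub_le hX)
  have h0 := abs_nonneg X
  have hXs : X ^ 2 = |X| ^ 2 := (sq_abs X).symm
  have hX22 : |X| ^ 2 ≤ |X| / 2 := by nlinarith
  have hX3 : |X| ^ 3 ≤ |X| / 4 := by
    calc |X| ^ 3 = |X| * |X| ^ 2 := by ring
      _ ≤ |X| * (1 / 2) ^ 2 := by gcongr
      _ = _ := by ring
  have h1 := le_abs_self X
  have h2 := neg_abs_le X
  have h3 := sq_nonneg X
  rw [abs_le]; constructor <;> linarith

lemma rpow_neg_eq_exp {r t : ℝ} (hr : 0 < r) : r ^ (-t) = Real.exp (-(t * Real.log r)) := by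
  rw [Real.rpow_def_of_pos hr]; ring_nf

lemma one_add_rpow_neg_le {X t : ℝ} (hX : |X| ≤ 1 / 2) (ht0 : 0 < t) (ht1 : t ≤ 1) :
    (1 + X) ^ (-t) ≤ 1 - t * (X - X ^ 2 / 2 - 2 * |X| ^ 3) + 4 * t ^ 2 * X ^ 2 := by
  have hr0 : 0 < 1 + X := by linarith [neg_abs_le X]
  obtain ⟨hl1, hl2⟩ := abs_le.1 (abs_log_one_add_sub_le hX)
  have hlog := abs_log_one_add_le hX
  have hexp := Real.abs_exp_sub_one_sub_id_le (x := -(t * Real.log (1 + X))) (by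
    rw [abs_neg, abs_mul, abs_of_pos ht0]
    calc t * |Real.log (1 + X)| ≤ 1 * (2 * |X|) := by gcongr
      _ ≤ 1 := by linarith)
  have hexp2 := (abs_le.1 hexp).2
  have hsq : (Real.log (1 + X)) ^ 2 ≤ 4 * X ^ 2 := by
    rw [← sq_abs X, ← sq_abs (Real.log _)]
    calc |Real.log (1 + X)| ^ 2 ≤ (2 * |X|) ^ 2 := by gcongr
      _ = _ := by ring
  rw [rpow_neg_eq_exp hr0]
  have a1 : t * (X - X ^ 2 / 2 - 2 * |X| ^ 3) ≤ t * Real.log (1 + X) := by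
    gcongr; linarith
  have a2 : (-(t * Real.log (1 + X))) ^ 2 ≤ 4 * t ^ 2 * X ^ 2 := by
    calc (-(t * Real.log (1 + X))) ^ 2 = t ^ 2 * (Real.log (1 + X)) ^ 2 := by ring
      _ ≤ t ^ 2 * (4 * X ^ 2) := by gcongr
      _ = _ := by ring
  linarith

lemma abs_one_add_rpow_neg_sub_one_le {X t : ℝ} (hX : |X| ≤ 1 / 2) (ht0 : 0 < t) (ht1 : t ≤ 1) :
    |(1 + X) ^ (-t) - 1| ≤ 4 * |X| := by
  have hr0 : 0 < 1 + X := by linarith [neg_abs_le X]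
  have hlog := abs_log_one_add_le hX
  have h1 : |-(t * Real.log (1 + X))| ≤ 2 * |X| := by
    rw [abs_neg, abs_mul, abs_of_pos ht0]
    calc t * |Real.log (1 + X)| ≤ 1 * (2 * |X|) := by gcongr
      _ = _ := by ring
  rw [rpow_neg_eq_exp hr0]
  refine (Real.abs_exp_sub_one_le (h1.trans (by linarith))).trans ?_
  linarith

lemma abs_shear_sub_one_le {M ℓ g z : ℝ} (hℓ : |ℓ| ≤ M) (hg0 : 0 ≤ g) (hg : g ≤ M)
    (hz : |z| ≤ 1) : |z * ℓ + z ^ 2 * g| ≤ 2 * M * |z| := by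
  have hz0 := abs_nonneg z
  calc |z * ℓ + z ^ 2 * g| ≤ |z * ℓ| + |z ^ 2 * g| := abs_add_le _ _
    _ ≤ |z| * M + |z| * M := by
        rw [abs_mul, abs_mul, abs_of_nonneg (sq_nonneg z), abs_of_nonneg hg0, ← sq_abs z]
        have : |z| ^ 2 ≤ |z| := by nlinarith
        gcongr
    _ = _ := by ring

lemma rpow_neg_le_of_one_le_mul {r N t : ℝ} (hr0 : 0 < r) (hN : 1 ≤ N) (ht0 : 0 ≤ t) (ht1 : t ≤ 1)
    (h : 1 ≤ N * r) : r ^ (-t) ≤ N := by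
  rw [Real.rpow_neg hr0.le, ← Real.inv_rpow hr0.le]
  have hri : r⁻¹ ≤ N := by rwa [inv_le_iff_one_le_mul₀ hr0]
  calc (r⁻¹) ^ t ≤ N ^ t := by gcongr
    _ ≤ N ^ (1 : ℝ) := Real.rpow_le_rpow_of_exponent_le hN ht1
    _ = _ := Real.rpow_one _

/-- Expansion of `r ^ (-t)` at `r = 1 + z ℓ + z² g`, valid for all `z`. -/
lemma rpow_neg_shear_le {M ℓ g z t : ℝ} (hM : 1 ≤ M) (hℓ : |ℓ| ≤ M) (hg0 : 0 ≤ g) (hg : g ≤ M)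
    (ht0 : 0 < t) (ht1 : t ≤ 1) (hr0 : 0 < 1 + z * ℓ + z ^ 2 * g)
    (hr : 1 ≤ M * (1 + |z|) ^ 2 * (1 + z * ℓ + z ^ 2 * g)) :
    (1 + z * ℓ + z ^ 2 * g) ^ (-t) ≤
      1 - t * ℓ * z + (-t * g + (t / 2 + 4 * t ^ 2) * ℓ ^ 2) * z ^ 2 + 150 * M ^ 4 * |z| ^ 3 := by
  have hM0 : 0 < M := by linarith
  have hz0 := abs_nonneg z
  have hM2 : M ^ 2 ≤ M ^ 4 := pow_le_pow_right₀ hM (by norm_num)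
  have hM3 : M ^ 3 ≤ M ^ 4 := pow_le_pow_right₀ hM (by norm_num)
  have hzℓ : |z * ℓ| ≤ |z| * M := by rw [abs_mul]; gcongr
  have hz3 : 0 ≤ |z| ^ 3 := by positivity
  have hzz : z ^ 2 = |z| ^ 2 := (sq_abs z).symm
  have h4 : M ^ 2 * |z| ^ 3 ≤ M ^ 4 * |z| ^ 3 := by gcongr
  have h5 : M ^ 3 * |z| ^ 3 ≤ M ^ 4 * |z| ^ 3 := by gcongr
  have h7 : 0 ≤ M ^ 4 * |z| ^ 3 := by positivity
  -- For small z the increment zℓ + z²g is at most 1/2 in modulus and the Taylor expansion applies.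
  -- For large z, `hr` bounds the power by M(1+|z|)², and 1 ≤ 4M|z| lets every lower power of |z| be
  -- absorbed into M⁴|z|³.
  by_cases hz : |z| ≤ 1 / (4 * M)
  · have hz' : |z| * (4 * M) ≤ 1 := by rwa [le_div_iff₀ (by positivity)] at hz
    have hz1 : |z| ≤ 1 := by nlinarith
    have hX1 := abs_shear_sub_one_le hℓ hg0 hg hz1
    clear hr
    have hXc : (z * ℓ + z ^ 2 * g) ^ 2 ≤ ℓ ^ 2 * z ^ 2 + 3 * M ^ 2 * |z| ^ 3 := by
      have h1 : 2 * (z * ℓ) * (z ^ 2 * g) ≤ 2 * (|z| * M) * (|z| ^ 2 * M) := by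
        rw [hzz]
        have : z * ℓ ≤ |z| * M := (le_abs_self _).trans hzℓ
        have h2 : 0 ≤ |z| ^ 2 * g := by positivity
        calc 2 * (z * ℓ) * (|z| ^ 2 * g) ≤ 2 * (|z| * M) * (|z| ^ 2 * g) := by gcongr
          _ ≤ _ := by gcongr
      have h3 : (z ^ 2 * g) ^ 2 ≤ M ^ 2 * |z| ^ 3 := by
        rw [hzz]
        calc (|z| ^ 2 * g) ^ 2 = |z| * g ^ 2 * |z| ^ 3 := by ring
          _ ≤ 1 * M ^ 2 * |z| ^ 3 := by gcongr
          _ = _ := by ring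
      calc (z * ℓ + z ^ 2 * g) ^ 2
          = ℓ ^ 2 * z ^ 2 + (2 * (z * ℓ) * (z ^ 2 * g) + (z ^ 2 * g) ^ 2) := by ring
        _ ≤ ℓ ^ 2 * z ^ 2 + (2 * (|z| * M) * (|z| ^ 2 * M) + M ^ 2 * |z| ^ 3) := by gcongr
        _ = _ := by ring
    have hX3' : |z * ℓ + z ^ 2 * g| ^ 3 ≤ 8 * M ^ 3 * |z| ^ 3 := by
      calc _ ≤ (2 * M * |z|) ^ 3 := by gcongr
        _ = _ := by ring
    have hkey := one_add_rpow_neg_le (X := z * ℓ + z ^ 2 * g) (by linarith) ht0 ht1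
    have hfin1 : (t / 2 + 4 * t ^ 2) * (z * ℓ + z ^ 2 * g) ^ 2 ≤
        (t / 2 + 4 * t ^ 2) * (ℓ ^ 2 * z ^ 2) + 5 * (3 * M ^ 2 * |z| ^ 3) := by
      have : t / 2 + 4 * t ^ 2 ≤ 5 := by nlinarith
      calc _ ≤ (t / 2 + 4 * t ^ 2) * (ℓ ^ 2 * z ^ 2 + 3 * M ^ 2 * |z| ^ 3) := by gcongr
        _ = (t / 2 + 4 * t ^ 2) * (ℓ ^ 2 * z ^ 2)
            + (t / 2 + 4 * t ^ 2) * (3 * M ^ 2 * |z| ^ 3) := by ring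
        _ ≤ _ := by gcongr
    have hfin2 : t * (2 * |z * ℓ + z ^ 2 * g| ^ 3) ≤ 1 * (2 * (8 * M ^ 3 * |z| ^ 3)) := by gcongr
    rw [← add_assoc] at hkey
    linarith
  · push Not at hz
    have hz' : 1 ≤ 4 * M * |z| := by
      rw [div_lt_iff₀ (by positivity)] at hz; linarith
    have hN1 : 1 ≤ M * (1 + |z|) ^ 2 := by nlinarith [sq_nonneg |z|]
    have hpow := rpow_neg_le_of_one_le_mul hr0 hN1 ht0.le ht1 hr
    have hA : 1 + |z| ≤ 5 * M * |z| := by nlinarith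
    have hz23 : |z| ^ 2 ≤ 4 * M * |z| ^ 3 := by
      calc |z| ^ 2 = 1 * |z| ^ 2 := by ring
        _ ≤ 4 * M * |z| * |z| ^ 2 := by gcongr
        _ = _ := by ring
    have hz13 : |z| ≤ 16 * M ^ 2 * |z| ^ 3 := by
      calc |z| = 1 * |z| := by ring
        _ ≤ (4 * M * |z|) * |z| := by gcongr
        _ = 4 * M * |z| ^ 2 := by ring
        _ ≤ 4 * M * (4 * M * |z| ^ 3) := by gcongr
        _ = _ := by ring
    have h1 : M * (1 + |z|) ^ 2 ≤ 100 * M ^ 4 * |z| ^ 3 := by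
      calc M * (1 + |z|) ^ 2 ≤ M * (5 * M * |z|) ^ 2 := by gcongr
        _ = 25 * M ^ 3 * |z| ^ 2 := by ring
        _ ≤ 25 * M ^ 3 * (4 * M * |z| ^ 3) := by gcongr
        _ = _ := by ring
    have h2 : t * ℓ * z ≤ 16 * M ^ 3 * |z| ^ 3 := by
      calc t * ℓ * z = t * (z * ℓ) := by ring
        _ ≤ t * |z * ℓ| := by gcongr; exact le_abs_self _
        _ ≤ 1 * (|z| * M) := by gcongr
        _ ≤ 1 * ((16 * M ^ 2 * |z| ^ 3) * M) := by gcongr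
        _ = _ := by ring
    have h3 : t * g * z ^ 2 ≤ 4 * M ^ 2 * |z| ^ 3 := by
      rw [hzz]
      calc t * g * |z| ^ 2 ≤ 1 * M * (4 * M * |z| ^ 3) := by gcongr
        _ = _ := by ring
    have h8 : 0 ≤ (t / 2 + 4 * t ^ 2) * ℓ ^ 2 * z ^ 2 := by positivity
    linarith


/-! ### Distortion of the form in one noisy step. -/

/-- Holds because (cu - 2p)² = 4Q - (4-c²)u² ≤ 4Q and u² ≤ (4/δ)Q. This is the coefficient of z in
`qf_shear`. -/
lemma abs_shear_coeff_le {c δ : ℝ} (p u : ℝ) (hδ : 0 < δ) (hδ1 : δ ≤ 1) (hd : δ ≤ 4 - c ^ 2) :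
    |u * (c * u - 2 * p)| ≤ 4 / δ * qf c p u := by
  have h2 := sq_snd_le_qf p u hδ hd
  have hq : 0 ≤ qf c p u :=
    nonneg_of_mul_nonneg_right ((sq_nonneg u).trans h2) (by positivity)
  apply abs_le_of_sq_le_sq _ (by positivity)
  have e : (u * (c * u - 2 * p)) ^ 2 = u ^ 2 * (4 * qf c p u - (4 - c ^ 2) * u ^ 2) := by
    unfold qf; ring
  rw [e]
  have h3 : 0 ≤ (4 - c ^ 2) * u ^ 2 := mul_nonneg (by linarith) (sq_nonneg u)
  have h4 : 4 ≤ 4 / δ := by rw [le_div_iff₀ hδ]; linarith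
  calc u ^ 2 * (4 * qf c p u - (4 - c ^ 2) * u ^ 2) ≤ u ^ 2 * (4 * qf c p u) := by
        gcongr; linarith
    _ ≤ (4 / δ * qf c p u) * (4 / δ * qf c p u) := by gcongr
    _ = _ := by ring

lemma qf_free (c p u : ℝ) : qf c u (c * u - p) = qf c p u := by unfold qf; ring

/-- The recursion is reversible: p = (c+z)u - w where w is the new value, and Q is symmetric, so
`qf_shear` also applies backwards. It keeps Q from collapsing by more than a polynomial factor in z,
hence bounds negative powers of the ratio for large z. -/
lemma qf_le_mul_qf_shear {c δ : ℝ} (p u z : ℝ) (hδ : 0 < δ) (hδ1 : δ ≤ 1) (hd : δ ≤ 4 - c ^ 2) :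
    qf c p u ≤ 4 / δ * (1 + |z|) ^ 2 * qf c u ((c + z) * u - p) := by
  set w := (c + z) * u - p with hw
  have h1 := abs_shear_coeff_le w u hδ hδ1 hd
  have h2 := sq_snd_le_qf w u hδ hd
  rw [qf_comm c w u] at h1 h2
  have hq : 0 ≤ qf c u w :=
    nonneg_of_mul_nonneg_right ((sq_nonneg u).trans h2) (by positivity)
  have e : qf c p u = qf c u w + z * (u * (c * u - 2 * w)) + z ^ 2 * u ^ 2 := by
    rw [hw]; unfold qf; ring
  have h4 : 1 ≤ 4 / δ := by rw [le_div_iff₀ hδ]; linarith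
  rw [e]
  have h3 : z * (u * (c * u - 2 * w)) ≤ |z| * (4 / δ * qf c u w) := by
    refine (le_abs_self _).trans ?_
    rw [abs_mul]; gcongr
  have h5 : z ^ 2 * u ^ 2 ≤ |z| ^ 2 * (4 / δ * qf c u w) := by rw [sq_abs]; gcongr
  have h6 : qf c u w ≤ 4 / δ * qf c u w := le_mul_of_one_le_left hq h4
  have h7 : 0 ≤ |z| * (4 / δ * qf c u w) := by positivity
  calc _ ≤ 4 / δ * qf c u w + |z| * (4 / δ * qf c u w) + |z| ^ 2 * (4 / δ * qf c u w) := by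
        gcongr
    _ ≤ _ := by linarith

/-! ### The correction term and the strict negativity of the drift. -/

/-- Bounded correction term of the Lyapunov function, as a function of the
three quotients `p²/Q`, `pu/Q`, `u²/Q`. -/
noncomputable def corrPoly (c t θ₀ θ θ' F₁ F₂ F₃ : ℝ) : ℝ :=
  -(t / (c * (4 - c ^ 2))) * (θ * (2 * F₂ - c * F₁) + θ' * (c * F₃ - 2 * F₂))
    - t * ((4 - c ^ 2) / 4) * θ₀ * (F₃ - 2 / (4 - c ^ 2)) ^ 2

/-- Here θ and θ' are the relative variances of the current and of the next noise, which alternate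
along the chain, and θ₀ is a lower bound for both. The part linear in the quotients is a coboundary
chosen to cancel the signless linear term of the drift. The square transfers part of the dissipation
from one step to the next, so that two consecutive deviations appear together. -/
noncomputable def corr (c t θ₀ θ θ' p u : ℝ) : ℝ :=
  corrPoly c t θ₀ θ θ' (p ^ 2 / qf c p u) (p * u / qf c p u) (u ^ 2 / qf c p u)

/-- Admissible parameters. -/
structure Params (δ Θ c t θ₀ θ θ' : ℝ) : Prop where
  δ0 : 0 < δ
  δ1 : δ ≤ 1
  c0 : δ ≤ |c|
  cd : δ ≤ 4 - c ^ 2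
  t0 : 0 < t
  t1 : t ≤ 1
  θ₀0 : 0 < θ₀
  hθ : θ₀ ≤ θ
  hθ' : θ₀ ≤ θ'
  hΘ : θ ≤ Θ
  hΘ' : θ' ≤ Θ

namespace Params
variable {δ Θ c t θ₀ θ θ' : ℝ}

lemma swap (h : Params δ Θ c t θ₀ θ θ') : Params δ Θ c t θ₀ θ' θ :=
  ⟨h.δ0, h.δ1, h.c0, h.cd, h.t0, h.t1, h.θ₀0, h.hθ', h.hθ, h.hΘ', h.hΘ⟩

lemma abs_c_le (h : Params δ Θ c t θ₀ θ θ') : |c| ≤ 2 := by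
  have := h.cd; have := h.δ0
  exact abs_le_of_sq_le_sq (by nlinarith) (by norm_num)

lemma abs_coeff_le (h : Params δ Θ c t θ₀ θ θ') : |t / (c * (4 - c ^ 2))| ≤ 1 / δ ^ 2 := by
  have hδ := h.δ0
  rw [abs_div, abs_mul, abs_of_pos h.t0]
  have h1 : δ ^ 2 ≤ |c| * |4 - c ^ 2| := by
    rw [sq]; exact mul_le_mul h.c0 (h.cd.trans (le_abs_self _)) hδ.le (abs_nonneg _)
  exact div_le_div₀ zero_le_one h.t1 (by positivity) h1

lemma theta_pos (h : Params δ Θ c t θ₀ θ θ') : 0 < θ := h.θ₀0.trans_le h.hθ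

lemma Theta_pos (h : Params δ Θ c t θ₀ θ θ') : 0 < Θ := h.theta_pos.trans_le h.hΘ

lemma two_div_le (h : Params δ Θ c t θ₀ θ θ') : |2 / (4 - c ^ 2)| ≤ 2 / δ := by
  have hδ := h.δ0
  have := h.cd
  rw [abs_of_pos (by apply div_pos <;> linarith)]
  gcongr

lemma abs_sq_coeff_le (h : Params δ Θ c t θ₀ θ θ') : |t * ((4 - c ^ 2) / 4) * θ₀| ≤ Θ := by
  have hδ := h.δ0
  have := h.cd
  have h4 : 0 ≤ (4 - c ^ 2) / 4 := by linarith
  have h5 : (4 - c ^ 2) / 4 ≤ 1 := by nlinarith [sq_nonneg c]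
  have := h.t0.le; have := h.θ₀0.le
  rw [abs_of_nonneg (by positivity)]
  calc t * ((4 - c ^ 2) / 4) * θ₀ ≤ 1 * 1 * Θ := by
        gcongr
        · exact h.t1
        · exact h.hθ.trans h.hΘ
    _ = Θ := by ring

lemma abs_corrPoly_sub_le (h : Params δ Θ c t θ₀ θ θ') {F₁ F₂ F₃ G₁ G₂ G₃ M e : ℝ}
    (h1 : |F₁ - G₁| ≤ e) (h2 : |F₂ - G₂| ≤ e) (h3 : |F₃ - G₃| ≤ e)
    (hF : |F₃| ≤ M) (hG : |G₃| ≤ M) :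
    |corrPoly c t θ₀ θ θ' F₁ F₂ F₃ - corrPoly c t θ₀ θ θ' G₁ G₂ G₃| ≤
      (1 / δ ^ 2 * (8 * Θ) + Θ * (2 * M + 4 / δ)) * e := by
  have hδ := h.δ0
  have hθ0 := h.theta_pos.le
  have hθ'0 := h.swap.theta_pos.le
  have hΘ0 := h.Theta_pos.le
  have he : 0 ≤ e := (abs_nonneg _).trans h1
  have hM : 0 ≤ M := (abs_nonneg _).trans hF
  have hc := h.abs_c_le
  have key : corrPoly c t θ₀ θ θ' F₁ F₂ F₃ - corrPoly c t θ₀ θ θ' G₁ G₂ G₃ =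
      -(t / (c * (4 - c ^ 2))) * (θ * (2 * (F₂ - G₂) - c * (F₁ - G₁))
        + θ' * (c * (F₃ - G₃) - 2 * (F₂ - G₂)))
      - t * ((4 - c ^ 2) / 4) * θ₀ * ((F₃ - G₃) * (F₃ + G₃ - 2 * (2 / (4 - c ^ 2)))) := by
    unfold corrPoly; ring
  rw [key]
  have e1 : |2 * (F₂ - G₂) - c * (F₁ - G₁)| ≤ 4 * e := by
    calc _ ≤ |2 * (F₂ - G₂)| + |c * (F₁ - G₁)| := abs_sub _ _
      _ ≤ 2 * e + 2 * e := by
        rw [abs_mul, abs_mul, abs_two]; gcongr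
      _ = _ := by ring
  have e2 : |c * (F₃ - G₃) - 2 * (F₂ - G₂)| ≤ 4 * e := by
    calc _ ≤ |c * (F₃ - G₃)| + |2 * (F₂ - G₂)| := abs_sub _ _
      _ ≤ 2 * e + 2 * e := by
        rw [abs_mul, abs_mul, abs_two]; gcongr
      _ = _ := by ring
  have e3 : |F₃ + G₃ - 2 * (2 / (4 - c ^ 2))| ≤ 2 * M + 4 / δ := by
    calc _ ≤ |F₃ + G₃| + |2 * (2 / (4 - c ^ 2))| := abs_sub _ _
      _ ≤ |F₃| + |G₃| + 2 * |2 / (4 - c ^ 2)| := by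
        rw [abs_mul, abs_two]; gcongr; exact abs_add_le _ _
      _ ≤ M + M + 2 * (2 / δ) := by gcongr; exact h.two_div_le
      _ = _ := by ring
  calc _ ≤ |-(t / (c * (4 - c ^ 2))) * (θ * (2 * (F₂ - G₂) - c * (F₁ - G₁))
        + θ' * (c * (F₃ - G₃) - 2 * (F₂ - G₂)))|
      + |t * ((4 - c ^ 2) / 4) * θ₀ * ((F₃ - G₃) * (F₃ + G₃ - 2 * (2 / (4 - c ^ 2))))| := abs_sub _ _
    _ ≤ 1 / δ ^ 2 * (Θ * (4 * e) + Θ * (4 * e)) + Θ * (e * (2 * M + 4 / δ)) := by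
        rw [abs_mul, abs_neg, abs_mul, abs_mul (F₃ - G₃)]
        gcongr
        · exact h.abs_coeff_le
        · refine (abs_add_le _ _).trans ?_
          rw [abs_mul, abs_mul, abs_of_nonneg hθ0, abs_of_nonneg hθ'0]
          gcongr
          · exact h.hΘ
          · exact h.hΘ'
        · exact h.abs_sq_coeff_le
    _ = _ := by ring

end Params

/-- Bound for the correction term and for its Lipschitz constant. -/
noncomputable def corrBound (δ Θ : ℝ) : ℝ :=
  (1 / δ ^ 2 * (8 * Θ) + Θ * (2 * (4 / δ) + 4 / δ)) * (4 / δ) + Θ * (2 / δ) ^ 2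

lemma corrBound_pos {δ Θ : ℝ} (hδ : 0 < δ) (hΘ : 0 < Θ) : 0 < corrBound δ Θ := by
  unfold corrBound; positivity

namespace Params
variable {δ Θ c t θ₀ θ θ' : ℝ}

/-- The three quotients are bounded by 4/δ, so the Lipschitz estimate is applied against the value
of `corrPoly` at the origin. -/
lemma abs_corr_le (h : Params δ Θ c t θ₀ θ θ') {p u : ℝ} (hpu : (p, u) ≠ 0) :
    |corr c t θ₀ θ θ' p u| ≤ corrBound δ Θ := by
  have hδ := h.δ0
  have hq : 0 < qf c p u := qf_pos (h.δ0.trans_le h.cd) hpu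
  have b1 : |p ^ 2 / qf c p u| ≤ 4 / δ := by
    rw [abs_of_nonneg (by positivity), div_le_iff₀ hq]; exact sq_fst_le_qf p u hδ h.cd
  have b2 : |p * u / qf c p u| ≤ 4 / δ := by
    rw [abs_div, abs_of_pos hq, div_le_iff₀ hq]; exact abs_mul_le_qf p u hδ h.cd
  have b3 : |u ^ 2 / qf c p u| ≤ 4 / δ := by
    rw [abs_of_nonneg (by positivity), div_le_iff₀ hq]; exact sq_snd_le_qf p u hδ h.cd
  have h0 : |corrPoly c t θ₀ θ θ' 0 0 0| ≤ Θ * (2 / δ) ^ 2 := by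
    have e : corrPoly c t θ₀ θ θ' 0 0 0 =
        -(t * ((4 - c ^ 2) / 4) * θ₀ * (2 / (4 - c ^ 2)) ^ 2) := by
      unfold corrPoly; ring
    rw [e, abs_neg, abs_mul, abs_pow]
    have := h.Theta_pos.le
    gcongr
    · exact h.abs_sq_coeff_le
    · exact h.two_div_le
  have h1 := h.abs_corrPoly_sub_le (F₁ := p ^ 2 / qf c p u) (G₁ := 0) (F₂ := p * u / qf c p u)
    (G₂ := 0) (F₃ := u ^ 2 / qf c p u) (G₃ := 0) (M := 4 / δ) (e := 4 / δ)
    (by simpa using b1) (by simpa using b2) (by simpa using b3) b3 (by simp; positivity)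
  unfold corr corrBound
  calc _ = |(corrPoly c t θ₀ θ θ' (p ^ 2 / qf c p u) (p * u / qf c p u) (u ^ 2 / qf c p u)
        - corrPoly c t θ₀ θ θ' 0 0 0) + corrPoly c t θ₀ θ θ' 0 0 0| := by ring_nf
    _ ≤ _ := (abs_add_le _ _).trans (add_le_add h1 h0)

end Params

lemma abs_div_sub_le {x y r M a X : ℝ} (hr : 1 / 2 ≤ r) (hr1 : |r - 1| ≤ X) (hy : |y| ≤ M)
    (hxy : |x - y| ≤ a) : |x / r - y| ≤ 2 * (a + M * X) := by
  have hr0 : 0 < r := by linarith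
  have hM : 0 ≤ M := (abs_nonneg _).trans hy
  have e : x / r - y = ((x - y) - y * (r - 1)) / r := by field_simp; ring
  rw [e, abs_div, abs_of_pos hr0, div_le_iff₀ hr0]
  have h1 : |(x - y) - y * (r - 1)| ≤ a + M * X := by
    refine (abs_sub _ _).trans ?_
    rw [abs_mul]; gcongr
  have h0 : 0 ≤ a + M * X := (abs_nonneg _).trans h1
  nlinarith

/-- Constant in the stability estimate for the correction term. -/
noncomputable def stabConst (δ Θ : ℝ) : ℝ :=
  let M := 4 / δ
  corrBound δ Θ * (8 * M) + (1 / δ ^ 2 * (8 * Θ) + Θ * (2 * M + 4 / δ)) * (2 * (3 * M + M * (2 * M)))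
    + corrBound δ Θ * (M * (4 * M + 1) ^ 2 + (4 * M) ^ 2)

-- In the Lyapunov function the correction carries a factor of the order of the variance β. An error
-- |z| + z² is therefore enough: its mean is small with β, and no second-order expansion of the
-- correction is needed.
set_option maxHeartbeats 800000 in
lemma Params.abs_rpow_mul_corr_sub_le {δ Θ c t θ₀ θ θ' : ℝ} (h : Params δ Θ c t θ₀ θ θ')
    {p u z : ℝ} (hpu : (p, u) ≠ 0) :
    |(qf c u ((c + z) * u - p) / qf c p u) ^ (-t) * corr c t θ₀ θ θ' u ((c + z) * u - p)
      - corr c t θ₀ θ θ' u (c * u - p)| ≤ stabConst δ Θ * (|z| + z ^ 2) := by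
  have hδ := h.δ0
  have hd0 := h.δ0.trans_le h.cd
  have hq : 0 < qf c p u := qf_pos hd0 hpu
  have hpu' := shear_ne_zero (c := c) (z := z) hpu
  have hpu0 := shear_ne_zero (c := c) (z := 0) hpu
  rw [add_zero] at hpu0
  have hq' : 0 < qf c u ((c + z) * u - p) := qf_pos hd0 hpu'
  have hC1 := h.abs_corr_le hpu'
  have hC0 := h.abs_corr_le hpu0
  have hCp := corrBound_pos h.δ0 h.Theta_pos
  have hΘ := h.Theta_pos
  have hz0 := abs_nonneg z
  obtain ⟨M, hM⟩ : ∃ M, M = 4 / δ := ⟨_, rfl⟩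
  have hM4 : 4 ≤ M := by rw [hM, le_div_iff₀ hδ]; linarith [h.δ1]
  have hr0 : 0 < qf c u ((c + z) * u - p) / qf c p u := by positivity
  have hA : 0 ≤ corrBound δ Θ * (8 * M) := by positivity
  have hB : 0 ≤ (1 / δ ^ 2 * (8 * Θ) + Θ * (2 * M + 4 / δ)) * (2 * (3 * M + M * (2 * M))) := by
    positivity
  have hCc : 0 ≤ corrBound δ Θ * (M * (4 * M + 1) ^ 2 + (4 * M) ^ 2) := by positivity
  have hS : stabConst δ Θ = corrBound δ Θ * (8 * M)
    + (1 / δ ^ 2 * (8 * Θ) + Θ * (2 * M + 4 / δ)) * (2 * (3 * M + M * (2 * M)))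
    + corrBound δ Θ * (M * (4 * M + 1) ^ 2 + (4 * M) ^ 2) := by rw [hM]; rfl
  -- Small z: both the power and the quotients move by O(|z|). Large z: both terms are bounded
  -- separately, and 1 ≤ (4M)²z² turns constants into multiples of z².
  by_cases hz : |z| ≤ 1 / (4 * M)
  · have hz' : |z| * (4 * M) ≤ 1 := by rwa [le_div_iff₀ (by positivity)] at hz
    have hz1 : |z| ≤ 1 := by nlinarith
    set g := u ^ 2 / qf c p u with hg
    set ℓ := u * (c * u - 2 * p) / qf c p u with hℓ
    have hgM : g ≤ M := by rw [hg, div_le_iff₀ hq, hM]; exact sq_snd_le_qf p u hδ h.cd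
    have hg0 : 0 ≤ g := by positivity
    have hℓM : |ℓ| ≤ M := by
      rw [hℓ, abs_div, abs_of_pos hq, div_le_iff₀ hq, hM]; exact abs_shear_coeff_le p u hδ h.δ1 h.cd
    have hrX : qf c u ((c + z) * u - p) / qf c p u = 1 + (z * ℓ + z ^ 2 * g) := by
      rw [qf_shear, hℓ, hg]; field_simp; ring
    have hX1 := abs_shear_sub_one_le hℓM hg0 hgM hz1
    set r := qf c u ((c + z) * u - p) / qf c p u with hr
    have hr1 : |r - 1| ≤ 2 * M * |z| := by rw [hrX, add_sub_cancel_left]; exact hX1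
    have hX2 : |z * ℓ + z ^ 2 * g| ≤ 1 / 2 := by linarith
    have hrhalf : 1 / 2 ≤ r := by
      have := (abs_le.1 hX2).1; rw [hrX]; linarith
    have hpow : |r ^ (-t) - 1| ≤ 8 * M * |z| := by
      rw [hrX]
      refine (abs_one_add_rpow_neg_sub_one_le hX2 h.t0 h.t1).trans ?_
      linarith
    set w := c * u - p with hw
    have hw' : (c + z) * u - p = w + z * u := by rw [hw]; ring
    have hqw : qf c u w = qf c p u := qf_free c p u
    have hqr : qf c u ((c + z) * u - p) = qf c p u * r := by rw [hr]; field_simp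
    have hfM : |w ^ 2 / qf c p u| ≤ M := by
      rw [abs_of_nonneg (by positivity), div_le_iff₀ hq, hM, ← hqw]; exact sq_snd_le_qf u w hδ h.cd
    have heM : |u * w / qf c p u| ≤ M := by
      rw [abs_div, abs_of_pos hq, div_le_iff₀ hq, hM, ← hqw]; exact abs_mul_le_qf u w hδ h.cd
    have hgM' : |g| ≤ M := by rwa [abs_of_nonneg hg0]
    have hz2 : z ^ 2 ≤ |z| := by rw [← sq_abs]; nlinarith
    have d1 : |u ^ 2 / qf c u ((c + z) * u - p) - u ^ 2 / qf c u w| ≤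
        2 * (3 * M * |z| + M * (2 * M * |z|)) := by
      rw [hqr, hqw, ← div_div]
      apply abs_div_sub_le hrhalf hr1 hgM'
      rw [sub_self, abs_zero]; positivity
    have d2 : |u * ((c + z) * u - p) / qf c u ((c + z) * u - p) - u * w / qf c u w| ≤
        2 * (3 * M * |z| + M * (2 * M * |z|)) := by
      rw [hqr, hqw, ← div_div]
      apply abs_div_sub_le hrhalf hr1 heM
      have : u * ((c + z) * u - p) / qf c p u - u * w / qf c p u = z * g := by
        rw [hw', hg]; ring
      rw [this, abs_mul]
      calc |z| * |g| ≤ |z| * M := by gcongr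
        _ ≤ |z| * (3 * M) := by gcongr; linarith
        _ = _ := by ring
    have d3 : |((c + z) * u - p) ^ 2 / qf c u ((c + z) * u - p) - w ^ 2 / qf c u w| ≤
        2 * (3 * M * |z| + M * (2 * M * |z|)) := by
      rw [hqr, hqw, ← div_div]
      apply abs_div_sub_le hrhalf hr1 hfM
      have : ((c + z) * u - p) ^ 2 / qf c p u - w ^ 2 / qf c p u =
          2 * z * (u * w / qf c p u) + z ^ 2 * g := by
        rw [hw', hg]; ring
      rw [this]
      calc _ ≤ |2 * z * (u * w / qf c p u)| + |z ^ 2 * g| := abs_add_le _ _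
        _ ≤ 2 * |z| * M + |z| * M := by
          rw [abs_mul, abs_mul, abs_mul, abs_two, abs_of_nonneg (sq_nonneg z)]; gcongr
        _ = _ := by ring
    have b3 : |((c + z) * u - p) ^ 2 / qf c u ((c + z) * u - p)| ≤ M := by
      rw [abs_of_nonneg (by positivity), div_le_iff₀ hq', hM]; exact sq_snd_le_qf _ _ hδ h.cd
    have hdiff := h.abs_corrPoly_sub_le d1 d2 d3 b3 (by rw [hqw]; exact hfM)
    change |corr c t θ₀ θ θ' u ((c + z) * u - p) - corr c t θ₀ θ θ' u w| ≤ _ at hdiff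
    have e : r ^ (-t) * corr c t θ₀ θ θ' u ((c + z) * u - p) - corr c t θ₀ θ θ' u w =
        (r ^ (-t) - 1) * corr c t θ₀ θ θ' u ((c + z) * u - p)
        + (corr c t θ₀ θ θ' u ((c + z) * u - p) - corr c t θ₀ θ θ' u w) := by ring
    rw [e]
    calc _ ≤ |(r ^ (-t) - 1) * corr c t θ₀ θ θ' u ((c + z) * u - p)|
          + |corr c t θ₀ θ θ' u ((c + z) * u - p) - corr c t θ₀ θ θ' u w| := abs_add_le _ _
      _ ≤ (8 * M * |z|) * corrBound δ Θ + (1 / δ ^ 2 * (8 * Θ) + Θ * (2 * M + 4 / δ))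
            * (2 * (3 * M * |z| + M * (2 * M * |z|))) := by
          rw [abs_mul]; gcongr
      _ = (corrBound δ Θ * (8 * M)
          + (1 / δ ^ 2 * (8 * Θ) + Θ * (2 * M + 4 / δ)) * (2 * (3 * M + M * (2 * M)))) * |z| := by
          ring
      _ ≤ stabConst δ Θ * |z| := by gcongr; rw [hS]; linarith
      _ ≤ _ := by
          gcongr
          · rw [hS]; positivity
          · linarith [sq_nonneg z]
  · push Not at hz
    have hz' : 1 ≤ 4 * M * |z| := by
      rw [div_lt_iff₀ (by positivity)] at hz; linarith
    have hN : 1 ≤ M * (1 + |z|) ^ 2 := by nlinarith [sq_nonneg |z|]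
    have hpow : (qf c u ((c + z) * u - p) / qf c p u) ^ (-t) ≤ M * (1 + |z|) ^ 2 := by
      apply rpow_neg_le_of_one_le_mul hr0 hN h.t0.le h.t1
      rw [← mul_div_assoc, le_div_iff₀ hq, one_mul, hM]
      exact qf_le_mul_qf_shear p u z hδ h.δ1 h.cd
    have hpow2 : M * (1 + |z|) ^ 2 ≤ M * (4 * M + 1) ^ 2 * z ^ 2 := by
      rw [← sq_abs z, mul_assoc, ← mul_pow]
      gcongr
      linarith
    have h16 : 1 ≤ (4 * M) ^ 2 * z ^ 2 := by
      rw [← sq_abs z, ← mul_pow]; exact one_le_pow₀ hz'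
    have hpp : 0 ≤ (qf c u ((c + z) * u - p) / qf c p u) ^ (-t) := by positivity
    calc _ ≤ |(qf c u ((c + z) * u - p) / qf c p u) ^ (-t) * corr c t θ₀ θ θ' u ((c + z) * u - p)|
          + |corr c t θ₀ θ θ' u (c * u - p)| := abs_sub _ _
      _ ≤ (M * (4 * M + 1) ^ 2 * z ^ 2) * corrBound δ Θ + corrBound δ Θ * ((4 * M) ^ 2 * z ^ 2) := by
          rw [abs_mul, abs_of_nonneg hpp]
          gcongr
          · exact hpow.trans hpow2
          · exact hC0.trans (le_mul_of_one_le_right hCp.le h16)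
      _ = corrBound δ Θ * (M * (4 * M + 1) ^ 2 + (4 * M) ^ 2) * z ^ 2 := by ring
      _ ≤ stabConst δ Θ * z ^ 2 := by gcongr; rw [hS]; linarith
      _ ≤ _ := by
          gcongr
          · rw [hS]; positivity
          · linarith

lemma stabConst_pos {δ Θ : ℝ} (hδ : 0 < δ) (hΘ : 0 < Θ) : 0 < stabConst δ Θ := by
  unfold stabConst corrBound; positivity

/-- Sum of the squared deviations of two consecutive quotients. -/
lemma sq_add_sq_dev_ge {c q p u : ℝ} (hd : 0 < 4 - c ^ 2) (hq : 0 < q) (hqe : q = qf c p u) :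
    c ^ 2 / (4 * (4 - c ^ 2)) ≤ (u ^ 2 / q - 2 / (4 - c ^ 2)) ^ 2
      + ((c * u - p) ^ 2 / q - 2 / (4 - c ^ 2)) ^ 2 := by
  obtain ⟨x, hx⟩ : ∃ x, x = u ^ 2 / q - 2 / (4 - c ^ 2) := ⟨_, rfl⟩
  obtain ⟨y, hy⟩ : ∃ y, y = (c * u - p) ^ 2 / q - 2 / (4 - c ^ 2) := ⟨_, rfl⟩
  have hd' := hd.ne'
  -- The quotients X = u²/Q and Y = (cu-p)²/Q satisfy (X + Y - 1)² = c²XY, because Q(u, cu-p) = Q.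
  -- Centring at 2/(4-c²) gives this conic, which avoids the origin when c ≠ 0; its left side is at
  -- most 4(x² + y²).
  have key : (x + y) ^ 2 - c ^ 2 * (x * y) = c ^ 2 / (4 - c ^ 2) := by
    have e1 : (x + 2 / (4 - c ^ 2)) * q = u ^ 2 := by rw [hx]; field_simp; ring
    have e2 : (y + 2 / (4 - c ^ 2)) * q = (c * u - p) ^ 2 := by rw [hy]; field_simp; ring
    have e3 : (x + 2 / (4 - c ^ 2)) + (y + 2 / (4 - c ^ 2)) - 1 = c * (u * (c * u - p)) / q := by
      rw [hx, hy]; field_simp; rw [hqe]; unfold qf; ring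
    have e4 : ((x + 2 / (4 - c ^ 2)) + (y + 2 / (4 - c ^ 2)) - 1) ^ 2 =
        c ^ 2 * ((x + 2 / (4 - c ^ 2)) * (y + 2 / (4 - c ^ 2))) := by
      rw [e3, div_pow, div_eq_iff (by positivity)]
      calc _ = c ^ 2 * (u ^ 2 * (c * u - p) ^ 2) := by ring
        _ = _ := by rw [← e1, ← e2]; ring
    have hD : ∃ D, D = 2 / (4 - c ^ 2) := ⟨_, rfl⟩
    obtain ⟨D, hD⟩ := hD
    have hD2 : c ^ 2 / (4 - c ^ 2) = 2 * D - 1 := by rw [hD]; field_simp; ring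
    have hc2 : c ^ 2 * D = 4 * D - 2 := by rw [hD]; field_simp; ring
    rw [← hD] at e4
    rw [hD2]
    linear_combination e4 + (x + y + D) * hc2
  rw [← hx, ← hy, ← div_div, div_right_comm, ← key]
  nlinarith [mul_nonneg hd.le (sq_nonneg (x - y)), mul_nonneg (sq_nonneg c) (sq_nonneg (x + y)),
    sq_nonneg (x + y), sq_nonneg (x - y)]

/-- After the coboundary cancels the linear term, the drift contains -tθ(4-c²)x²/2, and the square
in `corr` contributes t(4-c²)θ₀(x² - y²)/4. Together they are at most -tθ₀(4-c²)(x² + y²)/4, which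
`sq_add_sq_dev_ge` bounds away from 0. -/
lemma Params.drift_le {δ Θ c t θ₀ θ θ' : ℝ} (h : Params δ Θ c t θ₀ θ θ')
    (ht : t ≤ θ₀ * δ ^ 3 / (2048 * Θ)) {p u : ℝ} (hpu : (p, u) ≠ 0) :
    θ * (-t * (u ^ 2 / qf c p u)
        + (t / 2 + 4 * t ^ 2) * (u * (c * u - 2 * p) / qf c p u) ^ 2)
      + corr c t θ₀ θ' θ u (c * u - p) - corr c t θ₀ θ θ' p u ≤ -(t * θ₀ * δ ^ 2 / 32) := by
  have hδ := h.δ0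
  have hd0 := h.δ0.trans_le h.cd
  have ht0 := h.t0
  have hq : 0 < qf c p u := qf_pos hd0 hpu
  have hθ := h.theta_pos
  have hθ₀ := h.θ₀0
  have hΘ := h.Theta_pos
  have hc : c ≠ 0 := by
    intro hc; have := h.c0; rw [hc, abs_zero] at this; linarith
  have hdne := hd0.ne'
  have hdev := sq_add_sq_dev_ge hd0 hq rfl
  have hqw : qf c u (c * u - p) = qf c p u := qf_free c p u
  obtain ⟨q, hqdef⟩ : ∃ q, q = qf c p u := ⟨_, rfl⟩
  have hq2 : q = p ^ 2 - c * p * u + u ^ 2 := hqdef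
  have hgM : u ^ 2 / q ≤ 4 / δ := by
    rw [hqdef, div_le_iff₀ hq]; exact sq_snd_le_qf p u hδ h.cd
  unfold corr corrPoly
  rw [hqw]
  rw [← hqdef] at hq hdev ⊢
  obtain ⟨x, hx⟩ : ∃ x, x = u ^ 2 / q - 2 / (4 - c ^ 2) := ⟨_, rfl⟩
  obtain ⟨y, hy⟩ : ∃ y, y = (c * u - p) ^ 2 / q - 2 / (4 - c ^ 2) := ⟨_, rfl⟩
  have hℓ : (u * (c * u - 2 * p) / q) ^ 2 = u ^ 2 / q * (4 - (4 - c ^ 2) * (u ^ 2 / q)) := by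
    field_simp; rw [hq2]; ring
  have hℓ' : (u * (c * u - 2 * p) / q) ^ 2 ≤ 16 / δ := by
    rw [hℓ]
    have h0 : 0 ≤ u ^ 2 / q := by positivity
    have : 0 ≤ (4 - c ^ 2) * (u ^ 2 / q) := by positivity
    calc _ ≤ u ^ 2 / q * 4 := by gcongr; linarith
      _ ≤ 4 / δ * 4 := by gcongr
      _ = _ := by ring
  -- With g = u²/Q and ℓ² = g(4 - (4-c²)g), the point g = 2/(4-c²) is exactly where the t-linear
  -- drift -g + ℓ²/2 vanishes, so centring there leaves no constant term.
  have hmain : θ * (-t * (u ^ 2 / q)) + θ * (t / 2 * (u * (c * u - 2 * p) / q) ^ 2)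
      = -(t * θ * (x + (4 - c ^ 2) / 2 * x ^ 2)) := by
    rw [hℓ, hx]; field_simp; ring
  have hcob : -(t / (c * (4 - c ^ 2))) * (θ' * (2 * (u * (c * u - p) / q) - c * (u ^ 2 / q))
        + θ * (c * ((c * u - p) ^ 2 / q) - 2 * (u * (c * u - p) / q)))
      - (-(t / (c * (4 - c ^ 2))) * (θ * (2 * (p * u / q) - c * (p ^ 2 / q))
        + θ' * (c * (u ^ 2 / q) - 2 * (p * u / q)))) = t * θ * x := by
    rw [hx]; field_simp; rw [hq2]; ring
  -- The smallness of t is used only here: the t² remainder consumes half of the available tθ₀δ²/16.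
  have h4 : 4 * t ^ 2 * θ * (u * (c * u - 2 * p) / q) ^ 2 ≤ t * θ₀ * δ ^ 2 / 32 := by
    calc 4 * t ^ 2 * θ * (u * (c * u - 2 * p) / q) ^ 2
        ≤ 4 * (t * (θ₀ * δ ^ 3 / (2048 * Θ))) * Θ * (16 / δ) := by
          rw [sq t]; gcongr; exact h.hΘ
      _ = _ := by field_simp; ring
  have h5 : t * θ₀ * δ ^ 2 / 16 ≤ t * θ₀ * ((4 - c ^ 2) / 4) * (x ^ 2 + y ^ 2) := by
    have hc2 : δ ^ 2 ≤ c ^ 2 := by rw [← sq_abs c]; have := h.c0; gcongr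
    calc t * θ₀ * δ ^ 2 / 16 ≤ t * θ₀ * c ^ 2 / 16 := by gcongr
      _ = t * θ₀ * ((4 - c ^ 2) / 4) * (c ^ 2 / (4 * (4 - c ^ 2))) := by field_simp; norm_num
      _ ≤ _ := by rw [hx, hy]; gcongr
  have h6 : t * θ₀ * ((4 - c ^ 2) / 2) * x ^ 2 ≤ t * θ * ((4 - c ^ 2) / 2) * x ^ 2 := by
    gcongr; exact h.hθ
  rw [← hx, ← hy]
  linarith


/-! ### The Lyapunov function and its contraction in one step. -/

/-- The Lyapunov function `Q^{-t} (1 + β · corr)`. -/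
noncomputable def lyap (c t θ₀ θ θ' β p u : ℝ) : ℝ :=
  qf c p u ^ (-t) * (1 + β * corr c t θ₀ θ θ' p u)

lemma Params.lyap_shear_le {δ Θ c t θ₀ θ θ' β : ℝ} (h : Params δ Θ c t θ₀ θ θ') (hβ : 0 ≤ β)
    {p u : ℝ} (z : ℝ) (hpu : (p, u) ≠ 0) :
    lyap c t θ₀ θ θ' β u ((c + z) * u - p) ≤ qf c p u ^ (-t) *
      (1 - t * (u * (c * u - 2 * p) / qf c p u) * z
        + (-t * (u ^ 2 / qf c p u)
          + (t / 2 + 4 * t ^ 2) * (u * (c * u - 2 * p) / qf c p u) ^ 2) * z ^ 2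
        + 150 * (4 / δ) ^ 4 * |z| ^ 3
        + β * (corr c t θ₀ θ θ' u (c * u - p) + stabConst δ Θ * (|z| + z ^ 2))) := by
  have hδ := h.δ0
  have hd0 := h.δ0.trans_le h.cd
  have hq : 0 < qf c p u := qf_pos hd0 hpu
  have hq' : 0 < qf c u ((c + z) * u - p) := qf_pos hd0 (shear_ne_zero hpu)
  have hr0 : 0 < qf c u ((c + z) * u - p) / qf c p u := by positivity
  have hM : 1 ≤ 4 / δ := by rw [le_div_iff₀ hδ]; linarith [h.δ1]
  have hstab := (abs_le.1 (h.abs_rpow_mul_corr_sub_le (z := z) hpu)).2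
  have hrX : qf c u ((c + z) * u - p) / qf c p u =
      1 + z * (u * (c * u - 2 * p) / qf c p u) + z ^ 2 * (u ^ 2 / qf c p u) := by
    rw [qf_shear]; field_simp
  have hexp := rpow_neg_shear_le (M := 4 / δ) (z := z) (t := t)
    (ℓ := u * (c * u - 2 * p) / qf c p u) (g := u ^ 2 / qf c p u) hM
    (by rw [abs_div, abs_of_pos hq, div_le_iff₀ hq]; exact abs_shear_coeff_le p u hδ h.δ1 h.cd)
    (by positivity) (by rw [div_le_iff₀ hq]; exact sq_snd_le_qf p u hδ h.cd) h.t0 h.t1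
    (by rw [← hrX]; exact hr0)
    (by rw [← hrX, ← mul_div_assoc, le_div_iff₀ hq, one_mul]
        exact qf_le_mul_qf_shear p u z hδ h.δ1 h.cd)
  rw [← hrX] at hexp
  have e : qf c u ((c + z) * u - p) ^ (-t) =
      qf c p u ^ (-t) * (qf c u ((c + z) * u - p) / qf c p u) ^ (-t) := by
    rw [← Real.mul_rpow hq.le hr0.le, mul_div_cancel₀ _ hq.ne']
  unfold lyap
  rw [e, mul_assoc]
  have := mul_le_mul_of_nonneg_left hstab hβ
  refine mul_le_mul_of_nonneg_left ?_ (by positivity)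
  linarith

lemma Params.lyap_bounds {δ Θ c t θ₀ θ θ' β : ℝ} (h : Params δ Θ c t θ₀ θ θ') (hβ : 0 ≤ β)
    (hβC : 2 * (β * corrBound δ Θ) ≤ 1) {p u : ℝ} (hpu : (p, u) ≠ 0) :
    qf c p u ^ (-t) ≤ 2 * lyap c t θ₀ θ θ' β p u ∧
      lyap c t θ₀ θ θ' β p u ≤ 2 * qf c p u ^ (-t) := by
  have hq : 0 < qf c p u := qf_pos (h.δ0.trans_le h.cd) hpu
  have hp : 0 < qf c p u ^ (-t) := by positivity
  have hc : |β * corr c t θ₀ θ θ' p u| ≤ β * corrBound δ Θ := by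
    rw [abs_mul, abs_of_nonneg hβ]; have := h.abs_corr_le hpu; gcongr
  obtain ⟨h1, h2⟩ := abs_le.1 hc
  unfold lyap
  constructor <;> nlinarith

/-- Moment assumptions on the law of one noise variable, relative to the scale `β`. -/
structure NoiseLaw (ν : Measure ℝ) (τ η : ℝ) : Prop where
  prob : IsProbabilityMeasure ν
  int1 : Integrable (fun z : ℝ => z) ν
  int2 : Integrable (fun z : ℝ => z ^ 2) ν
  int3 : Integrable (fun z : ℝ => |z| ^ 3) ν
  mean : ∫ z, z ∂ν = 0
  var : ∫ z, z ^ 2 ∂ν = τ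
  third : ∫ z, |z| ^ 3 ∂ν ≤ η

lemma NoiseLaw.integrable_cubic {ν : Measure ℝ} {τ η : ℝ} (hν : NoiseLaw ν τ η) (a₀ a₁ a₂ a₃ : ℝ) :
    Integrable (fun z : ℝ => a₀ + a₁ * z + a₂ * z ^ 2 + a₃ * |z| ^ 3) ν := by
  have := hν.prob
  exact (((integrable_const _).add (hν.int1.const_mul _)).add (hν.int2.const_mul _)).add
    (hν.int3.const_mul _)

lemma NoiseLaw.integral_cubic {ν : Measure ℝ} {τ η : ℝ} (hν : NoiseLaw ν τ η) (a₀ a₁ a₂ a₃ : ℝ) :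
    ∫ z, (a₀ + a₁ * z + a₂ * z ^ 2 + a₃ * |z| ^ 3) ∂ν = a₀ + a₂ * τ + a₃ * ∫ z, |z| ^ 3 ∂ν := by
  have := hν.prob
  have i0 : Integrable (fun _ : ℝ => a₀) ν := integrable_const _
  have i1 : Integrable (fun z : ℝ => a₁ * z) ν := hν.int1.const_mul _
  have i2 : Integrable (fun z : ℝ => a₂ * z ^ 2) ν := hν.int2.const_mul _
  have i3 : Integrable (fun z : ℝ => a₃ * |z| ^ 3) ν := hν.int3.const_mul _
  have i01 : Integrable (fun z : ℝ => a₀ + a₁ * z) ν := i0.add i1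
  have i012 : Integrable (fun z : ℝ => a₀ + a₁ * z + a₂ * z ^ 2) ν := i01.add i2
  rw [integral_add i012 i3, integral_add i01 i2, integral_add i0 i1, integral_const_mul,
    integral_const_mul, integral_const_mul, hν.mean, hν.var]
  simp

/-- Expanding to second order in z and integrating, the mean-zero term drops out and the variance θβ
turns `Params.drift_le` into a gain of 2κβ. All other contributions are o(β): the third moment, the
change from β to β', the motion of the correction, and the product of κβ with the correction. The
variances θ, θ' exchange roles after the step. -/
lemma Params.exists_lyap_decay {δ Θ θ₀ t : ℝ} (hδ : 0 < δ) (hθ₀ : 0 < θ₀) (hΘ : 0 < Θ)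
    (ht0 : 0 < t) (ht : t ≤ θ₀ * δ ^ 3 / (2048 * Θ)) :
    ∃ κ > 0, ∃ ε > 0, ε ≤ 1 ∧ 4 * (ε * corrBound δ Θ) ≤ 1 ∧
      ∀ c θ θ' β β' : ℝ, Params δ Θ c t θ₀ θ θ' → 0 < β → β ≤ ε → 0 ≤ β' →
      |β' - β| ≤ ε * β → ∀ ν : Measure ℝ, NoiseLaw ν (θ * β) (ε * β) →
      ∀ p u : ℝ, (p, u) ≠ 0 →
      ∫⁻ z, ENNReal.ofReal (lyap c t θ₀ θ' θ β' u ((c + z) * u - p)) ∂ν ≤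
        ENNReal.ofReal ((1 - κ * β) * lyap c t θ₀ θ θ' β p u) := by
  -- Half the constant of `Params.drift_le`: the drift yields -2κβ, and the errors may consume κβ.
  obtain ⟨κ, hκ⟩ : ∃ κ, κ = t * θ₀ * δ ^ 2 / 64 := ⟨_, rfl⟩
  have hκ0 : 0 < κ := by rw [hκ]; positivity
  obtain ⟨S, hS⟩ : ∃ S, S = stabConst δ Θ := ⟨_, rfl⟩
  have hS0 : 0 < S := hS ▸ stabConst_pos hδ hΘ
  obtain ⟨C, hC⟩ : ∃ C, C = corrBound δ Θ := ⟨_, rfl⟩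
  have hC0 : 0 < C := hC ▸ corrBound_pos hδ hΘ
  -- Parameter in |z| ≤ η + z²/η, chosen so that β'Sη ≤ κβ/2 when β' ≤ 2β.
  obtain ⟨η, hη⟩ : ∃ η, η = κ / (4 * S) := ⟨_, rfl⟩
  have hη0 : 0 < η := by rw [hη]; positivity
  -- K collects the coefficients of the errors of order εβ: the product of κβ with the correction,
  -- the third moment, the change of β, and the z²/η part of the splitting of |z|.
  obtain ⟨K, hK⟩ : ∃ K, K = κ * C + 150 * (4 / δ) ^ 4 + C + 2 * S * (Θ * (1 / η + 1)) := ⟨_, rfl⟩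
  have hK0 : 0 < K := by rw [hK]; positivity
  refine ⟨κ, hκ0, min 1 (min (κ / (2 * K)) (1 / (4 * C))), by positivity, min_le_left _ _, ?_, ?_⟩
  · have : min 1 (min (κ / (2 * K)) (1 / (4 * C))) ≤ 1 / (4 * C) :=
      (min_le_right _ _).trans (min_le_right _ _)
    rw [← hC]
    calc _ ≤ 4 * (1 / (4 * C) * C) := by gcongr
      _ = 1 := by field_simp
  intro c θ θ' β β' h hβ hβε hβ' hββ ν hν p u hpu
  obtain ⟨ε, hε⟩ : ∃ ε, ε = min 1 (min (κ / (2 * K)) (1 / (4 * C))) := ⟨_, rfl⟩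
  rw [← hε] at hβε hββ hν
  have hε1 : ε ≤ 1 := hε ▸ min_le_left _ _
  have hε0 : 0 < ε := by rw [hε]; positivity
  have hεK : ε * K ≤ κ / 2 := by
    have : ε ≤ κ / (2 * K) := hε ▸ (min_le_right _ _).trans (min_le_left _ _)
    calc ε * K ≤ κ / (2 * K) * K := by gcongr
      _ = _ := by field_simp
  have hεC : ε * C ≤ 1 / 4 := by
    have : ε ≤ 1 / (4 * C) := hε ▸ (min_le_right _ _).trans (min_le_right _ _)
    calc ε * C ≤ 1 / (4 * C) * C := by gcongr
      _ = _ := by field_simp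
  have hβ2 : β' ≤ 2 * β := by
    have := (abs_le.1 hββ).2; nlinarith
  have hd0 := h.δ0.trans_le h.cd
  have hq : 0 < qf c p u := qf_pos hd0 hpu
  have hqt : 0 < qf c p u ^ (-t) := by positivity
  have := hν.prob
  have hdrift := h.drift_le ht hpu
  obtain ⟨ℓ, hℓ⟩ : ∃ ℓ, ℓ = u * (c * u - 2 * p) / qf c p u := ⟨_, rfl⟩
  obtain ⟨a, ha⟩ : ∃ a, a = -t * (u ^ 2 / qf c p u) + (t / 2 + 4 * t ^ 2) * ℓ ^ 2 := ⟨_, rfl⟩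
  obtain ⟨h0, hh0⟩ : ∃ h0, h0 = corr c t θ₀ θ' θ u (c * u - p) := ⟨_, rfl⟩
  have hpu0 : (u, c * u - p) ≠ 0 := by simpa using shear_ne_zero (c := c) (z := 0) hpu
  have hh0C : |h0| ≤ C := by rw [hh0, hC]; exact h.swap.abs_corr_le hpu0
  have hhC : |corr c t θ₀ θ θ' p u| ≤ C := by rw [hC]; exact h.abs_corr_le hpu
  have hpt : ∀ z, lyap c t θ₀ θ' θ β' u ((c + z) * u - p) ≤ qf c p u ^ (-t) *
      ((1 + β' * h0 + β' * S * η) + (-(t * ℓ)) * z + (a + β' * S * (1 / η + 1)) * z ^ 2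
        + 150 * (4 / δ) ^ 4 * |z| ^ 3) := by
    intro z
    refine (h.swap.lyap_shear_le hβ' z hpu).trans ?_
    rw [← hℓ, ← ha, ← hh0, ← hS]
    have hz : |z| ≤ η + 1 / η * z ^ 2 := by
      rw [← sq_abs z]
      have : η + 1 / η * |z| ^ 2 - |z| = ((η - |z|) ^ 2 + η * |z|) / η := by field_simp; ring
      have h2 : 0 ≤ ((η - |z|) ^ 2 + η * |z|) / η := by positivity
      linarith
    have := mul_le_mul_of_nonneg_left hz (mul_nonneg hβ' hS0.le)
    refine mul_le_mul_of_nonneg_left ?_ hqt.le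
    linarith
  have hint : Integrable (fun z : ℝ => qf c p u ^ (-t) *
      ((1 + β' * h0 + β' * S * η) + (-(t * ℓ)) * z + (a + β' * S * (1 / η + 1)) * z ^ 2
        + 150 * (4 / δ) ^ 4 * |z| ^ 3)) ν :=
    (hν.integrable_cubic _ _ _ _).const_mul _
  have hnn : ∀ z, 0 ≤ lyap c t θ₀ θ' θ β' u ((c + z) * u - p) := by
    intro z
    have hne := shear_ne_zero (c := c) (z := z) hpu
    have hqz : 0 < qf c u ((c + z) * u - p) := qf_pos hd0 hne
    have hb := (h.swap.lyap_bounds hβ' (by rw [← hC]; nlinarith) hne).1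
    have : 0 < qf c u ((c + z) * u - p) ^ (-t) := by positivity
    linarith
  calc _ ≤ ∫⁻ z, ENNReal.ofReal (qf c p u ^ (-t) *
      ((1 + β' * h0 + β' * S * η) + (-(t * ℓ)) * z + (a + β' * S * (1 / η + 1)) * z ^ 2
        + 150 * (4 / δ) ^ 4 * |z| ^ 3)) ∂ν := by
        apply lintegral_mono; intro z; exact ENNReal.ofReal_le_ofReal (hpt z)
    _ = ENNReal.ofReal (∫ z, qf c p u ^ (-t) *
      ((1 + β' * h0 + β' * S * η) + (-(t * ℓ)) * z + (a + β' * S * (1 / η + 1)) * z ^ 2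
        + 150 * (4 / δ) ^ 4 * |z| ^ 3) ∂ν) := by
        rw [ofReal_integral_eq_lintegral_ofReal hint]
        exact Eventually.of_forall fun z => (hnn z).trans (hpt z)
    _ ≤ _ := by
        apply ENNReal.ofReal_le_ofReal
        rw [integral_const_mul, hν.integral_cubic]
        unfold lyap
        rw [mul_left_comm (1 - κ * β)]
        refine mul_le_mul_of_nonneg_left ?_ hqt.le
        have h3 := mul_le_mul_of_nonneg_left hν.third
          (show (0 : ℝ) ≤ 150 * (4 / δ) ^ 4 by positivity)
        rw [← hℓ, ← ha, ← hh0] at hdrift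
        obtain ⟨hc, hhc⟩ : ∃ hc, hc = corr c t θ₀ θ θ' p u := ⟨_, rfl⟩
        rw [← hhc] at hdrift hhC ⊢
        have hθ := h.theta_pos
        have e1 : β' * h0 ≤ β * h0 + ε * β * C := by
          have : (β' - β) * h0 ≤ ε * β * C := by
            refine (le_abs_self _).trans ?_
            rw [abs_mul]; gcongr
          linarith
        have e2 : β' * S * η ≤ β * (κ / 2) := by
          have : S * η = κ / 4 := by rw [hη]; field_simp
          calc β' * S * η = β' * (S * η) := by ring
            _ ≤ 2 * β * (κ / 4) := by rw [this]; gcongr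
            _ = _ := by ring
        have e3 : β' * S * (1 / η + 1) * (θ * β) ≤ ε * β * (2 * S * (Θ * (1 / η + 1))) := by
          calc β' * S * (1 / η + 1) * (θ * β) ≤ (2 * ε) * S * (1 / η + 1) * (Θ * β) := by
                gcongr
                · linarith
                · exact h.hΘ
            _ = _ := by ring
        have e4 : κ * β * β * hc ≤ ε * β * (κ * C) := by
          have : |κ * β * β * hc| ≤ ε * β * (κ * C) := by
            rw [abs_mul, abs_of_nonneg (by positivity)]
            calc κ * β * β * |hc| ≤ κ * β * ε * C := by gcongr
              _ = _ := by ring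
          exact (abs_le.1 this).2
        have e5 : β * (θ * a + h0 - hc) ≤ β * (-(2 * κ)) := by
          gcongr; rw [hκ]; linarith
        have e6 : β * (ε * K) ≤ β * (κ / 2) := by gcongr
        rw [hK] at e6
        linarith

/-- Crude one-step bound. -/
lemma lintegral_qf_shear_le {δ c t τ η : ℝ} (hδ : 0 < δ) (hδ1 : δ ≤ 1) (hd : δ ≤ 4 - c ^ 2)
    (ht0 : 0 < t) (ht1 : t ≤ 1) {ν : Measure ℝ} (hν : NoiseLaw ν τ η) {p u : ℝ} (hpu : (p, u) ≠ 0) :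
    ∫⁻ z, ENNReal.ofReal (qf c u ((c + z) * u - p) ^ (-t)) ∂ν ≤
      ENNReal.ofReal (4 / δ * (2 + 2 * τ) * qf c p u ^ (-t)) := by
  have hd0 := hδ.trans_le hd
  have hq : 0 < qf c p u := qf_pos hd0 hpu
  have := hν.prob
  have hM : 1 ≤ 4 / δ := by rw [le_div_iff₀ hδ]; linarith
  have hpt : ∀ z, qf c u ((c + z) * u - p) ^ (-t) ≤
      4 / δ * qf c p u ^ (-t) * (2 + 2 * z ^ 2) := by
    intro z
    have hq' : 0 < qf c u ((c + z) * u - p) := qf_pos hd0 (shear_ne_zero hpu)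
    have hr0 : 0 < qf c u ((c + z) * u - p) / qf c p u := by positivity
    have hz := abs_nonneg z
    have h1 := rpow_neg_le_of_one_le_mul hr0 (N := 4 / δ * (1 + |z|) ^ 2)
      (by nlinarith [sq_nonneg |z|]) ht0.le ht1
      (by rw [← mul_div_assoc, le_div_iff₀ hq, one_mul]
          exact qf_le_mul_qf_shear p u z hδ hδ1 hd)
    have e : qf c u ((c + z) * u - p) ^ (-t) =
        qf c p u ^ (-t) * (qf c u ((c + z) * u - p) / qf c p u) ^ (-t) := by
      rw [← Real.mul_rpow hq.le hr0.le, mul_div_cancel₀ _ hq.ne']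
    rw [e]
    calc _ ≤ qf c p u ^ (-t) * (4 / δ * (1 + |z|) ^ 2) := by gcongr
      _ ≤ qf c p u ^ (-t) * (4 / δ * (2 + 2 * z ^ 2)) := by
          gcongr; rw [← sq_abs z]; nlinarith [sq_nonneg (1 - |z|)]
      _ = _ := by ring
  have hint : Integrable (fun z : ℝ => 4 / δ * qf c p u ^ (-t) * (2 + 2 * z ^ 2)) ν :=
    ((integrable_const _).add (hν.int2.const_mul _)).const_mul _
  calc _ ≤ ∫⁻ z, ENNReal.ofReal (4 / δ * qf c p u ^ (-t) * (2 + 2 * z ^ 2)) ∂ν :=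
        lintegral_mono fun z => ENNReal.ofReal_le_ofReal (hpt z)
    _ = ENNReal.ofReal (∫ z, 4 / δ * qf c p u ^ (-t) * (2 + 2 * z ^ 2) ∂ν) := by
        rw [ofReal_integral_eq_lintegral_ofReal hint]
        exact Eventually.of_forall fun z => by positivity
    _ = _ := by
        rw [integral_const_mul, integral_add (integrable_const _) (hν.int2.const_mul _),
          integral_const_mul, hν.var]
        simp only [integral_const, probReal_univ, smul_eq_mul, one_mul]
        congr 1; ring


/-! ### Independence and iteration along the random recursion. -/

/-- If `F z y` depends only on the coordinates `z i`, `i ∈ S`, with `k ∉ S`, then the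
variable `Z k` can be integrated out first. -/
lemma lintegral_coord {Ω : Type*} [MeasurableSpace Ω] {P : Measure Ω} [IsProbabilityMeasure P]
    {Z : ℕ → Ω → ℝ} (hZ : ∀ k, Measurable (Z k)) (hind : iIndepFun Z P) (S : Finset ℕ) {k : ℕ}
    (hk : k ∉ S) (F : (ℕ → ℝ) → ℝ → ENNReal) (hF : Measurable (Function.uncurry F))
    (hloc : ∀ z z' y, (∀ i ∈ S, z i = z' i) → F z y = F z' y) :
    ∫⁻ ω, F (fun i => Z i ω) (Z k ω) ∂P =
      ∫⁻ ω, ∫⁻ y, F (fun i => Z i ω) y ∂(P.map (Z k)) ∂P := by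
  classical
  let X : Ω → (S → ℝ) := fun ω i => Z i ω
  have hX : Measurable X := measurable_pi_lambda _ fun i => hZ i
  let ext : (S → ℝ) → ℕ → ℝ := fun x i => if h : i ∈ S then x ⟨i, h⟩ else 0
  have hext : Measurable ext := by
    refine measurable_pi_lambda _ fun i => ?_
    by_cases h : i ∈ S
    · simpa [ext, h] using measurable_pi_apply _
    · simp [ext, h]
  have hXY : IndepFun X (Z k) P := by
    have h1 := iIndepFun.indepFun_finset S {k} (by simpa using hk) hind hZ
    have hm : Measurable fun g : (({k} : Finset ℕ) → ℝ) => g ⟨k, by simp⟩ :=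
      measurable_pi_apply _
    exact h1.comp measurable_id hm
  have hG : Measurable fun q : (S → ℝ) × ℝ => F (ext q.1) q.2 :=
    hF.comp ((hext.comp measurable_fst).prodMk measurable_snd)
  have hEq : ∀ ω y, F (fun i => Z i ω) y = F (ext (X ω)) y := by
    intro ω y
    apply hloc
    intro i hi
    simp [ext, X, hi]
  have hmap := (indepFun_iff_map_prod_eq_prod_map_map hX.aemeasurable (hZ k).aemeasurable).1 hXY
  have := Measure.isProbabilityMeasure_map (μ := P) (hZ k).aemeasurable
  have := Measure.isProbabilityMeasure_map (μ := P) hX.aemeasurable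
  calc ∫⁻ ω, F (fun i => Z i ω) (Z k ω) ∂P = ∫⁻ ω, F (ext (X ω)) (Z k ω) ∂P := by
        simp_rw [hEq]
    _ = ∫⁻ q, F (ext q.1) q.2 ∂(P.map fun ω => (X ω, Z k ω)) := by
        rw [lintegral_map hG (hX.prodMk (hZ k))]
    _ = ∫⁻ x, ∫⁻ y, F (ext x) y ∂(P.map (Z k)) ∂(P.map X) := by
        rw [hmap, lintegral_prod _ hG.aemeasurable]
    _ = ∫⁻ ω, ∫⁻ y, F (ext (X ω)) y ∂(P.map (Z k)) ∂P := by
        rw [lintegral_map hG.lintegral_prod_right' hX]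
    _ = _ := by simp_rw [hEq]

/-- The pair `(u_{k-1}, u_k)` of the recursion `u_{k+1} = (c + z_k) u_k - u_{k-1}`,
`u_{-1} = 0`, `u_0 = 1`. -/
def state (c : ℝ) (z : ℕ → ℝ) : ℕ → ℝ × ℝ
  | 0 => (0, 1)
  | k + 1 => ((state c z k).2, (c + z k) * (state c z k).2 - (state c z k).1)

lemma state_ne_zero (c : ℝ) (z : ℕ → ℝ) (k : ℕ) : state c z k ≠ 0 := by
  induction k with
  | zero => simp [state]
  | succ k ih => exact shear_ne_zero ih

lemma state_congr (c : ℝ) {z z' : ℕ → ℝ} (k : ℕ) (h : ∀ i < k, z i = z' i) :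
    state c z k = state c z' k := by
  induction k with
  | zero => rfl
  | succ k ih =>
    simp only [state, ih fun i hi => h i (by omega), h k (by omega)]

lemma measurable_state (c : ℝ) (k : ℕ) : Measurable fun z : ℕ → ℝ => state c z k := by
  induction k with
  | zero => exact measurable_const
  | succ k ih =>
    exact ih.snd.prodMk (((measurable_const.add (measurable_pi_apply k)).mul ih.snd).sub ih.fst)

lemma measurable_qf (c : ℝ) : Measurable fun q : ℝ × ℝ => qf c q.1 q.2 := by
  unfold qf; fun_prop

lemma measurable_corr (c t θ₀ θ θ' : ℝ) : Measurable fun q : ℝ × ℝ => corr c t θ₀ θ θ' q.1 q.2 := by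
  have := measurable_qf c
  unfold corr corrPoly; fun_prop

lemma measurable_lyap (c t θ₀ θ θ' β : ℝ) :
    Measurable fun q : ℝ × ℝ => lyap c t θ₀ θ θ' β q.1 q.2 := by
  have h1 := measurable_qf c
  have h2 := measurable_corr c t θ₀ θ θ'
  unfold lyap
  exact (h1.pow_const _).mul ((h2.const_mul _).const_add _)

section Iteration

variable {Ω : Type*} [MeasurableSpace Ω] {P : Measure Ω} [IsProbabilityMeasure P]

/-- The state at time k and the weight at time j ≤ k depend only on the noises before k, so `Z k`
can be averaged first and a bound for deterministic states propagates to expectations. -/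
lemma lintegral_state_succ_le {Z : ℕ → Ω → ℝ} (hZ : ∀ k, Measurable (Z k)) (hind : iIndepFun Z P)
    {c : ℝ} {j k : ℕ} (hjk : j ≤ k) {w : ℝ → ENNReal} (hw : Measurable w) {f g : ℝ → ℝ → ℝ}
    (hf : Measurable fun q : ℝ × ℝ => f q.1 q.2) (hg : Measurable fun q : ℝ × ℝ => g q.1 q.2)
    {r : ℝ} (hr : 0 ≤ r)
    (h : ∀ p u, (p, u) ≠ 0 → ∫⁻ z, ENNReal.ofReal (f u ((c + z) * u - p)) ∂(P.map (Z k)) ≤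
      ENNReal.ofReal (r * g p u)) :
    ∫⁻ ω, w (state c (fun i => Z i ω) j).2 *
        ENNReal.ofReal (f (state c (fun i => Z i ω) (k + 1)).1 (state c (fun i => Z i ω) (k + 1)).2) ∂P
      ≤ ENNReal.ofReal r * ∫⁻ ω, w (state c (fun i => Z i ω) j).2 *
        ENNReal.ofReal (g (state c (fun i => Z i ω) k).1 (state c (fun i => Z i ω) k).2) ∂P := by
  let F : (ℕ → ℝ) → ℝ → ENNReal := fun z y => w (state c z j).2 *
    ENNReal.ofReal (f (state c z k).2 ((c + y) * (state c z k).2 - (state c z k).1))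
  have hFm : Measurable (Function.uncurry F) := by
    have h1 : Measurable fun q : (ℕ → ℝ) × ℝ => state c q.1 k :=
      (measurable_state c k).comp measurable_fst
    have h2 : Measurable fun q : (ℕ → ℝ) × ℝ => state c q.1 j :=
      (measurable_state c j).comp measurable_fst
    refine (hw.comp h2.snd).mul (ENNReal.measurable_ofReal.comp ?_)
    exact hf.comp (h1.snd.prodMk (((measurable_snd.const_add c).mul h1.snd).sub h1.fst))
  have hloc : ∀ z z' y, (∀ i ∈ Finset.range k, z i = z' i) → F z y = F z' y := by
    intro z z' y hz
    simp only [Finset.mem_range] at hz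
    simp only [F, state_congr c k hz, state_congr c j fun i hi => hz i (by omega)]
  have hkey := lintegral_coord hZ hind (Finset.range k) (k := k) (by simp) F hFm hloc
  calc _ = ∫⁻ ω, F (fun i => Z i ω) (Z k ω) ∂P := rfl
    _ = _ := hkey
    _ ≤ ∫⁻ ω, ENNReal.ofReal r * (w (state c (fun i => Z i ω) j).2 *
        ENNReal.ofReal (g (state c (fun i => Z i ω) k).1 (state c (fun i => Z i ω) k).2)) ∂P := by
        apply lintegral_mono
        intro ω
        have hm : Measurable fun y => ENNReal.ofReal (f (state c (fun i => Z i ω) k).2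
            ((c + y) * (state c (fun i => Z i ω) k).2 - (state c (fun i => Z i ω) k).1)) := by
          refine ENNReal.measurable_ofReal.comp ?_
          exact hf.comp (measurable_const.prodMk
            (((measurable_id.const_add c).mul measurable_const).sub measurable_const))
        simp only [F]
        rw [lintegral_const_mul _ hm, mul_left_comm, ← ENNReal.ofReal_mul hr]
        gcongr
        exact h _ _ (state_ne_zero c _ k)
    _ = _ := by
        rw [lintegral_const_mul]
        exact (hw.comp ((measurable_state c j).comp (measurable_pi_lambda _ hZ)).snd).mul
          (ENNReal.measurable_ofReal.comp
            (hg.comp ((measurable_state c k).comp (measurable_pi_lambda _ hZ))))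

/-- Alternating parameters. -/
def alt (θ θ' : ℝ) (k : ℕ) : ℝ := if Even k then θ else θ'

lemma alt_succ (θ θ' : ℝ) (k : ℕ) : alt θ θ' (k + 1) = alt θ' θ k := by
  unfold alt
  by_cases h : Even k <;> simp [h, Nat.even_add_one]

lemma Params.alt {δ Θ c t θ₀ θ θ' : ℝ} (h : Params δ Θ c t θ₀ θ θ') (k : ℕ) :
    Params δ Θ c t θ₀ (alt θ θ' k) (alt θ' θ k) := by
  unfold DecayingDirac.alt
  by_cases hk : Even k
  · simpa [hk] using h
  · simpa [hk] using h.swap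

/-- The weight |u_j|^{2t} normalizes the start: |u_j|^{2t} Q_j^{-t} = (u_j²/Q_j)^t is bounded. From
there the crude bound runs until the Lyapunov contraction becomes available, and the product of the
factors 1 - κβ_i is at most the exponential of -κ∑β_i. -/
lemma state_moment_decay {δ Θ θ₀ t : ℝ} (hδ : 0 < δ) (hδ1 : δ ≤ 1) (hθ₀ : 0 < θ₀) (hΘ : 0 < Θ)
    (ht0 : 0 < t) (ht1 : t ≤ 1) (ht : t ≤ θ₀ * δ ^ 3 / (2048 * Θ)) {β η : ℕ → ℝ}
    (hβ0 : ∀ k, 0 < β k) (hβ : ∀ ε > 0, ∀ᶠ k in atTop, β k ≤ ε)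
    (hββ : ∀ ε > 0, ∀ᶠ k in atTop, |β (k + 1) - β k| ≤ ε * β k)
    (hη : ∀ ε > 0, ∀ᶠ k in atTop, η k ≤ ε * β k) :
    ∃ κ > 0, ∀ j : ℕ, ∃ C > 0, ∀ (c θ θ' : ℝ), Params δ Θ c t θ₀ θ θ' → ∀ Z : ℕ → Ω → ℝ,
      (∀ k, Measurable (Z k)) → iIndepFun Z P →
      (∀ k, NoiseLaw (P.map (Z k)) (alt θ θ' k * β k) (η k)) → ∀ k ≥ j,
      ∫⁻ ω, ENNReal.ofReal (|(state c (fun i => Z i ω) j).2| ^ (2 * t)) *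
        ENNReal.ofReal (qf c (state c (fun i => Z i ω) k).1 (state c (fun i => Z i ω) k).2 ^ (-t)) ∂P
      ≤ ENNReal.ofReal (C * Real.exp (-κ * ∑ i ∈ Finset.range k, β i)) := by
  obtain ⟨κ, hκ, ε, hε, hε1, hεC, hstep⟩ := Params.exists_lyap_decay hδ hθ₀ hΘ ht0 ht
  refine ⟨κ, hκ, fun j => ?_⟩
  -- N depends only on j, ε and the sequences β, η, which makes the final constant uniform in c, θ,
  -- θ' and in the noises.
  obtain ⟨N, hN⟩ := eventually_atTop.1 (((hβ ε hε).and (hββ ε hε)).and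
    ((hη ε hε).and (eventually_ge_atTop j)))
  obtain ⟨a, ha⟩ : ∃ a : ℕ → ℝ, a = fun k => 4 / δ * (2 + 2 * (Θ * β k)) := ⟨_, rfl⟩
  have hM : 1 ≤ 4 / δ := by rw [le_div_iff₀ hδ]; linarith
  have ha1 : ∀ k, 1 ≤ a k := by
    intro k
    have := mul_pos hΘ (hβ0 k)
    rw [ha]; nlinarith
  -- Accumulated crude growth. Each factor is at least 1, so starting the product at 0 instead of j
  -- only enlarges it and keeps D monotone.
  obtain ⟨D, hD⟩ : ∃ D : ℕ → ℝ, D = fun k => 4 / δ * ∏ i ∈ Finset.range k, a i := ⟨_, rfl⟩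
  have hD0 : ∀ k, 0 < D k := by
    intro k; rw [hD]
    have : 0 < ∏ i ∈ Finset.range k, a i := Finset.prod_pos fun i _ => by linarith [ha1 i]
    positivity
  have hDm : Monotone D := by
    refine monotone_nat_of_le_succ fun k => ?_
    have h1 := hD0 k
    have : D (k + 1) = D k * a k := by rw [hD]; simp only [Finset.prod_range_succ]; ring
    rw [this]
    exact le_mul_of_one_le_right h1.le (ha1 k)
  set s : ℕ → ℝ := fun k => ∑ i ∈ Finset.range k, β i with hs
  have hsm : Monotone s := by
    refine monotone_nat_of_le_succ fun k => ?_
    simp only [hs, Finset.sum_range_succ]; linarith [hβ0 k]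
  have hDN := hD0 N
  refine ⟨4 * D N * Real.exp (κ * s N), by positivity, ?_⟩
  intro c θ θ' h Z hZ hind hlaw
  have hd0 := hδ.trans_le h.cd
  let w : ℝ → ENNReal := fun x => ENNReal.ofReal (|x| ^ (2 * t))
  have hw : Measurable w := ENNReal.measurable_ofReal.comp (measurable_norm.pow_const _)
  have hqm : Measurable fun q : ℝ × ℝ => qf c q.1 q.2 ^ (-t) := (measurable_qf c).pow_const _
  have crude : ∀ k ≥ j, ∫⁻ ω, w (state c (fun i => Z i ω) j).2 *
        ENNReal.ofReal (qf c (state c (fun i => Z i ω) k).1 (state c (fun i => Z i ω) k).2 ^ (-t)) ∂P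
      ≤ ENNReal.ofReal (D k) := by
    intro k hk
    induction k, hk using Nat.le_induction with
    | base =>
      calc _ ≤ ∫⁻ _, ENNReal.ofReal (4 / δ) ∂P := by
            apply lintegral_mono
            intro ω
            have hne := state_ne_zero c (fun i => Z i ω) j
            set p := (state c (fun i => Z i ω) j).1
            set u := (state c (fun i => Z i ω) j).2
            have hq : 0 < qf c p u := qf_pos hd0 hne
            simp only [w]
            rw [← ENNReal.ofReal_mul (by positivity)]
            apply ENNReal.ofReal_le_ofReal
            have h1 : |u| ^ (2 * t) = (u ^ 2) ^ t := by
              rw [Real.rpow_mul (abs_nonneg _)]; norm_num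
            rw [h1, Real.rpow_neg hq.le, ← Real.inv_rpow hq.le,
              ← Real.mul_rpow (by positivity) (by positivity), ← div_eq_mul_inv]
            have h2 : u ^ 2 / qf c p u ≤ 4 / δ := by
              rw [div_le_iff₀ hq]; exact sq_snd_le_qf p u hδ h.cd
            calc (u ^ 2 / qf c p u) ^ t ≤ (4 / δ) ^ t := by gcongr
              _ ≤ (4 / δ) ^ (1 : ℝ) := Real.rpow_le_rpow_of_exponent_le hM ht1
              _ = _ := Real.rpow_one _
        _ = ENNReal.ofReal (4 / δ) := by simp
        _ = ENNReal.ofReal (D 0) := by rw [hD]; simp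
        _ ≤ _ := ENNReal.ofReal_le_ofReal (hDm (Nat.zero_le _))
    | succ k hk ih =>
      have ha0 : 0 ≤ a k := by linarith [ha1 k]
      refine (lintegral_state_succ_le hZ hind hk hw (f := fun p u => qf c p u ^ (-t))
        (g := fun p u => qf c p u ^ (-t)) hqm hqm ha0 ?_).trans ?_
      · intro p u hpu
        refine (lintegral_qf_shear_le hδ hδ1 h.cd ht0 ht1 (hlaw k) hpu).trans ?_
        have : 0 ≤ qf c p u ^ (-t) := Real.rpow_nonneg (qf_pos hd0 hpu).le _
        have hak : a k = 4 / δ * (2 + 2 * (Θ * β k)) := by rw [ha]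
        rw [hak]
        apply ENNReal.ofReal_le_ofReal
        have := (h.alt k).hΘ
        have := (hβ0 k).le
        gcongr
      · calc _ ≤ ENNReal.ofReal (a k) * ENNReal.ofReal (D k) := by gcongr
          _ = _ := by
            rw [← ENNReal.ofReal_mul ha0]; congr 1; rw [hD]
            simp only [Finset.prod_range_succ]; ring
  have hbd : ∀ k ≥ N, ∀ p u, (p, u) ≠ 0 →
      qf c p u ^ (-t) ≤ 2 * lyap c t θ₀ (alt θ θ' k) (alt θ' θ k) (β k) p u ∧
      lyap c t θ₀ (alt θ θ' k) (alt θ' θ k) (β k) p u ≤ 2 * qf c p u ^ (-t) := by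
    intro k hk p u hpu
    refine (h.alt k).lyap_bounds (hβ0 k).le ?_ hpu
    have h1 : β k * corrBound δ Θ ≤ ε * corrBound δ Θ := by
      have := (corrBound_pos hδ hΘ).le
      gcongr; exact (hN k hk).1.1
    have := corrBound_pos hδ hΘ
    nlinarith [mul_pos hε this]
  have fine : ∀ k ≥ N, ∫⁻ ω, w (state c (fun i => Z i ω) j).2 *
        ENNReal.ofReal (lyap c t θ₀ (alt θ θ' k) (alt θ' θ k) (β k)
          (state c (fun i => Z i ω) k).1 (state c (fun i => Z i ω) k).2) ∂P
      ≤ ENNReal.ofReal (2 * D N * Real.exp (-κ * (s k - s N))) := by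
    intro k hk
    induction k, hk using Nat.le_induction with
    | base =>
      have hjN : j ≤ N := (hN N le_rfl).2.2
      calc _ ≤ ∫⁻ ω, ENNReal.ofReal 2 * (w (state c (fun i => Z i ω) j).2 *
          ENNReal.ofReal (qf c (state c (fun i => Z i ω) N).1 (state c (fun i => Z i ω) N).2 ^ (-t)))
          ∂P := by
            apply lintegral_mono
            intro ω
            beta_reduce
            rw [mul_left_comm, ← ENNReal.ofReal_mul (p := 2) (by norm_num)]
            gcongr
            exact (hbd N le_rfl _ _ (state_ne_zero c _ N)).2
        _ ≤ ENNReal.ofReal 2 * ENNReal.ofReal (D N) := by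
            rw [lintegral_const_mul' _ _ ENNReal.ofReal_ne_top]
            gcongr
            exact crude N hjN
        _ = _ := by rw [← ENNReal.ofReal_mul (by norm_num)]; simp
    | succ k hk ih =>
      obtain ⟨⟨hb1, hb2⟩, hb3, hb4⟩ := hN k hk
      have he : 0 ≤ Real.exp (-κ * β k) := (Real.exp_pos _).le
      refine (lintegral_state_succ_le hZ hind hb4 hw
        (f := fun p u => lyap c t θ₀ (alt θ θ' (k + 1)) (alt θ' θ (k + 1)) (β (k + 1)) p u)
        (g := fun p u => lyap c t θ₀ (alt θ θ' k) (alt θ' θ k) (β k) p u)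
        (measurable_lyap _ _ _ _ _ _) (measurable_lyap _ _ _ _ _ _) he ?_).trans ?_
      · intro p u hpu
        simp only [alt_succ]
        have hl := hlaw k
        refine (hstep c (alt θ θ' k) (alt θ' θ k) (β k) (β (k + 1)) (h.alt k) (hβ0 k) hb1
          (hβ0 _).le hb2 (P.map (Z k)) ⟨hl.prob, hl.int1, hl.int2, hl.int3, hl.mean, hl.var,
          hl.third.trans hb3⟩ p u hpu).trans ?_
        apply ENNReal.ofReal_le_ofReal
        have h1 := (hbd k hk p u hpu).1
        have : 0 ≤ qf c p u ^ (-t) := Real.rpow_nonneg (qf_pos hd0 hpu).le _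
        have h0 : 0 ≤ lyap c t θ₀ (alt θ θ' k) (alt θ' θ k) (β k) p u := by linarith
        gcongr
        have := Real.add_one_le_exp (-κ * β k)
        linarith
      · calc _ ≤ ENNReal.ofReal (Real.exp (-κ * β k)) *
              ENNReal.ofReal (2 * D N * Real.exp (-κ * (s k - s N))) := by gcongr
          _ = _ := by
            rw [← ENNReal.ofReal_mul he]
            congr 1
            have : s (k + 1) = s k + β k := by simp only [hs, Finset.sum_range_succ]
            rw [this, mul_left_comm, ← Real.exp_add]
            congr 2; ring
  intro k hk
  by_cases hkN : k ≤ N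
  · refine (crude k hk).trans (ENNReal.ofReal_le_ofReal ?_)
    have h1 : D k ≤ D N := hDm hkN
    have h2 : s k ≤ s N := hsm hkN
    calc D k ≤ 4 * D N * 1 := by linarith
      _ ≤ 4 * D N * Real.exp (κ * (s N - s k)) := by
        gcongr
        rw [Real.one_le_exp_iff]
        exact mul_nonneg hκ.le (by linarith)
      _ = _ := by rw [mul_assoc _ (Real.exp _), ← Real.exp_add]; congr 2; ring
  · push Not at hkN
    calc _ ≤ ∫⁻ ω, ENNReal.ofReal 2 * (w (state c (fun i => Z i ω) j).2 *
        ENNReal.ofReal (lyap c t θ₀ (alt θ θ' k) (alt θ' θ k) (β k)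
          (state c (fun i => Z i ω) k).1 (state c (fun i => Z i ω) k).2)) ∂P := by
          apply lintegral_mono
          intro ω
          simp only [w]
          rw [mul_left_comm, ← ENNReal.ofReal_mul (p := 2) (by norm_num)]
          gcongr
          exact (hbd k hkN.le _ _ (state_ne_zero c _ k)).1
      _ ≤ ENNReal.ofReal 2 * ENNReal.ofReal (2 * D N * Real.exp (-κ * (s k - s N))) := by
          rw [lintegral_const_mul' _ _ ENNReal.ofReal_ne_top]
          gcongr
          exact fine k hkN.le
      _ = _ := by
          rw [← ENNReal.ofReal_mul (by norm_num)]
          congr 1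
          rw [mul_assoc (4 * D N), ← Real.exp_add, ← mul_assoc, ← mul_assoc]
          congr 2
          · norm_num
          · ring

end Iteration


/-! ### Negative fractional moments from an L^p density. -/

lemma lintegral_Ioo_enorm_rpow_lt_top {r : ℝ} (hr : r < 1) :
    ∫⁻ y in Set.Ioo (-1 : ℝ) 1, ‖y‖ₑ ^ (-r) < ⊤ := by
  have h1 : IntegrableOn (fun x : ℝ => x ^ (-r)) (Set.Ioc 0 1) :=
    (intervalIntegral.intervalIntegrable_rpow' (by linarith)).1
  have h2 : ∫⁻ y in Set.Ioc (0 : ℝ) 1, ‖y‖ₑ ^ (-r) < ⊤ := by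
    refine lt_of_le_of_lt (le_of_eq ?_) h1.2
    apply setLIntegral_congr_fun measurableSet_Ioc
    intro y hy
    beta_reduce
    rw [Real.enorm_eq_ofReal_abs, Real.enorm_eq_ofReal_abs, abs_of_pos hy.1,
      abs_of_pos (Real.rpow_pos_of_pos hy.1 _), ENNReal.ofReal_rpow_of_pos hy.1]
  have h3 : ∫⁻ y in Set.Ico (-1 : ℝ) 0, ‖y‖ₑ ^ (-r) < ⊤ := by
    have := (Measure.measurePreserving_neg (volume : Measure ℝ)).setLIntegral_comp_preimage_emb
      (MeasurableEquiv.neg ℝ).measurableEmbedding (fun y : ℝ => ‖y‖ₑ ^ (-r)) (Set.Ioc 0 1)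
    rw [← this] at h2
    simpa using h2
  have h4 : ∫⁻ y in ({0} : Set ℝ), ‖y‖ₑ ^ (-r) = 0 := by simp
  have hsub : Set.Ioo (-1 : ℝ) 1 ⊆ Set.Ico (-1) 0 ∪ ({0} ∪ Set.Ioc 0 1) := by
    intro x hx
    rcases lt_trichotomy x 0 with h | h | h
    · exact Or.inl ⟨hx.1.le, h⟩
    · exact Or.inr (Or.inl h)
    · exact Or.inr (Or.inr ⟨h, hx.2.le⟩)
  calc _ ≤ ∫⁻ y in Set.Ico (-1 : ℝ) 0 ∪ ({0} ∪ Set.Ioc 0 1), ‖y‖ₑ ^ (-r) := lintegral_mono_set hsub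
    _ ≤ (∫⁻ y in Set.Ico (-1 : ℝ) 0, ‖y‖ₑ ^ (-r)) +
        ((∫⁻ y in ({0} : Set ℝ), ‖y‖ₑ ^ (-r)) + ∫⁻ y in Set.Ioc (0 : ℝ) 1, ‖y‖ₑ ^ (-r)) :=
        (lintegral_union_le _ _ _).trans (add_le_add le_rfl (lintegral_union_le _ _ _))
    _ < ⊤ := by rw [h4, zero_add]; exact ENNReal.add_lt_top.2 ⟨h3, h2⟩

/-- Fractional negative moments under a density in `L^p`, uniformly in the centre. -/
lemma exists_lintegral_enorm_add_rpow_le {p q r : ℝ} (hpq : p.HolderConjugate q) (hr : 0 < r)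
    (hrq : r * q < 1) :
    ∃ K > 0, ∀ {Ω : Type*} [MeasurableSpace Ω] (P : Measure Ω) [IsProbabilityMeasure P]
      (X : Ω → ℝ) (B : ℝ), Measurable X → 0 ≤ B → HasLpDensity P X p B → ∀ a : ℝ,
      ∫⁻ y, ‖y + a‖ₑ ^ (-r) ∂(P.map X) ≤ ENNReal.ofReal (K + B) := by
  have hK0 := lintegral_Ioo_enorm_rpow_lt_top hrq
  set K0 := ∫⁻ y in Set.Ioo (-1 : ℝ) 1, ‖y‖ₑ ^ (-(r * q)) with hK0d
  refine ⟨1 + K0.toReal, by positivity, ?_⟩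
  intro Ω _ P _ X B hX hB hρ a
  obtain ⟨ρ, hρ0, hρi, hρP, hρp⟩ := hρ
  have hmap : P.map X = volume.withDensity fun y => ENNReal.ofReal (ρ y) := by
    ext A hA
    rw [Measure.map_apply hX hA, withDensity_apply _ hA, hρP A hA]
  have hρm : AEMeasurable (fun y => ENNReal.ofReal (ρ y)) volume :=
    hρi.aestronglyMeasurable.aemeasurable.ennreal_ofReal
  have hone : ∫⁻ y, ENNReal.ofReal (ρ y) = 1 := by
    have := hρP Set.univ MeasurableSet.univ
    rw [Set.preimage_univ, measure_univ, Measure.restrict_univ] at this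
    exact this.symm
  have hfm : Measurable fun y : ℝ => ‖y + a‖ₑ ^ (-r) := by fun_prop
  rw [hmap, lintegral_withDensity_eq_lintegral_mul₀ hρm hfm.aemeasurable]
  have hq1 : (1 : ENNReal) ≤ ENNReal.ofReal q := by
    rw [ENNReal.one_le_ofReal]; exact hpq.symm.lt.le
  have hp1 : (1 : ENNReal) ≤ ENNReal.ofReal p := by
    rw [ENNReal.one_le_ofReal]; exact hpq.lt.le
  -- Within distance 1 of the singularity, Young's inequality separates ρ^p from |y+a|^{-rq}, which
  -- is integrable since rq < 1; farther away |y+a|^{-r} ≤ 1 and the total mass of ρ suffices.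
  have hpt : ∀ y, ((fun y => ENNReal.ofReal (ρ y)) * fun y => ‖y + a‖ₑ ^ (-r)) y ≤
      ENNReal.ofReal (ρ y) + (ENNReal.ofReal (ρ y ^ p) +
        (Set.Ioo (-1 : ℝ) 1).indicator (fun y => ‖y‖ₑ ^ (-(r * q))) (y + a)) := by
    intro y
    simp only [Pi.mul_apply]
    by_cases hy : y + a ∈ Set.Ioo (-1 : ℝ) 1
    · rw [Set.indicator_of_mem hy]
      refine le_add_left ?_
      refine (ENNReal.young_inequality _ _ hpq).trans ?_
      rw [ENNReal.ofReal_rpow_of_nonneg (hρ0 y) hpq.pos.le, ← ENNReal.rpow_mul, neg_mul]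
      gcongr
      · exact ENNReal.div_le_of_le_mul (le_mul_of_one_le_right zero_le hp1)
      · exact ENNReal.div_le_of_le_mul (le_mul_of_one_le_right zero_le hq1)
    · refine le_add_right ?_
      have h1 : 1 ≤ ‖y + a‖ₑ := by
        rw [Real.enorm_eq_ofReal_abs, ENNReal.one_le_ofReal]
        by_contra hn
        exact hy (abs_lt.1 (not_le.1 hn))
      have h2 : ‖y + a‖ₑ ^ (-r) ≤ 1 := ENNReal.rpow_le_one_of_one_le_of_neg h1 (by linarith)
      exact mul_le_of_le_one_right zero_le h2
  have hind : Measurable ((Set.Ioo (-1 : ℝ) 1).indicator (fun y : ℝ => ‖y‖ₑ ^ (-(r * q)))) :=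
    Measurable.indicator (by fun_prop) measurableSet_Ioo
  have hind2 : Measurable fun y : ℝ =>
      (Set.Ioo (-1 : ℝ) 1).indicator (fun y : ℝ => ‖y‖ₑ ^ (-(r * q))) (y + a) :=
    hind.comp (measurable_add_const a)
  calc _ ≤ ∫⁻ y, (ENNReal.ofReal (ρ y) + (ENNReal.ofReal (ρ y ^ p) +
        (Set.Ioo (-1 : ℝ) 1).indicator (fun y => ‖y‖ₑ ^ (-(r * q))) (y + a))) := lintegral_mono hpt
    _ = 1 + (∫⁻ y, ENNReal.ofReal (ρ y ^ p)) + K0 := by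
        rw [lintegral_add_left' hρm, lintegral_add_right _ hind2,
          hone, lintegral_add_right_eq_self (fun y =>
            (Set.Ioo (-1 : ℝ) 1).indicator (fun y : ℝ => ‖y‖ₑ ^ (-(r * q))) y) a,
          lintegral_indicator measurableSet_Ioo, add_assoc]
    _ ≤ 1 + ENNReal.ofReal B + K0 := by gcongr
    _ = _ := by
        rw [add_right_comm, ENNReal.ofReal_add (by positivity) hB,
          ENNReal.ofReal_add zero_le_one ENNReal.toReal_nonneg, ENNReal.ofReal_toReal hK0.ne,
          ENNReal.ofReal_one]

/-- Let D be the modulus of the new value, so D = |s||u|X with X = |y + a|. Solving the step for p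
gives |p| ≤ D + (2+|z|)|u| for z = sy, hence Q^t is controlled by D^{2t} + (3+|z|)^{2t}|u|^{2t}.
Multiplying by D^{-2t} leaves (3+|z|)^{2t}X^{-2t} up to constants; separating these factors by ab ≤
a² + b² is what doubles the exponent of X to 4t. -/
lemma rpow_neg_shear_snd_le {c t s s₀ p u y : ℝ} (hd : 0 < 4 - c ^ 2) (ht0 : 0 < t)
    (ht : 4 * t ≤ 1) (hs₀ : 0 < s₀) (hs₀1 : s₀ ≤ 1) (hs : s₀ ≤ |s|) (hu : u ≠ 0)
    (hD : (c + s * y) * u - p ≠ 0) :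
    |(c + s * y) * u - p| ^ (-(2 * t)) ≤ qf c p u ^ (-t) *
      (2 + 2 / s₀ * (4 + (s * y) ^ 2) + 2 / s₀ * |y + (c - p / u) / s| ^ (-(4 * t))) := by
  have hq : 0 < qf c p u := qf_pos hd (fun h => hu (congrArg Prod.snd h))
  have hs0 : s ≠ 0 := by intro h; rw [h, abs_zero] at hs; linarith
  obtain ⟨D, hDd⟩ : ∃ D, D = |(c + s * y) * u - p| := ⟨_, rfl⟩
  have hD0 : 0 < D := by rw [hDd]; positivity
  obtain ⟨X, hX⟩ : ∃ X, X = |y + (c - p / u) / s| := ⟨_, rfl⟩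
  have hDX : D = |s| * X * |u| := by
    rw [hDd, hX, ← abs_mul, ← abs_mul]; congr 1; field_simp; ring
  have hu0 : 0 < |u| := by positivity
  have hX0 : 0 < X := by
    rcases (abs_nonneg (y + (c - p / u) / s)).eq_or_lt with h | h
    · rw [hX] at hDX; rw [← h] at hDX; simp at hDX; linarith
    · rw [hX]; exact h
  rw [← hDd, ← hX]
  obtain ⟨z, hz⟩ : ∃ z, z = s * y := ⟨_, rfl⟩
  rw [← hz] at hDd ⊢
  have hc2 : |c| ≤ 2 := abs_le_of_sq_le_sq (by nlinarith) (by norm_num)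
  have hp : |p| ≤ D + (2 + |z|) * |u| := by
    have : p = (c + z) * u - ((c + z) * u - p) := by ring
    calc |p| ≤ |(c + z) * u| + |(c + z) * u - p| := by
          conv_lhs => rw [this]
          exact abs_sub _ _
      _ ≤ (2 + |z|) * |u| + D := by
          rw [abs_mul, hDd]
          have := abs_add_le c z
          gcongr; linarith
      _ = _ := by ring
  have hqle : qf c p u ≤ (2 * (D + (3 + |z|) * |u|)) ^ 2 := by
    refine (qf_le p u hd).trans ?_
    have h1 : |p| + |u| ≤ D + (3 + |z|) * |u| := by linarith
    have h2 : (|p| + |u|) ^ 2 ≤ (D + (3 + |z|) * |u|) ^ 2 := by gcongr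
    have h3 : p ^ 2 + u ^ 2 ≤ (|p| + |u|) ^ 2 := by
      rw [← sq_abs p, ← sq_abs u]; nlinarith [abs_nonneg p]
    nlinarith
  have hz0 := abs_nonneg z
  have hqt : qf c p u ^ t ≤ 2 * (D ^ (2 * t) + (3 + |z|) ^ (2 * t) * |u| ^ (2 * t)) := by
    calc qf c p u ^ t ≤ ((2 * (D + (3 + |z|) * |u|)) ^ 2) ^ t := by gcongr
      _ = (2 * (D + (3 + |z|) * |u|)) ^ (2 * t) := by
          rw [Real.rpow_mul (by positivity)]; norm_num
      _ = 2 ^ (2 * t) * (D + (3 + |z|) * |u|) ^ (2 * t) := by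
          rw [Real.mul_rpow (by norm_num) (by positivity)]
      _ ≤ 2 ^ (1 : ℝ) * (D ^ (2 * t) + ((3 + |z|) * |u|) ^ (2 * t)) := by
          gcongr
          · norm_num
          · linarith
          · exact Real.rpow_add_le_add_rpow hD0.le (by positivity) (by linarith) (by linarith)
      _ = _ := by rw [Real.rpow_one, Real.mul_rpow (by positivity) (by positivity)]
  have hDr : D ^ (-(2 * t)) * D ^ (2 * t) = 1 := by
    rw [← Real.rpow_add hD0]; simp
  have hur : |u| ^ (2 * t) * D ^ (-(2 * t)) = |s| ^ (-(2 * t)) * X ^ (-(2 * t)) := by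
    rw [hDX, Real.mul_rpow (by positivity) hu0.le, Real.mul_rpow (abs_nonneg _) hX0.le,
      mul_comm (|u| ^ (2 * t)), mul_assoc, ← Real.rpow_add hu0]
    simp
  have hsr : |s| ^ (-(2 * t)) ≤ 1 / s₀ := by
    calc |s| ^ (-(2 * t)) ≤ s₀ ^ (-(2 * t)) :=
          Real.rpow_le_rpow_of_nonpos hs₀ hs (by linarith)
      _ ≤ s₀ ^ (-1 : ℝ) := Real.rpow_le_rpow_of_exponent_ge hs₀ hs₀1 (by linarith)
      _ = _ := by rw [Real.rpow_neg_one, one_div]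
  have hprod : (3 + |z|) ^ (2 * t) * X ^ (-(2 * t)) ≤ (4 + z ^ 2) + X ^ (-(4 * t)) := by
    have h1 : ((3 + |z|) ^ (2 * t)) ^ 2 ≤ 4 + z ^ 2 := by
      calc ((3 + |z|) ^ (2 * t)) ^ 2 = (3 + |z|) ^ (4 * t) := by
            rw [← Real.rpow_natCast, ← Real.rpow_mul (by positivity)]; congr 1; push_cast; ring
        _ ≤ (3 + |z|) ^ (1 : ℝ) := Real.rpow_le_rpow_of_exponent_le (by linarith) ht
        _ = 3 + |z| := Real.rpow_one _
        _ ≤ _ := by rw [← sq_abs z]; nlinarith [sq_nonneg (|z| - 1)]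
    have h2 : (X ^ (-(2 * t))) ^ 2 = X ^ (-(4 * t)) := by
      rw [← Real.rpow_natCast, ← Real.rpow_mul hX0.le]; congr 1; push_cast; ring
    rw [← h2]
    nlinarith [sq_nonneg ((3 + |z|) ^ (2 * t) - X ^ (-(2 * t))),
      sq_nonneg ((3 + |z|) ^ (2 * t)), sq_nonneg (X ^ (-(2 * t)))]
  rw [Real.rpow_neg hq.le, ← div_eq_inv_mul, le_div_iff₀ (by positivity)]
  calc D ^ (-(2 * t)) * qf c p u ^ t
      ≤ D ^ (-(2 * t)) * (2 * (D ^ (2 * t) + (3 + |z|) ^ (2 * t) * |u| ^ (2 * t))) := by gcongr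
    _ = 2 * (D ^ (-(2 * t)) * D ^ (2 * t))
        + 2 * (3 + |z|) ^ (2 * t) * (|u| ^ (2 * t) * D ^ (-(2 * t))) := by ring
    _ = 2 + 2 * |s| ^ (-(2 * t)) * ((3 + |z|) ^ (2 * t) * X ^ (-(2 * t))) := by
        rw [hDr, hur]; ring
    _ ≤ 2 + 2 * (1 / s₀) * ((4 + z ^ 2) + X ^ (-(4 * t))) := by gcongr
    _ = _ := by ring

lemma lintegral_shear_snd_le {c t s s₀ K β η p u : ℝ} (hd : 0 < 4 - c ^ 2) (ht0 : 0 < t)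
    (ht : 4 * t ≤ 1) (hs₀ : 0 < s₀) (hs₀1 : s₀ ≤ 1) (hs : s₀ ≤ |s|) (hs1 : |s| ≤ 1 / s₀)
    {ν : Measure ℝ} (hν : NoiseLaw ν β η) (hK0 : 0 ≤ K)
    (hK : ∀ a : ℝ, ∫⁻ y, ‖y + a‖ₑ ^ (-(4 * t)) ∂ν ≤ ENNReal.ofReal K) (hpu : (p, u) ≠ 0) :
    ∫⁻ y, ‖(c + s * y) * u - p‖ₑ ^ (-(2 * t)) ∂ν ≤
      ENNReal.ofReal ((2 + 2 / s₀ * (4 + β / s₀ ^ 2) + 2 / s₀ * K) * qf c p u ^ (-t)) := by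
  have hq : 0 < qf c p u := qf_pos hd hpu
  have hqt : 0 < qf c p u ^ (-t) := by positivity
  have := hν.prob
  have hs0 : s ≠ 0 := by intro h; rw [h, abs_zero] at hs; linarith
  have hβ : 0 ≤ β := by rw [← hν.var]; exact integral_nonneg fun z => sq_nonneg z
  have hpt : ∀ y, ‖(c + s * y) * u - p‖ₑ ^ (-(2 * t)) ≤
      ENNReal.ofReal (qf c p u ^ (-t)) * (ENNReal.ofReal (2 + 2 / s₀ * (4 + (s * y) ^ 2)) +
        ENNReal.ofReal (2 / s₀) * ‖y + (c - p / u) / s‖ₑ ^ (-(4 * t))) := by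
    intro y
    -- If u = 0 the new value is -p whatever the noise, and |p|^{-2t} = Q^{-t}. If the new value
    -- vanishes with u ≠ 0, both sides are infinite.
    by_cases hu : u = 0
    · subst hu
      have hp : p ≠ 0 := fun h => hpu (by rw [h]; rfl)
      have e : ‖(c + s * y) * 0 - p‖ₑ ^ (-(2 * t)) = ENNReal.ofReal (qf c p 0 ^ (-t)) := by
        rw [mul_zero, zero_sub, enorm_neg, Real.enorm_eq_ofReal_abs,
          ENNReal.ofReal_rpow_of_pos (by positivity)]
        congr 1
        have : qf c p 0 = |p| ^ (2 : ℝ) := by unfold qf; simp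
        rw [this, ← Real.rpow_mul (abs_nonneg _)]; congr 1; ring
      rw [e]
      apply le_mul_of_one_le_right zero_le
      refine le_add_right ?_
      rw [ENNReal.one_le_ofReal]
      have : 0 ≤ 2 / s₀ * (4 + (s * y) ^ 2) := by positivity
      linarith
    · have e : (c + s * y) * u - p = s * u * (y + (c - p / u) / s) := by field_simp; ring
      by_cases hD : (c + s * y) * u - p = 0
      · have hy : y + (c - p / u) / s = 0 := by
          rw [e] at hD
          exact (mul_eq_zero.1 hD).resolve_left (mul_ne_zero hs0 hu)
        rw [hy, enorm_zero, ENNReal.zero_rpow_of_neg (by linarith),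
          ENNReal.mul_top (by rw [ne_eq, ENNReal.ofReal_eq_zero, not_le]; positivity), add_top,
          ENNReal.mul_top (by rw [ne_eq, ENNReal.ofReal_eq_zero, not_le]; positivity)]
        exact le_top
      · have hy : y + (c - p / u) / s ≠ 0 := by
          intro h; rw [e, h, mul_zero] at hD; exact hD rfl
        rw [Real.enorm_eq_ofReal_abs, ENNReal.ofReal_rpow_of_pos (abs_pos.2 hD),
          Real.enorm_eq_ofReal_abs, ENNReal.ofReal_rpow_of_pos (abs_pos.2 hy),
          ← ENNReal.ofReal_mul (by positivity), ← ENNReal.ofReal_add (by positivity) (by positivity),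
          ← ENNReal.ofReal_mul hqt.le]
        exact ENNReal.ofReal_le_ofReal (rpow_neg_shear_snd_le hd ht0 ht hs₀ hs₀1 hs hu hD)
  have hint : Integrable (fun y : ℝ => 2 + 2 / s₀ * (4 + (s * y) ^ 2)) ν := by
    have : Integrable (fun y : ℝ => 2 + 2 / s₀ * (4 + s ^ 2 * y ^ 2)) ν :=
      (integrable_const _).add (((integrable_const _).add (hν.int2.const_mul _)).const_mul _)
    simpa [mul_pow] using this
  have hval : ∫ y, (2 + 2 / s₀ * (4 + (s * y) ^ 2)) ∂ν ≤ 2 + 2 / s₀ * (4 + β / s₀ ^ 2) := by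
    have e : ∀ y : ℝ, 2 + 2 / s₀ * (4 + (s * y) ^ 2) =
        (2 + 2 / s₀ * 4) + 0 * y + 2 / s₀ * s ^ 2 * y ^ 2 + 0 * |y| ^ 3 := by intro y; ring
    simp_rw [e]
    rw [hν.integral_cubic]
    have h2 : s ^ 2 ≤ 1 / s₀ ^ 2 := by
      rw [← sq_abs s]
      calc |s| ^ 2 ≤ (1 / s₀) ^ 2 := by gcongr
        _ = _ := by rw [div_pow, one_pow]
    have h3 : 2 / s₀ * s ^ 2 * β ≤ 2 / s₀ * (1 / s₀ ^ 2) * β := by gcongr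
    have h4 : 2 / s₀ * (1 / s₀ ^ 2) * β = 2 / s₀ * (β / s₀ ^ 2) := by ring
    linarith
  have hm1 : Measurable fun y : ℝ => ENNReal.ofReal (2 + 2 / s₀ * (4 + (s * y) ^ 2)) := by fun_prop
  have hm2 : Measurable fun y : ℝ => ‖y + (c - p / u) / s‖ₑ ^ (-(4 * t)) := by fun_prop
  calc _ ≤ _ := lintegral_mono hpt
    _ = ENNReal.ofReal (qf c p u ^ (-t)) *
        ((∫⁻ y, ENNReal.ofReal (2 + 2 / s₀ * (4 + (s * y) ^ 2)) ∂ν) +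
        ENNReal.ofReal (2 / s₀) * ∫⁻ y, ‖y + (c - p / u) / s‖ₑ ^ (-(4 * t)) ∂ν) := by
        rw [lintegral_const_mul' _ _ ENNReal.ofReal_ne_top, lintegral_add_left hm1,
          lintegral_const_mul _ hm2]
    _ ≤ ENNReal.ofReal (qf c p u ^ (-t)) *
        (ENNReal.ofReal (2 + 2 / s₀ * (4 + β / s₀ ^ 2)) +
        ENNReal.ofReal (2 / s₀) * ENNReal.ofReal K) := by
        gcongr
        · rw [← ofReal_integral_eq_lintegral_ofReal hint
            (Eventually.of_forall fun y => by positivity)]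
          exact ENNReal.ofReal_le_ofReal hval
        · exact hK _
    _ = _ := by
        rw [← ENNReal.ofReal_mul (by positivity), ← ENNReal.ofReal_add (by positivity)
          (by positivity), ← ENNReal.ofReal_mul hqt.le, mul_comm]


/-! ### The Dirac operator as a nearest-neighbour chain. -/

/-- The chain enumeration `(1,-), (1,+), (2,-), (2,+), …` of the sites. -/
def site (k : ℕ) : Site := (Nat.succPNat (k / 2), if Even k then Spin.minus else Spin.plus)

/-- Position of a site in the chain. -/
def idx (x : Site) : ℕ := 2 * x.1.natPred + if x.2 = Spin.plus then 1 else 0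

lemma site_even (j : ℕ) : site (2 * j) = (Nat.succPNat j, Spin.minus) := by
  simp [site]

lemma site_odd (j : ℕ) : site (2 * j + 1) = (Nat.succPNat j, Spin.plus) := by
  have : (2 * j + 1) / 2 = j := by omega
  simp [site, this]

lemma idx_site (k : ℕ) : idx (site k) = k := by
  rcases Nat.even_or_odd' k with ⟨j, rfl | rfl⟩
  · rw [site_even]; simp [idx]
  · rw [site_odd]; simp [idx]

lemma site_idx (x : Site) : site (idx x) = x := by
  obtain ⟨n, σ⟩ := x
  cases σ
  · have : idx (n, Spin.plus) = 2 * n.natPred + 1 := by simp [idx]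
    rw [this, site_odd, PNat.succPNat_natPred]
  · have : idx (n, Spin.minus) = 2 * n.natPred := by simp [idx]
    rw [this, site_even, PNat.succPNat_natPred]

lemma site_injective : Function.Injective site := fun a b h => by
  rw [← idx_site a, h, idx_site]

/-- `box` stops at (L,-), the chain position 2L-2, and `box'` at (L,+), the position 2L-1. Thus both
are initial segments, and each bound of the theorem has its source of the same spin as the last
site. -/
lemma mem_box_iff (L : ℕ+) (x : Site) : x ∈ box L ↔ idx x < 2 * (L : ℕ) - 1 := by
  obtain ⟨n, σ⟩ := x
  have hn := PNat.natPred_add_one n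
  have hL := L.pos
  have h1 : n ≤ L ↔ (n : ℕ) ≤ L := Iff.rfl
  have h2 : n < L ↔ (n : ℕ) < L := Iff.rfl
  cases σ <;> simp only [box, Finset.mem_filter, Finset.mem_product, Finset.mem_Icc,
    Finset.mem_univ, idx, one_le, true_and, and_true, h1, h2, reduceCtorEq, if_true,
    if_false, forall_const, false_imp_iff] <;> omega

lemma mem_box'_iff (L : ℕ+) (x : Site) : x ∈ box' L ↔ idx x < 2 * (L : ℕ) := by
  obtain ⟨n, σ⟩ := x
  have hn := PNat.natPred_add_one n
  have h1 : n ≤ L ↔ (n : ℕ) ≤ L := Iff.rfl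
  cases σ <;> simp only [box', Finset.mem_product, Finset.mem_Icc,
    Finset.mem_univ, idx, one_le, true_and, and_true, h1, reduceCtorEq, if_true,
    if_false] <;> omega

lemma succPNat_succ (j : ℕ) : Nat.succPNat (j + 1) = Nat.succPNat j + 1 := rfl

lemma dirac_even (m : ℝ) (v : Site → ℝ) (Φ : Site → ℂ) (j : ℕ) :
    dirac m v Φ (site (2 * j)) = Φ (site (2 * j + 1))
      - (if 2 * j = 0 then 0 else Φ (site (2 * j - 1)))
      + ((v (site (2 * j)) : ℂ) - m) * Φ (site (2 * j)) := by
  cases j with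
  | zero =>
    have h1 := site_even 0
    have h2 := site_odd 0
    simp only [mul_zero, zero_add] at h1 h2
    have h3 : Nat.succPNat 0 = 1 := rfl
    simp only [mul_zero, zero_add, h1, h2, dirac, dStar, h3, if_true]
    ring
  | succ j =>
    have e : 2 * (j + 1) - 1 = 2 * j + 1 := by omega
    have h3 : Nat.succPNat (j + 1) ≠ 1 := by
      intro h; have := congrArg PNat.val h; simp at this
    have h4 : Nat.succPNat (j + 1) - 1 = Nat.succPNat j := by
      rw [succPNat_succ]; exact PNat.add_sub
    rw [e, site_even, site_odd, site_odd]
    simp only [dirac, dStar, h3, if_false, h4]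
    rw [if_neg (by omega)]
    ring

lemma dirac_odd (m : ℝ) (v : Site → ℝ) (Φ : Site → ℂ) (j : ℕ) :
    dirac m v Φ (site (2 * j + 1)) = Φ (site (2 * j)) - Φ (site (2 * j + 2))
      + ((v (site (2 * j + 1)) : ℂ) + m) * Φ (site (2 * j + 1)) := by
  have e : 2 * j + 2 = 2 * (j + 1) := by ring
  rw [e, site_even, site_odd, site_even, succPNat_succ]
  simp only [dirac, d]
  ring

lemma dirac_add (m : ℝ) (v : Site → ℝ) (Φ Ψ : Site → ℂ) (x : Site) :
    dirac m v (Φ + Ψ) x = dirac m v Φ x + dirac m v Ψ x := by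
  obtain ⟨n, σ⟩ := x
  cases σ
  · simp only [dirac, d, Pi.add_apply]; ring
  · simp only [dirac, dStar, Pi.add_apply]; split_ifs <;> ring

lemma dirac_smul (m : ℝ) (v : Site → ℝ) (a : ℂ) (Φ : Site → ℂ) (x : Site) :
    dirac m v (a • Φ) x = a * dirac m v Φ x := by
  obtain ⟨n, σ⟩ := x
  cases σ
  · simp only [dirac, d, Pi.smul_apply, smul_eq_mul]; ring
  · simp only [dirac, dStar, Pi.smul_apply, smul_eq_mul]; split_ifs <;> ring

/-- Evaluation of the Dirac operator at a site, as a linear functional. -/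
def diracAt (m : ℝ) (v : Site → ℝ) (x : Site) : (Site → ℂ) →ₗ[ℂ] ℂ where
  toFun Φ := dirac m v Φ x
  map_add' Φ Ψ := dirac_add m v Φ Ψ x
  map_smul' a Φ := dirac_smul m v a Φ x

/-- Extension by zero. -/
noncomputable def extendZero (Λ : Finset Site) (f : Λ → ℂ) (x : Site) : ℂ :=
  if h : x ∈ Λ then f ⟨x, h⟩ else 0

lemma extendZero_eq_sum (Λ : Finset Site) (f : Λ → ℂ) :
    extendZero Λ f = ∑ y : Λ, f y • (Pi.single (y : Site) (1 : ℂ) : Site → ℂ) := by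
  ext x
  simp only [extendZero, Finset.sum_apply, Pi.smul_apply, smul_eq_mul, Pi.single_apply]
  split_ifs with h
  · rw [Finset.sum_eq_single ⟨x, h⟩]
    · simp
    · intro b _ hb
      rw [if_neg (fun hx => hb (Subtype.ext hx.symm)), mul_zero]
    · simp
  · symm
    apply Finset.sum_eq_zero
    intro y _
    rw [if_neg (fun hx : x = y => h (hx ▸ y.2)), mul_zero]

lemma boxDirac_mulVec (m : ℝ) (v : Site → ℝ) (Λ : Finset Site) (f : Λ → ℂ) (x : Λ) :
    (boxDirac m v Λ).mulVec f x = dirac m v (extendZero Λ f) x := by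
  rw [extendZero_eq_sum]
  change _ = diracAt m v x _
  rw [map_sum]
  simp only [map_smul, smul_eq_mul, Matrix.mulVec, dotProduct, boxDirac, Matrix.of_apply]
  exact Finset.sum_congr rfl fun y _ => mul_comm _ _

lemma boxDirac_sub_mulVec (m : ℝ) (v : Site → ℝ) (Λ : Finset Site) (E : ℝ) (f : Λ → ℂ) (x : Λ) :
    (boxDirac m v Λ - (E : ℂ) • (1 : Matrix Λ Λ ℂ)).mulVec f x =
      dirac m v (extendZero Λ f) x - E * extendZero Λ f x := by
  rw [Matrix.sub_mulVec, Pi.sub_apply, boxDirac_mulVec, Matrix.smul_mulVec, Matrix.one_mulVec]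
  simp [extendZero]

/-- Ratio between the solution of the Dirac equation and the normalized recursion. -/
noncomputable def kap (μ : ℝ) : ℕ → ℝ
  | 0 => 1
  | k + 1 => if Even k then kap μ k / μ else -μ * kap μ k

lemma abs_kap {μ : ℝ} (hμ : 0 < μ) (k : ℕ) : |kap μ k| = if Even k then 1 else 1 / μ := by
  induction k with
  | zero => simp [kap]
  | succ k ih =>
    by_cases h : Even k
    · have h' : ¬ Even (k + 1) := by simpa [Nat.even_add_one] using h
      rw [kap, if_pos h, if_neg h', abs_div, ih, if_pos h, abs_of_pos hμ]
    · have h' : Even (k + 1) := by simpa [Nat.even_add_one] using h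
      rw [kap, if_neg h, if_pos h', abs_mul, ih, if_neg h, abs_neg, abs_of_pos hμ]
      field_simp

/-- Noise multiplier. -/
noncomputable def noiseCoeff (μ : ℝ) (k : ℕ) : ℝ := if Even k then -μ else -(1 / μ)

/-- A solution of the Dirac equation on an initial segment of the chain is determined by its value
at the first site. -/
lemma eq_kap_mul_state {m E μ c : ℝ} (hμ : 0 < μ) (hc : c = (E + m) * μ) (hc' : c * μ = E - m)
    (v : Site → ℝ) (Φ : Site → ℂ) (N : ℕ)
    (h : ∀ i < N, dirac m v Φ (site i) = E * Φ (site i)) (i : ℕ) (hi : i ≤ N) :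
    Φ (site i) = ((kap μ i * (state c (fun k => noiseCoeff μ k * v (site k)) i).2 : ℝ) : ℂ)
      * Φ (site 0) ∧
    (if i = 0 then 0 else Φ (site (i - 1))) =
      (((if Even i then -(1 / μ) else μ) * kap μ i *
        (state c (fun k => noiseCoeff μ k * v (site k)) i).1 : ℝ) : ℂ) * Φ (site 0) := by
  -- The previous value is carried along as well. Its factor is kap μ (i-1) written through kap μ i:
  -- -1/μ times it for even i, μ times it for odd i.
  induction i with
  | zero => simp [kap, state]
  | succ i ih =>
    obtain ⟨ih1, ih2⟩ := ih (by omega)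
    have hrow := h i (by omega)
    have hμc : (μ : ℂ) ≠ 0 := by exact_mod_cast hμ.ne'
    have hcC : (c : ℂ) = (E + m) * μ := by exact_mod_cast congrArg (fun x : ℝ => (x : ℂ)) hc
    have hcC' : (c : ℂ) * μ = E - m := by exact_mod_cast congrArg (fun x : ℝ => (x : ℂ)) hc'
    set st := state c (fun k => noiseCoeff μ k * v (site k)) i with hst
    have hst1 : state c (fun k => noiseCoeff μ k * v (site k)) (i + 1) =
        (st.2, (c + noiseCoeff μ i * v (site i)) * st.2 - st.1) := rfl
    rw [hst1]
    simp only [Nat.add_sub_cancel, Nat.succ_ne_zero, if_false]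
    rcases Nat.even_or_odd' i with ⟨j, hj | hj⟩
    · have hev : Even i := ⟨j, by omega⟩
      have hev' : ¬ Even (i + 1) := by simpa [Nat.even_add_one] using hev
      rw [if_pos hev] at ih2
      rw [if_neg hev', kap, if_pos hev, noiseCoeff, if_pos hev]
      rw [hj, dirac_even, ← hj, ih2, ih1] at hrow
      constructor
      · have : Φ (site (i + 1)) = _ := eq_add_of_sub_eq (eq_sub_of_add_eq hrow)
        rw [this]
        push_cast
        rw [hcC]
        field_simp
        ring
      · rw [ih1]; push_cast; field_simp
    · have hev : ¬ Even i := by rw [Nat.not_even_iff_odd]; exact ⟨j, hj⟩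
      have hev' : Even (i + 1) := by simpa [Nat.even_add_one] using hev
      rw [if_neg hev] at ih2
      have hi0 : i ≠ 0 := by omega
      rw [if_neg hi0] at ih2
      rw [if_pos hev', kap, if_neg hev, noiseCoeff, if_neg hev]
      have e : i - 1 = 2 * j := by omega
      have e2 : i + 1 = 2 * j + 2 := by omega
      rw [e] at ih2
      rw [hj, dirac_odd, ← hj, ← e2, ih2, ih1] at hrow
      constructor
      · have h3 : Φ (site (i + 1)) = ((μ * kap μ i * st.1 : ℝ) : ℂ) * Φ (site 0)
            + ((v (site i) : ℂ) + m) * (((kap μ i * st.2 : ℝ) : ℂ) * Φ (site 0))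
            - E * (((kap μ i * st.2 : ℝ) : ℂ) * Φ (site 0)) := by
          linear_combination -hrow
        rw [h3]
        push_cast
        have h4 : (-(μ : ℂ) * (kap μ i) * ((c + -(1 / (μ : ℂ)) * v (site i)) * st.2 - st.1)) =
            (kap μ i) * (-(c * μ) * st.2 + v (site i) * st.2 + μ * st.1) := by
          field_simp; ring
        rw [h4, hcC']
        ring
      · rw [ih1]; push_cast; field_simp

/-! ### Algebra of the Green's function on initial segments. -/

section Green

variable {m E μ c : ℝ} {Λ : Finset Site} {N : ℕ}

lemma extendZero_green (v : Site → ℝ) (y : Λ) :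
    extendZero Λ (fun x => (boxDirac m v Λ - (E : ℂ) • (1 : Matrix Λ Λ ℂ))⁻¹ x y) =
      fun x => green m v Λ E x y := by
  ext x
  unfold extendZero green
  by_cases h : x ∈ Λ
  · simp [h, y.2]
  · simp [h]

/-- A kernel vector, extended by zero, solves the equation on the first N rows and vanishes at site
N. Its value there is a nonzero multiple of u_N times its value at site 0, so the latter vanishes
and with it the whole vector. -/
lemma hasResolvent_of_state_ne_zero (hμ : 0 < μ) (hc : c = (E + m) * μ) (hc' : c * μ = E - m)
    (hΛ : ∀ x, x ∈ Λ ↔ idx x < N) (v : Site → ℝ)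
    (hne : (state c (fun k => noiseCoeff μ k * v (site k)) N).2 ≠ 0) :
    HasResolvent m v Λ E := by
  unfold HasResolvent
  rw [← Matrix.mulVec_injective_iff_isUnit]
  refine (injective_iff_map_eq_zero
    (Matrix.mulVecLin (boxDirac m v Λ - (E : ℂ) • (1 : Matrix Λ Λ ℂ)))).2 ?_
  intro f hf
  have hrow : ∀ i < N, dirac m v (extendZero Λ f) (site i) = E * extendZero Λ f (site i) := by
    intro i hi
    have hm : site i ∈ Λ := by rw [hΛ, idx_site]; exact hi
    have := congrFun hf ⟨site i, hm⟩
    rw [Matrix.mulVecLin_apply, boxDirac_sub_mulVec] at this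
    exact sub_eq_zero.1 this
  have hsol := eq_kap_mul_state hμ hc hc' v _ N hrow
  have hout : extendZero Λ f (site N) = 0 := by
    unfold extendZero
    rw [dif_neg]
    rw [hΛ, idx_site]; omega
  have hk : kap μ N ≠ 0 := by
    have := abs_kap hμ N
    intro h0
    rw [h0, abs_zero] at this
    split_ifs at this
    · norm_num at this
    · have : 0 < 1 / μ := by positivity
      linarith
  have h0 : extendZero Λ f (site 0) = 0 := by
    have h1 := (hsol N le_rfl).1
    rw [hout] at h1
    refine (mul_eq_zero.1 h1.symm).resolve_left ?_
    exact_mod_cast mul_ne_zero hk hne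
  ext x
  have hx : idx (x : Site) < N := (hΛ x).1 x.2
  have h1 := (hsol _ hx.le).1
  rw [h0, mul_zero, site_idx] at h1
  unfold extendZero at h1
  rw [dif_pos x.2] at h1
  exact h1

/-- The column of the resolvent with source k solves the homogeneous equation on the rows before k,
so up to position k it is a multiple of the solution started at site 0. No right-hand solution is
needed: the diagonal entry G(k,k) absorbs it. -/
lemma green_mul_eq (hμ : 0 < μ) (hc : c = (E + m) * μ) (hc' : c * μ = E - m)
    (hΛ : ∀ x, x ∈ Λ ↔ idx x < N) (v : Site → ℝ) {j k : ℕ} (hjk : j ≤ k) (hk : k < N) :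
    green m v Λ E (site j) (site k) *
        ((kap μ k * (state c (fun k => noiseCoeff μ k * v (site k)) k).2 : ℝ) : ℂ) =
      ((kap μ j * (state c (fun k => noiseCoeff μ k * v (site k)) j).2 : ℝ) : ℂ) *
        green m v Λ E (site k) (site k) := by
  have hkm : site k ∈ Λ := by rw [hΛ, idx_site]; exact hk
  by_cases hu : IsUnit (boxDirac m v Λ - (E : ℂ) • (1 : Matrix Λ Λ ℂ))
  · have hrow : ∀ i < k, dirac m v (fun x => green m v Λ E x (site k)) (site i) =
        E * green m v Λ E (site i) (site k) := by
      intro i hi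
      have hm : site i ∈ Λ := by rw [hΛ, idx_site]; omega
      have h1 := boxDirac_sub_mulVec m v Λ E
        (fun x => (boxDirac m v Λ - (E : ℂ) • (1 : Matrix Λ Λ ℂ))⁻¹ x ⟨site k, hkm⟩) ⟨site i, hm⟩
      rw [extendZero_green v ⟨site k, hkm⟩] at h1
      have h2 : (boxDirac m v Λ - (E : ℂ) • (1 : Matrix Λ Λ ℂ)).mulVec
          (fun x => (boxDirac m v Λ - (E : ℂ) • (1 : Matrix Λ Λ ℂ))⁻¹ x ⟨site k, hkm⟩)
          ⟨site i, hm⟩ = 0 := by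
        change ((boxDirac m v Λ - (E : ℂ) • (1 : Matrix Λ Λ ℂ)) *
          (boxDirac m v Λ - (E : ℂ) • (1 : Matrix Λ Λ ℂ))⁻¹) ⟨site i, hm⟩ ⟨site k, hkm⟩ = 0
        rw [Matrix.mul_nonsing_inv _ ((Matrix.isUnit_iff_isUnit_det _).1 hu), Matrix.one_apply_ne]
        intro h
        have := site_injective (congrArg Subtype.val h)
        omega
      rw [h2] at h1
      exact sub_eq_zero.1 h1.symm
    have hsol := eq_kap_mul_state hμ hc hc' v _ k hrow
    rw [(hsol j hjk).1, (hsol k le_rfl).1]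
    ring
  -- The matrix inverse is 0 by convention when the matrix is singular, so the identity is trivial.
  · have h0 : (boxDirac m v Λ - (E : ℂ) • (1 : Matrix Λ Λ ℂ))⁻¹ = 0 :=
      Matrix.nonsing_inv_apply_not_isUnit _
        (fun h => hu ((Matrix.isUnit_iff_isUnit_det _).2 h))
    have hz : ∀ x y, green m v Λ E x y = 0 := by
      intro x y; unfold green; rw [h0]; simp
    simp [hz]

lemma ite_pred_eq (n k : ℕ+) :
    (if k = 1 then (0 : ℂ) else if k - 1 = n then 1 else 0) = if n + 1 = k then 1 else 0 := by
  by_cases hk : k = 1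
  · subst hk
    rw [if_pos rfl, if_neg]
    intro h
    have := congrArg PNat.val h
    have := n.pos
    simp at *
  · have h : k - 1 = n ↔ n + 1 = k := by
      constructor
      · intro h; rw [← h, add_comm]; exact PNat.add_sub_of_lt (lt_of_le_of_ne one_le (Ne.symm hk))
      · intro h; rw [← h]; exact PNat.add_sub
    rw [if_neg hk]
    simp only [h]

/-- The difference operators `d` and `dStar` have real entries and are transposes of each other. The
symmetry is without conjugation, which gives G(x,y) = G(y,x) in `green_symm`. -/
lemma boxDirac_symm (m : ℝ) (v : Site → ℝ) (Λ : Finset Site) :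
    (boxDirac m v Λ).transpose = boxDirac m v Λ := by
  ext ⟨⟨n, σ⟩, hx⟩ ⟨⟨k, τ⟩, hy⟩
  simp only [Matrix.transpose_apply, boxDirac, Matrix.of_apply]
  cases σ <;> cases τ <;>
    simp only [dirac, d, dStar, Pi.single_apply, Prod.mk.injEq, and_true, and_false, if_false,
      reduceCtorEq, mul_zero, sub_zero, add_zero, zero_add, ite_self, zero_sub, sub_self]
  · by_cases h : n = k
    · subst h; simp
    · simp [h, Ne.symm h]
  · rw [ite_pred_eq, ite_cond_congr (propext (eq_comm (a := k) (b := n)))]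
  · rw [ite_pred_eq, ite_cond_congr (propext (eq_comm (a := k) (b := n)))]
  · by_cases h : n = k
    · subst h; simp
    · simp [h, Ne.symm h]

lemma green_symm (v : Site → ℝ) (x y : Site) : green m v Λ E x y = green m v Λ E y x := by
  have hT : (boxDirac m v Λ - (E : ℂ) • (1 : Matrix Λ Λ ℂ)).transpose =
      boxDirac m v Λ - (E : ℂ) • (1 : Matrix Λ Λ ℂ) := by
    rw [Matrix.transpose_sub, boxDirac_symm, Matrix.transpose_smul, Matrix.transpose_one]
  unfold green
  by_cases h : x ∈ Λ ∧ y ∈ Λ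
  · rw [dif_pos h, dif_pos h.symm, ← Matrix.transpose_apply (_⁻¹), Matrix.transpose_nonsing_inv, hT]
  · rw [dif_neg h, dif_neg (fun h' => h h'.symm)]

lemma boxDirac_update (v : Site → ℝ) (x : Λ) (y y' : ℝ) :
    boxDirac m (Function.update v x y) Λ = boxDirac m (Function.update v x y') Λ
      + Matrix.single x x ((y : ℂ) - y') := by
  ext ⟨⟨n, σ⟩, hx⟩ ⟨⟨k, τ⟩, hy⟩
  obtain ⟨⟨l, ρ⟩, hl⟩ := x
  simp only [boxDirac, Matrix.of_apply, Matrix.add_apply, Matrix.single_apply, Subtype.mk.injEq,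
    Prod.mk.injEq]
  cases σ <;> cases τ <;> cases ρ <;>
    simp only [dirac, Function.update_apply, Pi.single_apply, Prod.mk.injEq, and_true, and_false,
      if_false, reduceCtorEq, mul_zero, add_zero, and_self]
  all_goals
    by_cases h1 : n = l <;> by_cases h2 : n = k
    · subst h1; subst h2; simp; try ring
    · subst h1; simp [h2]
    · subst h2; simp [h1, Ne.symm h1]
    · have : ¬ (l = n ∧ l = k) := fun h => h1 h.1.symm
      simp [h1, h2, this]

/-- As a function of the potential at `x`, the diagonal Green's function is `1/(v(x) + a)`. -/
lemma exists_enorm_green_update_le (v : Site → ℝ) {x : Site} (hx : x ∈ Λ) :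
    ∃ a : ℝ, ∀ y : ℝ, ‖green m (Function.update v x y) Λ E x x‖ₑ ≤ ‖y + a‖ₑ⁻¹ := by
  let M : ℝ → Matrix Λ Λ ℂ := fun y =>
    boxDirac m (Function.update v x y) Λ - (E : ℂ) • (1 : Matrix Λ Λ ℂ)
  have hg : ∀ y, green m (Function.update v x y) Λ E x x = (M y)⁻¹ ⟨x, hx⟩ ⟨x, hx⟩ := by
    intro y; unfold green; rw [dif_pos ⟨hx, hx⟩]
  have hsing : ∀ y, ¬ IsUnit (M y) → (M y)⁻¹ = 0 := fun y h =>
    Matrix.nonsing_inv_apply_not_isUnit _ fun h' => h ((Matrix.isUnit_iff_isUnit_det _).2 h')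
  by_cases hex : ∃ y', (M y')⁻¹ ⟨x, hx⟩ ⟨x, hx⟩ ≠ 0
  · obtain ⟨y', hy'⟩ := hex
    have hu' : IsUnit (M y') := by
      by_contra h; rw [hsing y' h] at hy'; exact hy' rfl
    set G' := (M y')⁻¹ ⟨x, hx⟩ ⟨x, hx⟩ with hG'
    -- The rank-one resolvent identity gives 1/G = y + (1/G' - y') exactly. Keeping only the real
    -- part of the constant can only enlarge the bound on |G|, so its reality need not be known.
    refine ⟨(1 / G' - y').re, fun y => ?_⟩
    rw [hg]
    by_cases hu : IsUnit (M y)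
    · set G := (M y)⁻¹ ⟨x, hx⟩ ⟨x, hx⟩ with hG
      have hres : (M y')⁻¹ = (M y)⁻¹ + (M y)⁻¹ * Matrix.single ⟨x, hx⟩ ⟨x, hx⟩ ((y : ℂ) - y')
          * (M y')⁻¹ := by
        have hM : M y = M y' + Matrix.single ⟨x, hx⟩ ⟨x, hx⟩ ((y : ℂ) - y') := by
          simp only [M]
          rw [boxDirac_update v ⟨x, hx⟩ y y']; abel
        have h1 : (M y)⁻¹ * M y = 1 :=
          Matrix.nonsing_inv_mul _ ((Matrix.isUnit_iff_isUnit_det _).1 hu)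
        have h2 : M y' * (M y')⁻¹ = 1 :=
          Matrix.mul_nonsing_inv _ ((Matrix.isUnit_iff_isUnit_det _).1 hu')
        have h3 : Matrix.single ⟨x, hx⟩ ⟨x, hx⟩ ((y : ℂ) - y') = M y - M y' := by
          rw [hM]; abel
        rw [h3, mul_sub, h1, sub_mul, one_mul, mul_assoc, h2, mul_one]; abel
      have hent : G' = G + G * ((y : ℂ) - y') * G' := by
        have := congrFun (congrFun hres ⟨x, hx⟩) ⟨x, hx⟩
        rw [Matrix.add_apply, Matrix.mul_apply] at this
        rw [Finset.sum_eq_single ⟨x, hx⟩] at this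
        · rwa [Matrix.mul_single_apply_same] at this
        · intro b _ hb
          rw [Matrix.mul_single_apply_of_ne _ _ _ _ _ hb, zero_mul]
        · simp
      have hone : G * (y + (1 / G' - y')) = 1 := by
        field_simp
        linear_combination -hent
      have hn : ‖G‖ₑ * ‖(y : ℂ) + (1 / G' - y')‖ₑ = 1 := by rw [← enorm_mul, hone, enorm_one]
      have hle : ‖y + (1 / G' - y').re‖ₑ ≤ ‖(y : ℂ) + (1 / G' - y')‖ₑ := by
        rw [Real.enorm_eq_ofReal_abs, ← ofReal_norm]
        apply ENNReal.ofReal_le_ofReal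
        have := Complex.abs_re_le_norm ((y : ℂ) + (1 / G' - y'))
        simpa using this
      rw [ENNReal.eq_inv_of_mul_eq_one_left hn]
      exact ENNReal.inv_le_inv.2 hle
    · rw [hsing y hu]; simp
  · push Not at hex
    exact ⟨0, fun y => by rw [hg, hex]; simp⟩

lemma measurable_green (x y : Site) : Measurable fun v : Site → ℝ => green m v Λ E x y := by
  unfold green
  by_cases h : x ∈ Λ ∧ y ∈ Λ
  · simp only [dif_pos h]
    have hM : Continuous fun v : Site → ℝ => boxDirac m v Λ - (E : ℂ) • (1 : Matrix Λ Λ ℂ) := by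
      refine Continuous.sub ?_ continuous_const
      refine continuous_matrix fun i j => ?_
      obtain ⟨⟨n, σ⟩, hi⟩ := i
      simp only [boxDirac, Matrix.of_apply]
      cases σ <;> simp only [dirac] <;> fun_prop
    simp_rw [Matrix.inv_def, Matrix.smul_apply, Ring.inverse_eq_inv', smul_eq_mul]
    exact (hM.matrix_det.measurable.inv).mul (hM.matrix_adjugate.matrix_elem _ _).measurable
  · simp only [dif_neg h]; exact measurable_const

end Green


/-! ### Fractional moments of the Green's function. -/

lemma dirac_congr_potential (m : ℝ) {v v' : Site → ℝ} (Φ : Site → ℂ) {x : Site} (h : v x = v' x) :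
    dirac m v Φ x = dirac m v' Φ x := by
  obtain ⟨n, σ⟩ := x
  cases σ <;> simp only [dirac, h]

lemma green_congr {m E : ℝ} {Λ : Finset Site} {v v' : Site → ℝ} (h : ∀ x ∈ Λ, v x = v' x)
    (x y : Site) : green m v Λ E x y = green m v' Λ E x y := by
  have : boxDirac m v Λ = boxDirac m v' Λ := by
    ext i j
    simp only [boxDirac, Matrix.of_apply]
    exact dirac_congr_potential m _ (h i i.2)
  unfold green
  rw [this]

lemma NoiseLaw.const_mul {Ω : Type*} [MeasurableSpace Ω] {P : Measure Ω} {Y : Ω → ℝ} (hY : Measurable Y) {τ η : ℝ}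
    (h : NoiseLaw (P.map Y) τ η) (s : ℝ) :
    NoiseLaw (P.map fun ω => s * Y ω) (s ^ 2 * τ) (|s| ^ 3 * η) := by
  have hm : Measurable fun y : ℝ => s * y := measurable_const_mul s
  have e : (P.map fun ω => s * Y ω) = (P.map Y).map fun y => s * y := by
    rw [Measure.map_map hm hY]; rfl
  have := h.prob
  have i1 := h.int1.const_mul s
  have i2 := h.int2.const_mul (s ^ 2)
  have i3 := h.int3.const_mul (|s| ^ 3)
  rw [e]
  have m1 : AEStronglyMeasurable (fun z : ℝ => z) ((P.map Y).map fun y => s * y) :=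
    measurable_id.aestronglyMeasurable
  have m2 : AEStronglyMeasurable (fun z : ℝ => z ^ 2) ((P.map Y).map fun y => s * y) :=
    (measurable_id.pow_const 2).aestronglyMeasurable
  have m3 : AEStronglyMeasurable (fun z : ℝ => |z| ^ 3) ((P.map Y).map fun y => s * y) :=
    (measurable_norm.pow_const 3).aestronglyMeasurable
  refine ⟨Measure.isProbabilityMeasure_map hm.aemeasurable, ?_, ?_, ?_, ?_, ?_, ?_⟩
  · rw [integrable_map_measure m1 hm.aemeasurable]; exact i1
  · rw [integrable_map_measure m2 hm.aemeasurable]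
    simpa [Function.comp_def, mul_pow] using i2
  · rw [integrable_map_measure m3 hm.aemeasurable]
    simpa [Function.comp_def, mul_pow, abs_mul] using i3
  · rw [integral_map hm.aemeasurable m1, integral_const_mul, h.mean, mul_zero]
  · rw [integral_map hm.aemeasurable m2]
    simp_rw [mul_pow]
    rw [integral_const_mul, h.var]
  · rw [integral_map hm.aemeasurable m3]
    simp_rw [abs_mul, mul_pow]
    rw [integral_const_mul]
    exact mul_le_mul_of_nonneg_left h.third (by positivity)

section Moments

variable {Ω : Type*} [MeasurableSpace Ω] {P : Measure Ω} [IsProbabilityMeasure P]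

lemma abs_noiseCoeff {μ s₀ : ℝ} (hμ : 0 < μ) (h1 : s₀ ≤ μ) (h2 : μ ≤ 1 / s₀) (hs₀ : 0 < s₀)
    (k : ℕ) : s₀ ≤ |noiseCoeff μ k| ∧ |noiseCoeff μ k| ≤ 1 / s₀ := by
  have h3 : s₀ ≤ 1 / μ := by
    rw [le_div_iff₀ hs₀] at h2; rw [le_div_iff₀ hμ]; linarith
  have h4 : 1 / μ ≤ 1 / s₀ := by gcongr
  unfold noiseCoeff
  split_ifs
  · rw [abs_neg, abs_of_pos hμ]; exact ⟨h1, h2⟩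
  · rw [abs_neg, abs_of_pos (by positivity)]; exact ⟨h3, h4⟩

lemma noiseCoeff_sq {μ : ℝ} (k : ℕ) : noiseCoeff μ k ^ 2 = alt (μ ^ 2) ((1 / μ) ^ 2) k := by
  unfold noiseCoeff alt
  split_ifs <;> ring

/-- The chain states driven by the potential `z`. -/
noncomputable def chainState (c μ : ℝ) (z : ℕ → ℝ) (k : ℕ) : ℝ × ℝ :=
  state c (fun i => noiseCoeff μ i * z i) k

lemma chainState_congr (c μ : ℝ) {z z' : ℕ → ℝ} (k : ℕ) (h : ∀ i < k, z i = z' i) :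
    chainState c μ z k = chainState c μ z' k :=
  state_congr c k fun i hi => by rw [h i hi]

lemma measurable_chainState (c μ : ℝ) (k : ℕ) : Measurable fun z : ℕ → ℝ => chainState c μ z k :=
  (measurable_state c k).comp (measurable_pi_lambda _ fun i => (measurable_pi_apply i).const_mul _)

/-- Given the earlier potentials, u_{k+1} is affine in `Y k`; averaging this single variable trades
|u_{k+1}|^{-2t} for Q_k^{-t}, to which `state_moment_decay` applies. -/
lemma lintegral_rpow_neg_chainState_le {Y : ℕ → Ω → ℝ} (hY : ∀ k, Measurable (Y k))
    (hind : iIndepFun Y P) {c μ t s₀ β η K : ℝ} (hd : 0 < 4 - c ^ 2) (ht0 : 0 < t)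
    (ht : 4 * t ≤ 1) (hμ : 0 < μ) (hs₀ : 0 < s₀) (hs₀1 : s₀ ≤ 1) (h1 : s₀ ≤ μ) (h2 : μ ≤ 1 / s₀)
    {j k : ℕ} (hjk : j ≤ k) (hν : NoiseLaw (P.map (Y k)) β η) (hK0 : 0 ≤ K)
    (hK : ∀ a : ℝ, ∫⁻ y, ‖y + a‖ₑ ^ (-(4 * t)) ∂(P.map (Y k)) ≤ ENNReal.ofReal K) :
    ∫⁻ ω, ‖(chainState c μ (fun i => Y i ω) j).2‖ₑ ^ (2 * t) *
        ‖(chainState c μ (fun i => Y i ω) (k + 1)).2‖ₑ ^ (-(2 * t)) ∂P ≤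
      ENNReal.ofReal (2 + 2 / s₀ * (4 + β / s₀ ^ 2) + 2 / s₀ * K) *
        ∫⁻ ω, ENNReal.ofReal (|(chainState c μ (fun i => Y i ω) j).2| ^ (2 * t)) *
          ENNReal.ofReal (qf c (chainState c μ (fun i => Y i ω) k).1
            (chainState c μ (fun i => Y i ω) k).2 ^ (-t)) ∂P := by
  let F : (ℕ → ℝ) → ℝ → ENNReal := fun z y => ‖(chainState c μ z j).2‖ₑ ^ (2 * t) *
    ‖(c + noiseCoeff μ k * y) * (chainState c μ z k).2 - (chainState c μ z k).1‖ₑ ^ (-(2 * t))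
  have hFm : Measurable (Function.uncurry F) := by
    have e1 : Measurable fun q : (ℕ → ℝ) × ℝ => chainState c μ q.1 k :=
      (measurable_chainState c μ k).comp measurable_fst
    have e2 : Measurable fun q : (ℕ → ℝ) × ℝ => chainState c μ q.1 j :=
      (measurable_chainState c μ j).comp measurable_fst
    exact (e2.snd.enorm.pow_const _).mul
      ((((((measurable_snd.const_mul _).const_add c).mul e1.snd).sub e1.fst)).enorm.pow_const _)
  have hloc : ∀ z z' y, (∀ i ∈ Finset.range k, z i = z' i) → F z y = F z' y := by
    intro z z' y hz
    simp only [Finset.mem_range] at hz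
    simp only [F, chainState_congr c μ k hz, chainState_congr c μ j fun i hi => hz i (by omega)]
  have hkey := lintegral_coord hY hind (Finset.range k) (k := k) (by simp) F hFm hloc
  have hβ : 0 ≤ β := by rw [← hν.var]; exact integral_nonneg fun z => sq_nonneg z
  have hL : 0 ≤ 2 + 2 / s₀ * (4 + β / s₀ ^ 2) + 2 / s₀ * K := by positivity
  obtain ⟨hs, hs1⟩ := abs_noiseCoeff hμ h1 h2 hs₀ k
  calc _ = ∫⁻ ω, F (fun i => Y i ω) (Y k ω) ∂P := rfl
    _ = _ := hkey
    _ ≤ ∫⁻ ω, ENNReal.ofReal (2 + 2 / s₀ * (4 + β / s₀ ^ 2) + 2 / s₀ * K) *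
        (ENNReal.ofReal (|(chainState c μ (fun i => Y i ω) j).2| ^ (2 * t)) *
          ENNReal.ofReal (qf c (chainState c μ (fun i => Y i ω) k).1
            (chainState c μ (fun i => Y i ω) k).2 ^ (-t))) ∂P := by
        apply lintegral_mono
        intro ω
        simp only [F]
        rw [lintegral_const_mul _ (by fun_prop), mul_left_comm, ← ENNReal.ofReal_mul hL]
        have e : ‖(chainState c μ (fun i => Y i ω) j).2‖ₑ ^ (2 * t) =
            ENNReal.ofReal (|(chainState c μ (fun i => Y i ω) j).2| ^ (2 * t)) := by
          rw [Real.enorm_eq_ofReal_abs, ENNReal.ofReal_rpow_of_nonneg (abs_nonneg _) (by linarith)]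
        rw [e]
        gcongr
        exact lintegral_shear_snd_le hd ht0 ht hs₀ hs₀1 hs hs1 hν hK0 hK (state_ne_zero c _ k)
    _ = _ := lintegral_const_mul' _ _ ENNReal.ofReal_ne_top

lemma kap_ratio_le {μ s₀ : ℝ} (hμ : 0 < μ) (h1 : s₀ ≤ μ) (h2 : μ ≤ 1 / s₀) (hs₀ : 0 < s₀)
    (hs₀1 : s₀ ≤ 1) (j k : ℕ) : |kap μ j| ≤ 1 / s₀ * |kap μ k| := by
  have h3 : 1 ≤ 1 / s₀ := by rw [le_div_iff₀ hs₀]; linarith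
  have h4 : 1 / μ ≤ 1 / s₀ := by gcongr
  have h5 : 0 < 1 / μ := by positivity
  rw [abs_kap hμ, abs_kap hμ]
  split_ifs
  · linarith
  · calc 1 = μ * (1 / μ) := by field_simp
      _ ≤ 1 / s₀ * (1 / μ) := by gcongr
  · linarith
  · exact le_mul_of_one_le_left h5.le h3

/-- Uses |G(j,k)| ≤ (1/s₀)|u_j||u_k|^{-1}|G(k,k)|. Only the last factor depends on `Y k`, and its
conditional 2t-moment is bounded by K whatever the other potentials are. -/
lemma lintegral_green_le {Y : ℕ → Ω → ℝ} (hY : ∀ k, Measurable (Y k)) (hind : iIndepFun Y P)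
    {m E c μ t s₀ K : ℝ} {Λ : Finset Site} {N : ℕ} (ht0 : 0 < t) (ht : 4 * t ≤ 1) (hμ : 0 < μ)
    (hs₀ : 0 < s₀) (hs₀1 : s₀ ≤ 1) (h1 : s₀ ≤ μ) (h2 : μ ≤ 1 / s₀)
    (hc : c = (E + m) * μ) (hc' : c * μ = E - m) (hΛ : ∀ x, x ∈ Λ ↔ idx x < N)
    {j k : ℕ} (hjk : j ≤ k) (hk : k < N)
    (hne : ∀ᵐ ω ∂P, (chainState c μ (fun i => Y i ω) k).2 ≠ 0)
    (hK : ∀ a : ℝ, ∫⁻ y, ‖y + a‖ₑ ^ (-(2 * t)) ∂(P.map (Y k)) ≤ ENNReal.ofReal K) :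
    ∫⁻ ω, ‖green m (fun x => Y (idx x) ω) Λ E (site j) (site k)‖ₑ ^ (2 * t) ∂P ≤
      ENNReal.ofReal (1 / s₀) * ENNReal.ofReal K *
        ∫⁻ ω, ‖(chainState c μ (fun i => Y i ω) j).2‖ₑ ^ (2 * t) *
          ‖(chainState c μ (fun i => Y i ω) k).2‖ₑ ^ (-(2 * t)) ∂P := by
  have hkΛ : site k ∈ Λ := by rw [hΛ, idx_site]; exact hk
  let v : (ℕ → ℝ) → Site → ℝ := fun z x => z (idx x)
  have hv : Measurable v := measurable_pi_lambda _ fun x => measurable_pi_apply _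
  let F : (ℕ → ℝ) → ℝ → ENNReal := fun z y =>
    (‖(chainState c μ z j).2‖ₑ ^ (2 * t) * ‖(chainState c μ z k).2‖ₑ ^ (-(2 * t))) *
    ‖green m (Function.update (v z) (site k) y) Λ E (site k) (site k)‖ₑ ^ (2 * t)
  have hgm : Measurable fun q : (ℕ → ℝ) × ℝ =>
      green m (Function.update (v q.1) (site k) q.2) Λ E (site k) (site k) := by
    refine (measurable_green (m := m) (E := E) (Λ := Λ) (site k) (site k)).comp ?_
    refine measurable_pi_lambda _ fun x => ?_
    by_cases hx : x = site k
    · subst hx; simpa using measurable_snd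
    · have hm : Measurable fun q : (ℕ → ℝ) × ℝ => v q.1 x :=
        (measurable_pi_apply (idx x)).comp measurable_fst
      simpa [Function.update_of_ne hx] using hm
  have hFm : Measurable (Function.uncurry F) := by
    have e1 : Measurable fun q : (ℕ → ℝ) × ℝ => chainState c μ q.1 k :=
      (measurable_chainState c μ k).comp measurable_fst
    have e2 : Measurable fun q : (ℕ → ℝ) × ℝ => chainState c μ q.1 j :=
      (measurable_chainState c μ j).comp measurable_fst
    exact ((e2.snd.enorm.pow_const _).mul (e1.snd.enorm.pow_const _)).mul (hgm.enorm.pow_const _)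
  -- Every potential of the box except the k-th is frozen: G(k,k), unlike u_j and u_k, also depends
  -- on the potentials beyond k.
  have hloc : ∀ z z' y, (∀ i ∈ (Finset.range N).erase k, z i = z' i) → F z y = F z' y := by
    intro z z' y hz
    have hz' : ∀ i < k, z i = z' i := fun i hi => hz i (by simp; omega)
    have hgr : green m (Function.update (v z) (site k) y) Λ E (site k) (site k) =
        green m (Function.update (v z') (site k) y) Λ E (site k) (site k) := by
      apply green_congr
      intro x hx
      by_cases hxk : x = site k
      · subst hxk; simp
      · rw [Function.update_of_ne hxk, Function.update_of_ne hxk]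
        refine hz _ ?_
        rw [Finset.mem_erase, Finset.mem_range]
        exact ⟨fun h => hxk (by rw [← h, site_idx]), (hΛ x).1 hx⟩
    simp only [F, chainState_congr c μ k hz', chainState_congr c μ j fun i hi => hz' i (by omega),
      hgr]
  have hkey := lintegral_coord hY hind ((Finset.range N).erase k) (k := k) (by simp) F hFm hloc
  have hupd : ∀ ω, Function.update (v fun i => Y i ω) (site k) (Y k ω) = fun x => Y (idx x) ω := by
    intro ω
    ext x
    by_cases hx : x = site k
    · subst hx; simp [idx_site]
    · rw [Function.update_of_ne hx]
  have hr0 : 0 ≤ 2 * t := by linarith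
  have hpt : ∀ᵐ ω ∂P, ‖green m (fun x => Y (idx x) ω) Λ E (site j) (site k)‖ₑ ^ (2 * t) ≤
      ENNReal.ofReal (1 / s₀) * F (fun i => Y i ω) (Y k ω) := by
    filter_upwards [hne] with ω hω
    simp only [F, hupd]
    have heq := green_mul_eq hμ hc hc' hΛ (fun x => Y (idx x) ω) hjk hk
    simp only [idx_site] at heq
    change _ * ((kap μ k * (chainState c μ (fun i => Y i ω) k).2 : ℝ) : ℂ) =
      ((kap μ j * (chainState c μ (fun i => Y i ω) j).2 : ℝ) : ℂ) * _ at heq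
    set uk := (chainState c μ (fun i => Y i ω) k).2
    set uj := (chainState c μ (fun i => Y i ω) j).2
    set G := green m (fun x => Y (idx x) ω) Λ E (site j) (site k)
    set G' := green m (fun x => Y (idx x) ω) Λ E (site k) (site k)
    have hratio := kap_ratio_le hμ h1 h2 hs₀ hs₀1 j k
    have hkpos : 0 < |kap μ k| := by
      rw [abs_kap hμ]; split_ifs <;> positivity
    have huk : 0 < |uk| := abs_pos.2 hω
    have hnorm : ‖G‖ * (|kap μ k| * |uk|) = |kap μ j| * |uj| * ‖G'‖ := by
      have := congrArg norm heq
      simpa only [norm_mul, Complex.norm_real, Real.norm_eq_abs, abs_mul] using this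
    have hGle : ‖G‖ ≤ 1 / s₀ * (|uj| * |uk|⁻¹ * ‖G'‖) := by
      have h3 : ‖G‖ * (|kap μ k| * |uk|) ≤
          (1 / s₀ * (|uj| * |uk|⁻¹ * ‖G'‖)) * (|kap μ k| * |uk|) := by
        rw [hnorm]
        calc |kap μ j| * |uj| * ‖G'‖ ≤ (1 / s₀ * |kap μ k|) * |uj| * ‖G'‖ := by gcongr
          _ = _ := by field_simp
      exact le_of_mul_le_mul_right h3 (by positivity)
    have hGr : ‖G‖ ^ (2 * t) ≤ 1 / s₀ * (|uj| ^ (2 * t) * |uk| ^ (-(2 * t)) * ‖G'‖ ^ (2 * t)) := by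
      calc ‖G‖ ^ (2 * t) ≤ (1 / s₀ * (|uj| * |uk|⁻¹ * ‖G'‖)) ^ (2 * t) := by gcongr
        _ = (1 / s₀) ^ (2 * t) * (|uj| ^ (2 * t) * |uk| ^ (-(2 * t)) * ‖G'‖ ^ (2 * t)) := by
            rw [Real.mul_rpow (by positivity) (by positivity),
              Real.mul_rpow (by positivity) (by positivity),
              Real.mul_rpow (by positivity) (by positivity), Real.inv_rpow huk.le,
              Real.rpow_neg huk.le]
        _ ≤ (1 / s₀) ^ (1 : ℝ) * (|uj| ^ (2 * t) * |uk| ^ (-(2 * t)) * ‖G'‖ ^ (2 * t)) := by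
            gcongr
            · rw [le_div_iff₀ hs₀]; linarith
            · linarith
        _ = _ := by rw [Real.rpow_one]
    have e1 : ‖uj‖ₑ ^ (2 * t) = ENNReal.ofReal (|uj| ^ (2 * t)) := by
      rw [Real.enorm_eq_ofReal_abs, ENNReal.ofReal_rpow_of_nonneg (abs_nonneg _) hr0]
    have e2 : ‖uk‖ₑ ^ (-(2 * t)) = ENNReal.ofReal (|uk| ^ (-(2 * t))) := by
      rw [Real.enorm_eq_ofReal_abs, ENNReal.ofReal_rpow_of_pos huk]
    have e3 : ∀ g : ℂ, ‖g‖ₑ ^ (2 * t) = ENNReal.ofReal (‖g‖ ^ (2 * t)) := by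
      intro g
      rw [← ofReal_norm, ENNReal.ofReal_rpow_of_nonneg (norm_nonneg _) hr0]
    rw [e1, e2, e3, e3, ← ENNReal.ofReal_mul (by positivity), ← ENNReal.ofReal_mul (by positivity),
      ← ENNReal.ofReal_mul (by positivity)]
    exact ENNReal.ofReal_le_ofReal hGr
  calc _ ≤ ∫⁻ ω, ENNReal.ofReal (1 / s₀) * F (fun i => Y i ω) (Y k ω) ∂P := lintegral_mono_ae hpt
    _ = ENNReal.ofReal (1 / s₀) * ∫⁻ ω, F (fun i => Y i ω) (Y k ω) ∂P :=
        lintegral_const_mul' _ _ ENNReal.ofReal_ne_top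
    _ ≤ ENNReal.ofReal (1 / s₀) * ∫⁻ ω, ENNReal.ofReal K *
        (‖(chainState c μ (fun i => Y i ω) j).2‖ₑ ^ (2 * t) *
          ‖(chainState c μ (fun i => Y i ω) k).2‖ₑ ^ (-(2 * t))) ∂P := by
        rw [hkey]
        gcongr with ω
        simp only [F]
        have hgy : Measurable fun y : ℝ =>
            ‖green m (Function.update (v fun i => Y i ω) (site k) y) Λ E (site k) (site k)‖ₑ
              ^ (2 * t) :=
          (hgm.comp (measurable_prodMk_left (x := fun i => Y i ω))).enorm.pow_const _
        rw [lintegral_const_mul _ hgy, mul_comm]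
        gcongr
        obtain ⟨a, ha⟩ := exists_enorm_green_update_le (m := m) (E := E)
          (v fun i => Y i ω) hkΛ
        refine le_trans (lintegral_mono fun y => ?_) (hK a)
        beta_reduce
        rw [ENNReal.rpow_neg, ← ENNReal.inv_rpow]
        gcongr
        exact ha y
    _ = _ := by rw [lintegral_const_mul' _ _ ENNReal.ofReal_ne_top, mul_assoc]

end Moments


lemma NoiseLaw.mono {ν : Measure ℝ} {τ η η' : ℝ} (h : NoiseLaw ν τ η) (hη : η ≤ η') :
    NoiseLaw ν τ η' :=
  ⟨h.prob, h.int1, h.int2, h.int3, h.mean, h.var, h.third.trans hη⟩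

/-- Relations between the energy and the parameters of the normalized recursion. -/
structure Band (m δ s₀ E c μ : ℝ) : Prop where
  μ0 : 0 < μ
  hμ : s₀ ≤ μ
  hμ' : μ ≤ 1 / s₀
  hc : c = (E + m) * μ
  hc' : c * μ = E - m
  c0 : δ ≤ |c|
  cd : δ ≤ 4 - c ^ 2

/-- Two potentials are spent on regularity, the k-th for G(k,k) and the (k-1)-th for |u_k|^{-2t};
they produce the two density factors. Those before k-1 produce the exponential. -/
lemma green_moment_decay {Ω : Type*} [MeasurableSpace Ω] {P : Measure Ω} [IsProbabilityMeasure P]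
    {m δ s₀ t : ℝ} (hδ : 0 < δ) (hδ1 : δ ≤ 1) (hs₀ : 0 < s₀) (hs₀1 : s₀ ≤ 1) (ht0 : 0 < t)
    (ht4 : 4 * t ≤ 1) (ht : t ≤ s₀ ^ 2 * δ ^ 3 / (2048 * (1 / s₀) ^ 2))
    {Y : ℕ → Ω → ℝ} (hY : ∀ k, Measurable (Y k)) (hind : iIndepFun Y P) {β τ B : ℕ → ℝ}
    (hβ0 : ∀ k, 0 < β k) (hβ : ∀ ε > 0, ∀ᶠ k in atTop, β k ≤ ε)
    (hββ : ∀ ε > 0, ∀ᶠ k in atTop, |β (k + 1) - β k| ≤ ε * β k)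
    (hτ : ∀ ε > 0, ∀ᶠ k in atTop, τ k ≤ ε * β k)
    (hlaw : ∀ k, NoiseLaw (P.map (Y k)) (β k) (τ k)) (hB : ∀ k, 1 ≤ B k)
    (hB2 : ∀ k (a : ℝ), ∫⁻ y, ‖y + a‖ₑ ^ (-(2 * t)) ∂(P.map (Y k)) ≤ ENNReal.ofReal (B k))
    (hB4 : ∀ k (a : ℝ), ∫⁻ y, ‖y + a‖ₑ ^ (-(4 * t)) ∂(P.map (Y k)) ≤ ENNReal.ofReal (B k)) :
    ∃ κ > 0, ∀ j : ℕ, ∃ C > 0, ∀ E c μ : ℝ, Band m δ s₀ E c μ →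
      (∀ k, ∀ᵐ ω ∂P, (chainState c μ (fun i => Y i ω) k).2 ≠ 0) ∧
      ∀ (Λ : Finset Site) (N : ℕ), (∀ x, x ∈ Λ ↔ idx x < N) → ∀ k, j ≤ k → k < N →
      ∫⁻ ω, ‖green m (fun x => Y (idx x) ω) Λ E (site j) (site k)‖ₑ ^ (2 * t) ∂P ≤
        ENNReal.ofReal (C * (B k * (1 + β (k - 1) + B (k - 1)) *
          Real.exp (-κ * ∑ i ∈ Finset.range (k - 1), β i))) := by
  have ht1 : t ≤ 1 := by linarith
  have hη : ∀ ε > 0, ∀ᶠ k in atTop, (1 / s₀) ^ 3 * τ k ≤ ε * β k := by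
    intro ε hε
    filter_upwards [hτ (ε * s₀ ^ 3) (by positivity)] with k hk
    calc (1 / s₀) ^ 3 * τ k ≤ (1 / s₀) ^ 3 * (ε * s₀ ^ 3 * β k) := by gcongr
      _ = _ := by field_simp
  obtain ⟨κ, hκ, hdec⟩ := state_moment_decay (Ω := Ω) (P := P) hδ hδ1
    (θ₀ := s₀ ^ 2) (Θ := (1 / s₀) ^ 2) (by positivity)
    (by positivity) ht0 ht1 ht hβ0 hβ hββ hη
  have happ : ∀ E c μ : ℝ, Band m δ s₀ E c μ →
      Params δ ((1 / s₀) ^ 2) c t (s₀ ^ 2) (μ ^ 2) ((1 / μ) ^ 2) ∧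
      (∀ k, Measurable fun ω => noiseCoeff μ k * Y k ω) ∧
      iIndepFun (fun k ω => noiseCoeff μ k * Y k ω) P ∧
      ∀ k, NoiseLaw (P.map fun ω => noiseCoeff μ k * Y k ω)
        (alt (μ ^ 2) ((1 / μ) ^ 2) k * β k) ((1 / s₀) ^ 3 * τ k) := by
    intro E c μ h
    have hμ0 := h.μ0
    have hμi : s₀ ≤ 1 / μ := by
      have := h.hμ'
      rw [le_div_iff₀ hs₀] at this; rw [le_div_iff₀ hμ0]; linarith
    have hμi' : 1 / μ ≤ 1 / s₀ := by have := h.hμ; gcongr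
    refine ⟨⟨hδ, hδ1, h.c0, h.cd, ht0, ht1, by positivity, ?_, ?_, ?_, ?_⟩,
      fun k => (hY k).const_mul _, ?_, fun k => ?_⟩
    · have := h.hμ; gcongr
    · gcongr
    · have := h.hμ'; gcongr
    · gcongr
    · exact hind.comp (fun k y => noiseCoeff μ k * y) fun k => measurable_const_mul _
    · rw [← noiseCoeff_sq]
      have h3 := ((hlaw k).const_mul (hY k) (noiseCoeff μ k))
      refine h3.mono ?_
      have hs := (abs_noiseCoeff hμ0 h.hμ h.hμ' hs₀ k).2
      have hτ0 : 0 ≤ τ k := le_trans (integral_nonneg fun z => by positivity) (hlaw k).third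
      gcongr
  have hL : ∀ k, 2 + 2 / s₀ * (4 + β k / s₀ ^ 2) + 2 / s₀ * B k ≤
      10 / s₀ ^ 3 * (1 + β k + B k) := by
    intro k
    have h1 : 1 ≤ 1 / s₀ := by rw [le_div_iff₀ hs₀]; linarith
    obtain ⟨x, hx⟩ : ∃ x, x = 1 / s₀ := ⟨_, rfl⟩
    rw [← hx] at h1
    have hx3 : x ≤ x ^ 3 := le_self_pow₀ h1 (by norm_num)
    have e1 : 2 / s₀ * (4 + β k / s₀ ^ 2) = 8 * x + 2 * x ^ 3 * β k := by rw [hx]; field_simp; ring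
    have e2 : 2 / s₀ * B k = 2 * x * B k := by rw [hx]; field_simp
    have e3 : 10 / s₀ ^ 3 = 10 * x ^ 3 := by rw [hx]; field_simp
    rw [e1, e2, e3]
    have hBk := hB k
    have hβk := hβ0 k
    have h3 : x * B k ≤ x ^ 3 * B k := by gcongr
    have h4 : 0 ≤ x ^ 3 * β k := by positivity
    have h5 : 0 ≤ x ^ 3 * B k := by positivity
    nlinarith
  have hneg : ∀ j : ℕ, ∃ C > 0, ∀ E c μ : ℝ, Band m δ s₀ E c μ → ∀ k ≥ j,
      ∫⁻ ω, ‖(chainState c μ (fun i => Y i ω) j).2‖ₑ ^ (2 * t) *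
        ‖(chainState c μ (fun i => Y i ω) (k + 1)).2‖ₑ ^ (-(2 * t)) ∂P ≤
      ENNReal.ofReal (C * ((1 + β k + B k) * Real.exp (-κ * ∑ i ∈ Finset.range k, β i))) := by
    intro j
    obtain ⟨C, hC, hdecj⟩ := hdec j
    refine ⟨10 / s₀ ^ 3 * C, by positivity, ?_⟩
    intro E c μ h k hk
    obtain ⟨hpar, hm, hi, hl⟩ := happ E c μ h
    have hBk := hB k
    have hβk := hβ0 k
    have h1 := lintegral_rpow_neg_chainState_le hY hind (hδ.trans_le h.cd) ht0 ht4 h.μ0 hs₀ hs₀1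
      h.hμ h.hμ' hk (hlaw k) (by linarith) (hB4 k)
    have h2 := hdecj c _ _ hpar _ hm hi hl k hk
    refine h1.trans ((mul_le_mul_right h2 _).trans ?_)
    rw [← ENNReal.ofReal_mul (by positivity)]
    apply ENNReal.ofReal_le_ofReal
    calc _ ≤ (10 / s₀ ^ 3 * (1 + β k + B k)) *
          (C * Real.exp (-κ * ∑ i ∈ Finset.range k, β i)) := by
          gcongr; exact hL k
      _ = _ := by ring
  refine ⟨κ, hκ, fun j => ?_⟩
  obtain ⟨C₀, hC₀, hneg0⟩ := hneg 0
  obtain ⟨C, hC, hnegj⟩ := hneg j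
  -- Compensates the exponential when k = j: the expectation is then at most 1, and there is no step
  -- left to average.
  set D := Real.exp (κ * ∑ i ∈ Finset.range (j - 1), β i) with hD
  have hD0 : 0 < D := Real.exp_pos _
  refine ⟨1 / s₀ * (C + D), by positivity, ?_⟩
  intro E c μ h
  -- Since u_0 = 1, the estimate with j = 0 bounds the mean of |u_{k+1}|^{-2t}, and a finite mean
  -- excludes u_{k+1} = 0 almost surely because 0^{-2t} is infinite.
  have hne : ∀ k, ∀ᵐ ω ∂P, (chainState c μ (fun i => Y i ω) k).2 ≠ 0 := by
    intro k
    cases k with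
    | zero => exact Eventually.of_forall fun ω => by simp [chainState, state]
    | succ k =>
      have h1 := hneg0 E c μ h k (Nat.zero_le _)
      have e : ∀ ω, ‖(chainState c μ (fun i => Y i ω) 0).2‖ₑ ^ (2 * t) = 1 := by
        intro ω; simp [chainState, state]
      simp_rw [e, one_mul] at h1
      have hm : Measurable fun ω => ‖(chainState c μ (fun i => Y i ω) (k + 1)).2‖ₑ ^ (-(2 * t)) :=
        (((measurable_chainState c μ (k + 1)).comp
          (measurable_pi_lambda _ hY)).snd.enorm.pow_const _)
      filter_upwards [ae_lt_top hm (ne_top_of_le_ne_top ENNReal.ofReal_ne_top h1)] with ω hω h0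
      rw [h0, enorm_zero, ENNReal.zero_rpow_of_neg (by linarith)] at hω
      exact lt_irrefl _ hω
  refine ⟨hne, ?_⟩
  intro Λ N hΛ k hjk hk
  have hBk := hB k
  have hBk' := hB (k - 1)
  have hβk' := hβ0 (k - 1)
  refine (lintegral_green_le hY hind ht0 ht4 h.μ0 hs₀ hs₀1 h.hμ h.hμ' h.hc h.hc' hΛ hjk hk (hne k)
    (hB2 k)).trans ?_
  have hmain : ∫⁻ ω, ‖(chainState c μ (fun i => Y i ω) j).2‖ₑ ^ (2 * t) *
        ‖(chainState c μ (fun i => Y i ω) k).2‖ₑ ^ (-(2 * t)) ∂P ≤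
      ENNReal.ofReal ((C + D) * ((1 + β (k - 1) + B (k - 1)) *
        Real.exp (-κ * ∑ i ∈ Finset.range (k - 1), β i))) := by
    rcases hjk.eq_or_lt with hjk' | hjk'
    · subst hjk'
      calc _ ≤ ∫⁻ _, 1 ∂P := by
            apply lintegral_mono
            intro ω
            beta_reduce
            rw [ENNReal.rpow_neg]
            exact ENNReal.mul_inv_le_one _
        _ = ENNReal.ofReal 1 := by simp
        _ ≤ _ := by
            apply ENNReal.ofReal_le_ofReal
            calc (1 : ℝ) = D * (1 * Real.exp (-κ * ∑ i ∈ Finset.range (j - 1), β i)) := by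
                  rw [hD, one_mul, ← Real.exp_add]; simp
              _ ≤ _ := by
                  gcongr
                  · linarith
                  · linarith
    · obtain ⟨k, rfl⟩ : ∃ k', k = k' + 1 := ⟨k - 1, by omega⟩
      refine (hnegj E c μ h k (by omega)).trans (ENNReal.ofReal_le_ofReal ?_)
      simp only [Nat.add_sub_cancel] at hβk' hBk' ⊢
      gcongr
      linarith
  refine (mul_le_mul_right hmain _).trans ?_
  rw [← ENNReal.ofReal_mul (by positivity), ← ENNReal.ofReal_mul (by positivity)]
  apply ENNReal.ofReal_le_ofReal
  apply le_of_eq; ring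


/-! ### Uniformity in the energy and asymptotics of the variances. -/

/-- On the compact interval E²-m² stays away from 0 and 4, whichever band it lies in. The parameters
are μ² = (E-m)/(E+m) and c = (E+m)μ, so c² = E²-m². -/
lemma exists_band {m E₁ E₂ : ℝ} (hm : 0 ≤ m) (hI : Set.Icc E₁ E₂ ⊆ openBands m) :
    ∃ δ > 0, δ ≤ 1 ∧ ∃ s₀ > 0, s₀ ≤ 1 ∧ ∀ E ∈ Set.Icc E₁ E₂, ∃ c μ, Band m δ s₀ E c μ := by
  have hpos : ∀ E ∈ Set.Icc E₁ E₂, 0 < min (E ^ 2 - m ^ 2) (4 - (E ^ 2 - m ^ 2)) := by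
    intro E hE
    have hs : √(m ^ 2 + 4) ^ 2 = m ^ 2 + 4 := Real.sq_sqrt (by positivity)
    have hs0 := Real.sqrt_nonneg (m ^ 2 + 4)
    rw [lt_min_iff]
    rcases hI hE with h | h
    · constructor <;> nlinarith [h.1, h.2]
    · constructor <;> nlinarith [h.1, h.2]
  obtain ⟨δ, hδ, hδE⟩ : ∃ δ > 0, ∀ E ∈ Set.Icc E₁ E₂,
      δ ≤ min (E ^ 2 - m ^ 2) (4 - (E ^ 2 - m ^ 2)) := by
    rcases (Set.Icc E₁ E₂).eq_empty_or_nonempty with he | hne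
    · exact ⟨1, one_pos, by simp [he]⟩
    · obtain ⟨E₀, hE₀, hmin⟩ := isCompact_Icc.exists_isMinOn hne
        (f := fun E : ℝ => min (E ^ 2 - m ^ 2) (4 - (E ^ 2 - m ^ 2))) (by fun_prop)
      exact ⟨_, hpos E₀ hE₀, fun E hE => hmin hE⟩
  have hδ1 : 0 < min δ 1 := by positivity
  set δ' := min δ 1 with hδ'
  have hR : 0 < 4 * (m ^ 2 + 4) := by positivity
  -- Since (E±m)² ≤ 4(m²+4) and E²-m² ≥ δ', both μ² and 1/μ² are at least δ'/(4(m²+4)), which is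
  -- s₀².
  refine ⟨δ', hδ1, min_le_right _ _, √(δ' / (4 * (m ^ 2 + 4))), by positivity, ?_, ?_⟩
  · refine Real.sqrt_le_iff.2 ⟨zero_le_one, ?_⟩
    rw [one_pow, div_le_one hR]
    have : δ' ≤ 1 := min_le_right _ _
    nlinarith [sq_nonneg m]
  intro E hE
  have h1 : δ' ≤ E ^ 2 - m ^ 2 := (min_le_left _ _).trans ((hδE E hE).trans (min_le_left _ _))
  have h2 : δ' ≤ 4 - (E ^ 2 - m ^ 2) := (min_le_left _ _).trans ((hδE E hE).trans (min_le_right _ _))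
  have hδ'1 : δ' ≤ 1 := min_le_right _ _
  have hprod : 0 < (E + m) * (E - m) := by nlinarith
  have hp : E + m ≠ 0 := by intro h; rw [h] at hprod; simp at hprod
  have hq : E - m ≠ 0 := by intro h; rw [h] at hprod; simp at hprod
  have hr : 0 < (E - m) / (E + m) := by
    have : (E - m) / (E + m) = ((E + m) * (E - m)) / (E + m) ^ 2 := by field_simp
    rw [this]; positivity
  have hμ2 : √((E - m) / (E + m)) ^ 2 = (E - m) / (E + m) := Real.sq_sqrt hr.le
  have hpb : (E + m) ^ 2 ≤ 4 * (m ^ 2 + 4) := by nlinarith [sq_nonneg (E - m)]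
  have hqb : (E - m) ^ 2 ≤ 4 * (m ^ 2 + 4) := by nlinarith [sq_nonneg (E + m)]
  have hμ0 : 0 < √((E - m) / (E + m)) := by positivity
  have hc2 : ((E + m) * √((E - m) / (E + m))) ^ 2 = E ^ 2 - m ^ 2 := by
    rw [mul_pow, hμ2]; field_simp; ring
  refine ⟨(E + m) * √((E - m) / (E + m)), √((E - m) / (E + m)), hμ0, ?_, ?_, rfl, ?_, ?_, ?_⟩
  · apply Real.sqrt_le_sqrt
    rw [div_le_iff₀ hR]
    have e : (E - m) / (E + m) = (E ^ 2 - m ^ 2) / (E + m) ^ 2 := by field_simp; ring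
    rw [e, div_mul_eq_mul_div, le_div_iff₀ (by positivity)]
    exact mul_le_mul h1 hpb (by positivity) (by linarith)
  · rw [← Real.sqrt_one, ← Real.sqrt_div' _ (by positivity), one_div_div]
    apply Real.sqrt_le_sqrt
    have e : (E - m) / (E + m) = (E - m) ^ 2 / (E ^ 2 - m ^ 2) := by
      have : E ^ 2 - m ^ 2 = (E + m) * (E - m) := by ring
      rw [this]; field_simp
    rw [e]
    exact div_le_div₀ hR.le hqb hδ1 h1
  · rw [mul_assoc, ← sq, hμ2]; field_simp
  · apply abs_le_of_sq_le_sq' _ (abs_nonneg _) |>.2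
    rw [sq_abs, hc2]; nlinarith
  · rw [hc2]; exact h2

lemma exists_bounds_of_tendsto_one {x : ℕ → ℝ} (hx : ∀ n, 0 < x n) (hlim : Tendsto x atTop (𝓝 1)) :
    ∃ l > 0, ∃ h > 0, ∀ n, l ≤ x n ∧ x n ≤ h := by
  obtain ⟨h, hh⟩ := hlim.bddAbove_range
  obtain ⟨i, hi⟩ := (hlim.inv₀ one_ne_zero).bddAbove_range
  have hi' : ∀ n, (x n)⁻¹ ≤ i := fun n => hi ⟨n, rfl⟩
  have hh' : ∀ n, x n ≤ h := fun n => hh ⟨n, rfl⟩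
  have hi0 : 0 < i := (inv_pos.2 (hx 0)).trans_le (hi' 0)
  exact ⟨i⁻¹, inv_pos.2 hi0, h, (hx 0).trans_le (hh' 0), fun n =>
    ⟨inv_le_of_inv_le₀ (hx n) (hi' n), hh' n⟩⟩

lemma tendsto_half_atTop : Tendsto (fun k : ℕ => k / 2) atTop atTop :=
  tendsto_atTop.2 fun b => (eventually_ge_atTop (2 * b)).mono fun k hk => by omega

lemma lintegral_rpow_le_rpow {Ω : Type*} [MeasurableSpace Ω] {P : Measure Ω}
    [IsProbabilityMeasure P] {f : Ω → ℂ} (hf : Measurable f) {s r : ℝ} (hs : 0 < s) (hsr : s ≤ r) :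
    ∫⁻ ω, ‖f ω‖ₑ ^ s ∂P ≤ (∫⁻ ω, ‖f ω‖ₑ ^ r ∂P) ^ (s / r) := by
  have h := eLpNorm'_le_eLpNorm'_of_exponent_le hs hsr P hf.aestronglyMeasurable
  unfold eLpNorm' at h
  have h2 := ENNReal.rpow_le_rpow h hs.le
  rwa [← ENNReal.rpow_mul, ← ENNReal.rpow_mul, one_div_mul_cancel hs.ne', ENNReal.rpow_one,
    one_div_mul_eq_div] at h2

lemma exists_rpow_mul_exp_le {q b e : ℝ} (hb : 0 < b) (he : 0 < e) :
    ∃ K > 0, ∀ n : ℕ, ((n : ℝ) + 1) ^ q * Real.exp (-b * ((n : ℝ) + 1) ^ e) ≤ K := by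
  have h1 := tendsto_rpow_mul_exp_neg_mul_atTop_nhds_zero (q / e) b hb
  have h2 : Tendsto (fun n : ℕ => ((n : ℝ) + 1) ^ e) atTop atTop :=
    (tendsto_rpow_atTop he).comp (tendsto_atTop_add_const_right _ _ tendsto_natCast_atTop_atTop)
  obtain ⟨K, hK⟩ := (h1.comp h2).bddAbove_range
  refine ⟨max K 1, by positivity, fun n => ?_⟩
  have h3 := hK ⟨n, rfl⟩
  simp only [Function.comp_apply] at h3
  rw [← Real.rpow_mul (by positivity), mul_div_cancel₀ _ he.ne'] at h3
  exact h3.trans (le_max_left _ _)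

/-- Asymptotics of the variance sequence along the chain. -/
lemma chain_scale_bounds {α lam : ℝ} (hα : 0 < α) (hlam : 0 < lam) {b : ℕ → ℝ} (hb : ∀ n, 0 < b n)
    (hlim : Tendsto (fun n : ℕ => ((n : ℝ) + 1) ^ α * b n) atTop (𝓝 1)) :
    (∀ ε > 0, ∀ᶠ k : ℕ in atTop, (lam * b (k / 2)) ^ 2 ≤ ε) ∧
    (∀ ε > 0, ∀ᶠ k : ℕ in atTop,
      |(lam * b ((k + 1) / 2)) ^ 2 - (lam * b (k / 2)) ^ 2| ≤ ε * (lam * b (k / 2)) ^ 2) ∧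
    ∀ C ν : ℝ, 0 < ν → ∀ ε > 0, ∀ᶠ k : ℕ in atTop,
      C * (((k / 2 : ℕ) : ℝ) + 1) ^ (-(2 * α + ν)) ≤ ε * (lam * b (k / 2)) ^ 2 := by
  have hcast : Tendsto (fun n : ℕ => (n : ℝ) + 1) atTop atTop :=
    tendsto_atTop_add_const_right _ _ tendsto_natCast_atTop_atTop
  have hp : ∀ n : ℕ, 0 < (n : ℝ) + 1 := fun n => by positivity
  have hb0 : Tendsto b atTop (𝓝 0) := by
    have h1 := ((tendsto_rpow_neg_atTop hα).comp hcast).mul hlim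
    rw [zero_mul] at h1
    refine h1.congr fun n => ?_
    simp only [Function.comp_apply]
    rw [← mul_assoc, ← Real.rpow_add (hp n)]; simp
  have hratio : Tendsto (fun n : ℕ => b (n + 1) / b n) atTop (𝓝 1) := by
    have h1 := (hlim.comp (tendsto_add_atTop_nat 1)).div hlim one_ne_zero
    have h2 : Tendsto (fun n : ℕ => (((n : ℝ) + 1) / ((n : ℝ) + 1 + 1)) ^ α) atTop (𝓝 1) := by
      have h3 := (tendsto_natCast_div_add_atTop (1 : ℝ)).comp (tendsto_add_atTop_nat 1)
      have h4 := h3.rpow_const (p := α) (Or.inl one_ne_zero)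
      rw [Real.one_rpow] at h4
      refine h4.congr fun n => ?_
      simp
    have h5 := h1.mul h2
    rw [div_one, one_mul] at h5
    refine h5.congr fun n => ?_
    simp only [Function.comp_apply, Pi.div_apply]
    have := hb n
    have := hp n
    have hp1 : 0 < (n : ℝ) + 1 + 1 := by positivity
    rw [Real.div_rpow (hp n).le hp1.le]
    push_cast
    have := Real.rpow_pos_of_pos (hp n) α
    have := Real.rpow_pos_of_pos hp1 α
    field_simp
  refine ⟨?_, ?_, ?_⟩
  · intro ε hε
    have h1 : Tendsto (fun n => (lam * b n) ^ 2) atTop (𝓝 0) := by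
      have := (hb0.const_mul lam).pow 2
      simpa using this
    exact tendsto_half_atTop.eventually (h1.eventually (eventually_le_nhds hε))
  · intro ε hε
    have h1 : Tendsto (fun n => |(b (n + 1) / b n) ^ 2 - 1|) atTop (𝓝 0) := by
      have := ((hratio.pow 2).sub_const 1).abs
      simpa using this
    filter_upwards [tendsto_half_atTop.eventually (h1.eventually (eventually_le_nhds hε))] with k hk
    have hbk := hb (k / 2)
    have hpos : 0 ≤ ε * (lam * b (k / 2)) ^ 2 := by positivity
    rcases Nat.even_or_odd' k with ⟨j, hj | hj⟩
    · have : (k + 1) / 2 = k / 2 := by omega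
      rw [this, sub_self, abs_zero]; exact hpos
    · have : (k + 1) / 2 = k / 2 + 1 := by omega
      rw [this]
      have e : (lam * b (k / 2 + 1)) ^ 2 - (lam * b (k / 2)) ^ 2 =
          ((b (k / 2 + 1) / b (k / 2)) ^ 2 - 1) * (lam * b (k / 2)) ^ 2 := by
        field_simp
      rw [e, abs_mul, abs_of_nonneg (sq_nonneg (lam * b (k / 2)))]
      gcongr
  · intro C ν hν ε hε
    have h1 : Tendsto (fun n : ℕ => C * ((n : ℝ) + 1) ^ (-ν) /
        (((n : ℝ) + 1) ^ α * b n) ^ 2) atTop (𝓝 0) := by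
      have := (((tendsto_rpow_neg_atTop hν).comp hcast).const_mul C).div (hlim.pow 2) (by simp)
      rw [mul_zero, zero_div] at this
      exact this
    have hε' : 0 < ε * lam ^ 2 := by positivity
    filter_upwards [tendsto_half_atTop.eventually (h1.eventually (eventually_le_nhds hε'))]
      with k hk
    have hbk := hb (k / 2)
    obtain ⟨x, hx⟩ : ∃ x : ℝ, x = ((k / 2 : ℕ) : ℝ) + 1 := ⟨_, rfl⟩
    have hx0 : 0 < x := by rw [hx]; positivity
    rw [← hx] at hk ⊢
    rw [div_le_iff₀ (by positivity)] at hk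
    have e : x ^ (-(2 * α + ν)) = x ^ (-ν) * x ^ (-(2 * α)) := by
      rw [← Real.rpow_add hx0]; congr 1; ring
    have e2 : (x ^ α) ^ 2 * x ^ (-(2 * α)) = 1 := by
      rw [← Real.rpow_natCast, ← Real.rpow_mul hx0.le, ← Real.rpow_add hx0]
      push_cast
      rw [show α * 2 + -(2 * α) = 0 by ring, Real.rpow_zero]
    rw [e, ← mul_assoc]
    calc C * x ^ (-ν) * x ^ (-(2 * α)) ≤ ε * lam ^ 2 * (x ^ α * b (k / 2)) ^ 2 * x ^ (-(2 * α)) := by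
          gcongr
      _ = ε * lam ^ 2 * b (k / 2) ^ 2 * ((x ^ α) ^ 2 * x ^ (-(2 * α))) := by ring
      _ = _ := by rw [e2]; ring

/-- As b(n) is comparable to (n+1)^{-α}, the density factors grow at most polynomially, while the
sum of variances is at least of order n^{1-2α} with 1-2α > 0, so the exponential wins. -/
lemma chain_factor_le {α lam γ A D κ l h : ℝ} (hα : 0 < α) (hα' : α < 1 / 2) (hlam : 0 < lam)
    (hγ : 0 ≤ γ) (hA : 1 ≤ A) (hD : 0 ≤ D) (hκ : 0 < κ) (hl : 0 < l) {b : ℕ → ℝ}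
    (hb : ∀ n, 0 < b n)
    (hlh : ∀ n : ℕ, l ≤ ((n : ℝ) + 1) ^ α * b n ∧ ((n : ℝ) + 1) ^ α * b n ≤ h) :
    ∃ c > 0, ∃ K > 0, ∀ k : ℕ,
      (A + D * b (k / 2) ^ (-γ)) * (1 + (lam * b ((k - 1) / 2)) ^ 2
          + (A + D * b ((k - 1) / 2) ^ (-γ))) *
        Real.exp (-κ * ∑ i ∈ Finset.range (k - 1), (lam * b (i / 2)) ^ 2) ≤
      K * Real.exp (-c * (((k / 2 : ℕ) : ℝ) + 1) ^ (1 - 2 * α)) := by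
  have hh : 0 < h := hl.trans_le ((hlh 0).1.trans (hlh 0).2)
  have hlow : ∀ i n : ℕ, i ≤ n → l * ((n : ℝ) + 1) ^ (-α) ≤ b i := by
    intro i n hin
    have hi : (0 : ℝ) < (i : ℝ) + 1 := by positivity
    have h1 : ((n : ℝ) + 1) ^ (-α) ≤ ((i : ℝ) + 1) ^ (-α) :=
      Real.rpow_le_rpow_of_nonpos hi (by gcongr) (by linarith)
    calc l * ((n : ℝ) + 1) ^ (-α) ≤ (((i : ℝ) + 1) ^ α * b i) * ((i : ℝ) + 1) ^ (-α) := by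
          exact mul_le_mul (hlh i).1 h1 (by positivity) (hl.le.trans (hlh i).1)
      _ = b i * (((i : ℝ) + 1) ^ α * ((i : ℝ) + 1) ^ (-α)) := by ring
      _ = b i := by rw [← Real.rpow_add hi]; simp
  have hup : ∀ i : ℕ, b i ≤ h := by
    intro i
    have h1 : 1 ≤ ((i : ℝ) + 1) ^ α :=
      Real.one_le_rpow (by linarith [Nat.cast_nonneg (α := ℝ) i]) hα.le
    exact (le_mul_of_one_le_left (hb i).le h1).trans (hlh i).2
  obtain ⟨w, hw⟩ : ∃ w, w = lam ^ 2 * l ^ 2 := ⟨_, rfl⟩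
  have hw0 : 0 < w := by rw [hw]; positivity
  obtain ⟨M, hM⟩ : ∃ M, M = A + D * l ^ (-γ) := ⟨_, rfl⟩
  have hM1 : 1 ≤ M := by
    have : 0 ≤ D * l ^ (-γ) := by positivity
    rw [hM]; linarith
  have hBle : ∀ i n : ℕ, i ≤ n → A + D * b i ^ (-γ) ≤ M * ((n : ℝ) + 1) ^ (α * γ) := by
    intro i n hin
    have hn : (0 : ℝ) < (n : ℝ) + 1 := by positivity
    have h1 : b i ^ (-γ) ≤ l ^ (-γ) * ((n : ℝ) + 1) ^ (α * γ) := by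
      calc b i ^ (-γ) ≤ (l * ((n : ℝ) + 1) ^ (-α)) ^ (-γ) :=
            Real.rpow_le_rpow_of_nonpos (by positivity) (hlow i n hin) (by linarith)
        _ = _ := by
            rw [Real.mul_rpow hl.le (by positivity), ← Real.rpow_mul hn.le, neg_mul_neg]
    have h2 : 1 ≤ ((n : ℝ) + 1) ^ (α * γ) :=
      Real.one_le_rpow (by linarith [Nat.cast_nonneg (α := ℝ) n]) (by positivity)
    calc A + D * b i ^ (-γ) ≤ A * ((n : ℝ) + 1) ^ (α * γ)
          + D * (l ^ (-γ) * ((n : ℝ) + 1) ^ (α * γ)) := by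
          gcongr
          exact le_mul_of_one_le_right (by linarith) h2
      _ = _ := by rw [hM]; ring
  -- Half of the rate κw absorbs the polynomial (n+1)^{2αγ}; the other half is the final rate.
  obtain ⟨K₀, hK₀, hexp⟩ := exists_rpow_mul_exp_le (q := α * γ + α * γ) (b := κ * w / 2)
    (e := 1 - 2 * α) (by positivity) (by linarith)
  refine ⟨κ * w / 2, by positivity,
    M * (1 + (lam * h) ^ 2 + M) * Real.exp (2 * κ * w) * K₀, by positivity, fun k => ?_⟩
  obtain ⟨n, hn⟩ : ∃ n, n = k / 2 := ⟨_, rfl⟩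
  have hn' : (k - 1) / 2 ≤ n := by omega
  have h1 := hBle (k / 2) n hn.ge
  have h2 := hBle ((k - 1) / 2) n hn'
  have hx0 : (0 : ℝ) < (n : ℝ) + 1 := by positivity
  have hx1 : 1 ≤ ((n : ℝ) + 1) ^ (α * γ) :=
    Real.one_le_rpow (by linarith [Nat.cast_nonneg (α := ℝ) n]) (by positivity)
  have h3 : 1 + (lam * b ((k - 1) / 2)) ^ 2 + (A + D * b ((k - 1) / 2) ^ (-γ)) ≤
      (1 + (lam * h) ^ 2 + M) * ((n : ℝ) + 1) ^ (α * γ) := by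
    have h4 : (lam * b ((k - 1) / 2)) ^ 2 ≤ (lam * h) ^ 2 := by
      have := hb ((k - 1) / 2)
      have := hup ((k - 1) / 2)
      gcongr
    have h5 : 1 + (lam * h) ^ 2 ≤ (1 + (lam * h) ^ 2) * ((n : ℝ) + 1) ^ (α * γ) :=
      le_mul_of_one_le_right (by positivity) hx1
    linarith
  -- Each of the k-1 terms is at least w(n+1)^{-2α}, and k-1 ≥ n-1 = (n+1)-2 with n = k/2; the two
  -- missing terms cost at most 2w.
  have hsum : w * (((n : ℝ) + 1) ^ (1 - 2 * α) - 2) ≤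
      ∑ i ∈ Finset.range (k - 1), (lam * b (i / 2)) ^ 2 := by
    have h4 : ∀ i ∈ Finset.range (k - 1),
        w * ((n : ℝ) + 1) ^ (-(2 * α)) ≤ (lam * b (i / 2)) ^ 2 := by
      intro i hi
      rw [Finset.mem_range] at hi
      have h5 := hlow (i / 2) n (by omega)
      calc w * ((n : ℝ) + 1) ^ (-(2 * α)) = (lam * (l * ((n : ℝ) + 1) ^ (-α))) ^ 2 := by
            rw [mul_pow, mul_pow, ← Real.rpow_natCast (((n : ℝ) + 1) ^ (-α)),
              ← Real.rpow_mul hx0.le, hw]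
            push_cast
            rw [show -α * 2 = -(2 * α) by ring]; ring
        _ ≤ _ := by gcongr
    have h6 := Finset.card_nsmul_le_sum _ _ _ h4
    rw [Finset.card_range, nsmul_eq_mul] at h6
    refine le_trans ?_ h6
    have h7 : (n : ℝ) + 1 - 2 ≤ ((k - 1 : ℕ) : ℝ) := by
      have : n ≤ (k - 1) + 1 := by omega
      have : (n : ℝ) ≤ ((k - 1 : ℕ) : ℝ) + 1 := by exact_mod_cast this
      linarith
    have h8 : ((n : ℝ) + 1) ^ (-(2 * α)) ≤ 1 :=
      Real.rpow_le_one_of_one_le_of_nonpos (by linarith [Nat.cast_nonneg (α := ℝ) n]) (by linarith)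
    have h9 : ((n : ℝ) + 1) ^ (1 - 2 * α) = ((n : ℝ) + 1) * ((n : ℝ) + 1) ^ (-(2 * α)) := by
      rw [sub_eq_add_neg, Real.rpow_add hx0, Real.rpow_one]
    have h10 : 0 < ((n : ℝ) + 1) ^ (-(2 * α)) := by positivity
    calc w * (((n : ℝ) + 1) ^ (1 - 2 * α) - 2)
        ≤ w * (((n : ℝ) + 1 - 2) * ((n : ℝ) + 1) ^ (-(2 * α))) := by
          gcongr; rw [h9]; linarith
      _ ≤ w * (((k - 1 : ℕ) : ℝ) * ((n : ℝ) + 1) ^ (-(2 * α))) := by gcongr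
      _ = _ := by ring
  have hE : Real.exp (-κ * ∑ i ∈ Finset.range (k - 1), (lam * b (i / 2)) ^ 2) ≤
      Real.exp (2 * κ * w) * (Real.exp (-(κ * w / 2) * ((n : ℝ) + 1) ^ (1 - 2 * α)) *
        Real.exp (-(κ * w / 2) * ((n : ℝ) + 1) ^ (1 - 2 * α))) := by
    rw [← Real.exp_add, ← Real.exp_add]
    apply Real.exp_le_exp.2
    have := mul_le_mul_of_nonneg_left hsum hκ.le
    linarith
  have hxe := hexp n
  rw [Real.rpow_add hx0] at hxe
  have hb1 := hb (k / 2)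
  have hb2 := hb ((k - 1) / 2)
  rw [← hn] at h1 ⊢
  have hB0 : 0 ≤ A + D * b ((k - 1) / 2) ^ (-γ) := by positivity
  calc _ ≤ (M * ((n : ℝ) + 1) ^ (α * γ)) *
        ((1 + (lam * h) ^ 2 + M) * ((n : ℝ) + 1) ^ (α * γ)) *
        (Real.exp (2 * κ * w) * (Real.exp (-(κ * w / 2) * ((n : ℝ) + 1) ^ (1 - 2 * α)) *
        Real.exp (-(κ * w / 2) * ((n : ℝ) + 1) ^ (1 - 2 * α)))) := by
        gcongr
    _ = M * (1 + (lam * h) ^ 2 + M) * Real.exp (2 * κ * w) *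
        (((n : ℝ) + 1) ^ (α * γ) * ((n : ℝ) + 1) ^ (α * γ) *
          Real.exp (-(κ * w / 2) * ((n : ℝ) + 1) ^ (1 - 2 * α))) *
        Real.exp (-(κ * w / 2) * ((n : ℝ) + 1) ^ (1 - 2 * α)) := by ring
    _ ≤ _ := by gcongr


/-! ### Assembly of the estimates. -/

lemma noiseLaw_map {Ω : Type*} [MeasurableSpace Ω] {P : Measure Ω} [IsProbabilityMeasure P]
    {X : Ω → ℝ} (hX : Measurable X) {σ η : ℝ} (h1 : Integrable X P)
    (hmean : ∫ ω, X ω ∂P = 0) (h2 : Integrable (fun ω => X ω ^ 2) P)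
    (hvar : √(∫ ω, X ω ^ 2 ∂P) = σ) (h3 : Integrable (fun ω => |X ω| ^ 3) P)
    (hthird : ∫ ω, |X ω| ^ 3 ∂P ≤ η) : NoiseLaw (P.map X) (σ ^ 2) η where
  prob := Measure.isProbabilityMeasure_map hX.aemeasurable
  int1 := (integrable_map_measure (by fun_prop) hX.aemeasurable).2 h1
  int2 := (integrable_map_measure (by fun_prop) hX.aemeasurable).2 h2
  int3 := (integrable_map_measure (by fun_prop) hX.aemeasurable).2 h3
  mean := (integral_map hX.aemeasurable (by fun_prop)).trans hmean
  var := by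
    rw [integral_map hX.aemeasurable (by fun_prop), ← hvar,
      Real.sq_sqrt (integral_nonneg fun ω => sq_nonneg _)]
  third := (integral_map hX.aemeasurable (by fun_prop)).trans_le hthird

/-- Exponential decay of a fractional moment of the Green's function along the chain of sites, with
respect to the later of its two arguments. -/
lemma green_moment_le_exp {Ω : Type*} [MeasurableSpace Ω] {P : Measure Ω} [IsProbabilityMeasure P]
    {m α lam : ℝ} (hm : 0 ≤ m) (hα : 0 < α) (hα' : α < 1 / 2) (hlam : 0 < lam) {b : ℕ → ℝ}
    (hb : ∀ n, 0 < b n) (hlim : Tendsto (fun n : ℕ => ((n : ℝ) + 1) ^ α * b n) atTop (𝓝 1))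
    {Y : ℕ → Ω → ℝ} (hY : ∀ k, Measurable (Y k)) (hind : iIndepFun Y P)
    {C₃ ε : ℝ} (hε : 0 < ε) (hlaw : ∀ k, NoiseLaw (P.map (Y k)) ((lam * b (k / 2)) ^ 2)
      (C₃ * (((k / 2 : ℕ) : ℝ) + 1) ^ (-(2 * α + ε))))
    {p γ D : ℝ} (hp : 1 < p) (hγ : 0 ≤ γ) (hD : 0 < D)
    (hdens : ∀ k, HasLpDensity P (Y k) p (D * b (k / 2) ^ (-γ)))
    {E₁ E₂ : ℝ} (hI : Set.Icc E₁ E₂ ⊆ openBands m) :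
    ∃ r > (0 : ℝ), ∃ c > (0 : ℝ), ∀ j : ℕ, ∃ C > (0 : ℝ), ∀ E ∈ Set.Icc E₁ E₂,
      ∀ (Λ : Finset Site) (N : ℕ), (∀ x, x ∈ Λ ↔ idx x < N) →
      (∀ᵐ ω ∂P, HasResolvent m (fun x => Y (idx x) ω) Λ E) ∧
      ∀ k, j ≤ k → k < N →
        ∫⁻ ω, ‖green m (fun x => Y (idx x) ω) Λ E (site j) (site k)‖ₑ ^ r ∂P ≤
          ENNReal.ofReal (C * Real.exp (-c * (((k / 2 : ℕ) : ℝ) + 1) ^ (1 - 2 * α))) := by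
  obtain ⟨δ, hδ, hδ1, s₀, hs₀, hs₀1, hband⟩ := exists_band hm hI
  have hpq := Real.HolderConjugate.conjExponent hp
  obtain ⟨q, hq⟩ : ∃ q, q = Real.conjExponent p := ⟨_, rfl⟩
  rw [← hq] at hpq
  have hq0 : 0 < q := hpq.symm.pos
  -- The three constraints serve the drift estimate, the condition 4t ≤ 1, and the integrability of
  -- |y|^{-4tq} near 0, since 4tq ≤ 1/2.
  obtain ⟨t, ht⟩ : ∃ t, t = min (s₀ ^ 2 * δ ^ 3 / (2048 * (1 / s₀) ^ 2)) (min (1 / 4) (1 / (8 * q))) :=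
    ⟨_, rfl⟩
  have ht0 : 0 < t := by rw [ht]; positivity
  have ht1 : t ≤ s₀ ^ 2 * δ ^ 3 / (2048 * (1 / s₀) ^ 2) := by rw [ht]; exact min_le_left _ _
  have ht4 : 4 * t ≤ 1 := by
    have : t ≤ 1 / 4 := by rw [ht]; exact (min_le_right _ _).trans (min_le_left _ _)
    linarith
  have htq : t * (8 * q) ≤ 1 := by
    have : t ≤ 1 / (8 * q) := by rw [ht]; exact (min_le_right _ _).trans (min_le_right _ _)
    rwa [le_div_iff₀ (by positivity)] at this
  obtain ⟨K₂, hK₂, hm₂⟩ := exists_lintegral_enorm_add_rpow_le hpq (r := 2 * t) (by positivity)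
    (by nlinarith)
  obtain ⟨K₄, hK₄, hm₄⟩ := exists_lintegral_enorm_add_rpow_le hpq (r := 4 * t) (by positivity)
    (by nlinarith)
  have hbD : ∀ k, 0 < D * b (k / 2) ^ (-γ) := fun k => by have := hb (k / 2); positivity
  obtain ⟨hβ, hββ, hτ⟩ := chain_scale_bounds hα hlam hb hlim
  obtain ⟨κ, hκ, hdec⟩ := green_moment_decay hδ hδ1 hs₀ hs₀1 ht0 ht4 ht1 hY hind (m := m)
    (β := fun k => (lam * b (k / 2)) ^ 2) (B := fun k => 1 + K₂ + K₄ + D * b (k / 2) ^ (-γ))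
    (fun k => by have := hb (k / 2); positivity) hβ hββ (hτ C₃ ε hε) hlaw
    (fun k => by have := hbD k; linarith)
    (fun k a => (hm₂ P (Y k) _ (hY k) (hbD k).le (hdens k) a).trans
      (ENNReal.ofReal_le_ofReal (by linarith)))
    (fun k a => (hm₄ P (Y k) _ (hY k) (hbD k).le (hdens k) a).trans
      (ENNReal.ofReal_le_ofReal (by linarith)))
  obtain ⟨l, hl, h, -, hlh⟩ := exists_bounds_of_tendsto_one
    (fun n => by have := hb n; positivity) hlim
  obtain ⟨c, hc, K, hK, hfac⟩ := chain_factor_le hα hα' hlam hγ (A := 1 + K₂ + K₄) (by linarith)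
    hD.le hκ hl hb hlh
  refine ⟨2 * t, by positivity, c, hc, fun j => ?_⟩
  obtain ⟨C, hC, hdecj⟩ := hdec j
  refine ⟨C * K, by positivity, fun E hE Λ N hΛ => ?_⟩
  obtain ⟨e, μ, hB⟩ := hband E hE
  obtain ⟨hne, hgr⟩ := hdecj E e μ hB
  refine ⟨?_, fun k hjk hkN => (hgr Λ N hΛ k hjk hkN).trans (ENNReal.ofReal_le_ofReal ?_)⟩
  · filter_upwards [hne N] with ω hω
    refine hasResolvent_of_state_ne_zero hB.μ0 hB.hc hB.hc' hΛ _ ?_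
    simp only [idx_site]
    exact hω
  · rw [mul_assoc C K]
    exact mul_le_mul_of_nonneg_left (hfac k) hC.le

/-- Symmetric form of an exponential bound on the Green's function, uniform for sources in the
first `M` sites of the chain. -/
lemma exists_green_moment_le {Ω : Type*} [MeasurableSpace Ω] {P : Measure Ω} {m r c e : ℝ}
    (hc : 0 < c) (he : 0 < e) {Y : ℕ → Ω → ℝ} {S : Set ℝ}
    (hdec : ∀ j : ℕ, ∃ C > 0, ∀ E ∈ S, ∀ (Λ : Finset Site) (N : ℕ), (∀ x, x ∈ Λ ↔ idx x < N) →
      ∀ k, j ≤ k → k < N →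
        ∫⁻ ω, ‖green m (fun x => Y (idx x) ω) Λ E (site j) (site k)‖ₑ ^ r ∂P ≤
          ENNReal.ofReal (C * Real.exp (-c * (((k / 2 : ℕ) : ℝ) + 1) ^ e))) (M : ℕ) :
    ∃ C > 0, ∀ E ∈ S, ∀ (Λ : Finset Site) (N : ℕ), (∀ x, x ∈ Λ ↔ idx x < N) →
      ∀ j k, j < M → j < N → k < N →
        ∫⁻ ω, ‖green m (fun x => Y (idx x) ω) Λ E (site j) (site k)‖ₑ ^ r ∂P ≤
          ENNReal.ofReal (C * Real.exp (-c * (((k / 2 : ℕ) : ℝ) + 1) ^ e)) := by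
  choose C hC hle using hdec
  have hsum : ∀ i < M, C i ≤ 1 + ∑ i ∈ Finset.range M, C i := fun i hi => by
    have := Finset.single_le_sum (fun i _ => (hC i).le) (Finset.mem_range.2 hi)
    linarith
  have hsum0 : 0 ≤ ∑ i ∈ Finset.range M, C i := Finset.sum_nonneg fun i _ => (hC i).le
  refine ⟨1 + ∑ i ∈ Finset.range M, C i, by linarith, fun E hE Λ N hΛ j k hj hjN hkN => ?_⟩
  -- For k ≤ j the symmetry moves the bound to the position j, where the exponential is smaller
  -- still; k < M then keeps the constant uniform.
  rcases le_total j k with h | h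
  · refine (hle j E hE Λ N hΛ k h hkN).trans (ENNReal.ofReal_le_ofReal ?_)
    gcongr
    exact hsum j hj
  · simp only [green_symm _ (site j)]
    refine (hle k E hE Λ N hΛ j h hjN).trans (ENNReal.ofReal_le_ofReal ?_)
    have h1 : (((k / 2 : ℕ) : ℝ) + 1) ^ e ≤ (((j / 2 : ℕ) : ℝ) + 1) ^ e := by
      gcongr
    gcongr ?_ * Real.exp ?_
    · exact hsum k (h.trans_lt hj)
    · nlinarith

lemma lintegral_rpow_le_of_le {Ω : Type*} [MeasurableSpace Ω] {P : Measure Ω}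
    [IsProbabilityMeasure P] {f : Ω → ℂ} (hf : Measurable f) {s r C c x : ℝ} (hs : 0 < s)
    (hsr : s ≤ r) (hC : 0 < C)
    (h : ∫⁻ ω, ‖f ω‖ₑ ^ r ∂P ≤ ENNReal.ofReal (C * Real.exp (-c * x))) :
    ∫⁻ ω, ‖f ω‖ₑ ^ s ∂P ≤ ENNReal.ofReal (C ^ (s / r) * Real.exp (-(c * (s / r)) * x)) := by
  have hr : 0 < s / r := div_pos hs (hs.trans_le hsr)
  refine (lintegral_rpow_le_rpow hf hs hsr).trans ((ENNReal.rpow_le_rpow h hr.le).trans_eq ?_)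
  rw [ENNReal.ofReal_rpow_of_nonneg (by positivity) hr.le,
    Real.mul_rpow hC.le (Real.exp_pos _).le, ← Real.exp_mul]
  congr 3
  ring

lemma idx_lt_two_mul (x : Site) : idx x < 2 * (x.1 : ℕ) := by
  have := PNat.natPred_add_one x.1
  unfold idx
  split_ifs <;> omega

lemma cast_idx_half_add_one (x : Site) : ((idx x / 2 : ℕ) : ℝ) + 1 = (x.1 : ℝ) := by
  have h := PNat.natPred_add_one x.1
  have : idx x / 2 + 1 = (x.1 : ℕ) := by
    unfold idx
    split_ifs <;> omega
  exact_mod_cast this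

end DecayingDirac

theorem mainTheorem8
    {Ω : Type*} [MeasurableSpace Ω] (P : Measure Ω) [IsProbabilityMeasure P]
    (m α lam : ℝ) (hm : 0 ≤ m) (hα : 0 < α) (hα' : α < 1 / 2) (hlam : 0 < lam)
    (a : ℕ+ → ℝ) (ha : ∀ n, 0 < a n)
    (ha_lim : Tendsto (fun n : ℕ+ => (n : ℝ) ^ α * a n) atTop (𝓝 1))
    -- `V (n, +)` and `V (n, -)` are the random variables `V_{ω,1}(n)` and `V_{ω,2}(n)`
    (V : DecayingDirac.Site → Ω → ℝ)
    (hV_meas : ∀ x, Measurable (V x)) (hV_int : ∀ x, Integrable (V x) P)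
    -- (A1)
    (hA1 : iIndepFun V P)
    -- (A2)
    (hA2 : ∀ x, ∫ ω, V x ω ∂P = 0)
    -- (A3a)
    (hA3a : ∀ x, Integrable (fun ω => V x ω ^ 2) P ∧ √(∫ ω, V x ω ^ 2 ∂P) = lam * a x.1)
    -- (A5)
    (hA5 : ∃ C > (0 : ℝ), ∃ ε > (0 : ℝ), ∀ x, Integrable (fun ω => |V x ω| ^ 3) P ∧
      ∫ ω, |V x ω| ^ 3 ∂P ≤ C * (x.1 : ℝ) ^ (-(2 * α + ε)))
    -- (A6a)
    (hA6a : ∃ p > (1 : ℝ), ∃ γ ≥ (0 : ℝ), ∃ C > (0 : ℝ), ∀ x,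
      DecayingDirac.HasLpDensity P (V x) p (C * lam ^ (-γ) * a x.1 ^ (-γ)))
    (E₁ E₂ : ℝ) (hI : Set.Icc E₁ E₂ ⊆ DecayingDirac.openBands m) :
    (∀ L : ℕ+, ∀ E ∈ Set.Icc E₁ E₂,
      (∀ᵐ ω ∂P, DecayingDirac.HasResolvent m (fun x => V x ω) (DecayingDirac.box L) E) ∧
      (∀ᵐ ω ∂P, DecayingDirac.HasResolvent m (fun x => V x ω) (DecayingDirac.box' L) E)) ∧
    ∃ s₀ > (0 : ℝ), ∀ s : ℝ, 0 < s → s ≤ s₀ → ∀ u : ℕ+, ∃ c > (0 : ℝ), ∃ C > (0 : ℝ),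
      ∀ L n : ℕ+, u ≤ L → n ≤ L → ∀ E ∈ Set.Icc E₁ E₂, ∀ σ : DecayingDirac.Spin,
        ∫⁻ ω, ‖DecayingDirac.green m (fun x => V x ω) (DecayingDirac.box L) E
            (u, σ) (n, DecayingDirac.Spin.minus)‖ₑ ^ s ∂P
          ≤ ENNReal.ofReal (C * lam ^ (-2 * s) * a n ^ (-2 * s) *
              Real.exp (-c * (n : ℝ) ^ (1 - 2 * α))) ∧
        ∫⁻ ω, ‖DecayingDirac.green m (fun x => V x ω) (DecayingDirac.box' L) E
            (u, σ) (n, DecayingDirac.Spin.plus)‖ₑ ^ s ∂P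
          ≤ ENNReal.ofReal (C * lam ^ (-2 * s) * a n ^ (-2 * s) *
              Real.exp (-c * (n : ℝ) ^ (1 - 2 * α))) := by
  obtain ⟨C₃, -, ε, hε, h3⟩ := hA5
  obtain ⟨p, hp, γ, hγ, D, hD, hdens⟩ := hA6a
  have hsucc : Tendsto Nat.succPNat atTop atTop :=
    tendsto_atTop_atTop_of_monotone (fun _ _ h => Nat.succPNat_le_succPNat.2 h)
      fun x => ⟨x.natPred, by rw [PNat.succPNat_natPred]⟩
  have hlim : Tendsto (fun n : ℕ => ((n : ℝ) + 1) ^ α * a (Nat.succPNat n)) atTop (𝓝 1) := by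
    refine (ha_lim.comp hsucc).congr fun n => ?_
    simp
  obtain ⟨r, hr, c, hc, hdec⟩ := DecayingDirac.green_moment_le_exp hm hα hα' hlam
    (b := fun n => a (Nat.succPNat n)) (fun n => ha _) hlim
    (Y := fun k => V (DecayingDirac.site k)) (fun k => hV_meas _)
    (hA1.precomp DecayingDirac.site_injective) (C₃ := C₃) hε
    (fun k => by
      have h := h3 (DecayingDirac.site k)
      refine DecayingDirac.noiseLaw_map (hV_meas _) (hV_int _) (hA2 _) (hA3a _).1 (hA3a _).2 h.1
        (h.2.trans_eq ?_)
      simp [DecayingDirac.site])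
    hp hγ (D := D * lam ^ (-γ)) (by positivity) (fun k => hdens _) hI
  simp only [DecayingDirac.site_idx] at hdec
  refine ⟨fun L E hE => ?_, r, hr, fun s hs hsr u => ?_⟩
  · obtain ⟨C, -, hC⟩ := hdec 0
    exact ⟨(hC E hE _ _ (DecayingDirac.mem_box_iff L)).1,
      (hC E hE _ _ (DecayingDirac.mem_box'_iff L)).1⟩
  -- Both sites (u,±) have chain position below 2u, so M = 2u gives a constant depending on u but
  -- not on σ.
  obtain ⟨C, hC, hgr⟩ := DecayingDirac.exists_green_moment_le (P := P) (m := m) (r := r) hc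
    (e := 1 - 2 * α) (by linarith) (Y := fun k => V (DecayingDirac.site k))
    (S := Set.Icc E₁ E₂) (fun j => by
      obtain ⟨C, hC, h⟩ := hdec j
      refine ⟨C, hC, fun E hE Λ N hΛ => ?_⟩
      simpa only [DecayingDirac.site_idx] using (h E hE Λ N hΛ).2) (2 * u)
  simp only [DecayingDirac.site_idx] at hgr
  obtain ⟨l, -, h, hh, hlh⟩ := DecayingDirac.exists_bounds_of_tendsto_one
    (fun n => by have := ha (Nat.succPNat n); positivity) hlim
  have hah : ∀ n, a n ≤ h := fun n => by
    have h1 := (hlh n.natPred).2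
    rw [PNat.succPNat_natPred] at h1
    exact (le_mul_of_one_le_left (ha n).le (Real.one_le_rpow (by simp) hα.le)).trans h1
  have hs' : 0 < s / r := div_pos hs hr
  -- The proof yields a bound without the factor λ^{-2s}a_n^{-2s}. As a_n ≤ h, putting λ^{2s}h^{2s}
  -- into the constant makes the product with that factor at least 1.
  refine ⟨c * (s / r), by positivity, C ^ (s / r) * (lam ^ (2 * s) * h ^ (2 * s)), by positivity,
    fun L n hu hn E hE σ => ?_⟩
  have key : ∀ (Λ : Finset DecayingDirac.Site) (N : ℕ),
      (∀ x, x ∈ Λ ↔ DecayingDirac.idx x < N) → ∀ τ : DecayingDirac.Spin,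
      ∫⁻ ω, ‖DecayingDirac.green m (fun x => V x ω) Λ E (u, σ) (n, τ)‖ₑ ^ s ∂P ≤
        ENNReal.ofReal (C ^ (s / r) * (lam ^ (2 * s) * h ^ (2 * s)) * lam ^ (-2 * s) *
          a n ^ (-2 * s) * Real.exp (-(c * (s / r)) * (n : ℝ) ^ (1 - 2 * α))) := by
    intro Λ N hΛ τ
    -- Outside the box, for instance at (L,+) for `box L`, the Green's function is 0 by definition
    -- and the bound is trivial since s > 0.
    by_cases hmem : (u, σ) ∈ Λ ∧ (n, τ) ∈ Λ
    · have h1 := hgr E hE Λ N hΛ (DecayingDirac.idx (u, σ)) (DecayingDirac.idx (n, τ))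
        (DecayingDirac.idx_lt_two_mul _) ((hΛ _).1 hmem.1) ((hΛ _).1 hmem.2)
      rw [DecayingDirac.cast_idx_half_add_one, DecayingDirac.site_idx,
        DecayingDirac.site_idx] at h1
      refine (DecayingDirac.lintegral_rpow_le_of_le
        (DecayingDirac.measurable_green _ _ |>.comp (measurable_pi_lambda _ hV_meas)) hs hsr hC
        h1).trans (ENNReal.ofReal_le_ofReal ?_)
      have h2 : 1 ≤ lam ^ (2 * s) * h ^ (2 * s) * (lam ^ (-2 * s) * a n ^ (-2 * s)) := by
        have han := ha n
        have h3 : a n ^ (2 * s) ≤ h ^ (2 * s) := Real.rpow_le_rpow han.le (hah n) (by positivity)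
        rw [show -2 * s = -(2 * s) by ring, Real.rpow_neg hlam.le, Real.rpow_neg han.le]
        have h4 : 0 < a n ^ (2 * s) := by positivity
        have h5 : 0 < lam ^ (2 * s) := by positivity
        calc (1 : ℝ) = a n ^ (2 * s) * (a n ^ (2 * s))⁻¹ := by field_simp
          _ ≤ h ^ (2 * s) * (a n ^ (2 * s))⁻¹ := by gcongr
          _ = _ := by field_simp
      have h3 : 0 ≤ C ^ (s / r) * Real.exp (-(c * (s / r)) * (n : ℝ) ^ (1 - 2 * α)) := by
        positivity
      calc _ ≤ _ := le_mul_of_one_le_right h3 h2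
        _ = _ := by ring
    · simp [DecayingDirac.green, hmem, hs]
  exact ⟨key _ _ (DecayingDirac.mem_box_iff L) _, key _ _ (DecayingDirac.mem_box'_iff L) _⟩
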